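/- **Setting.** Let $(N_1,\mathcal I_1),\dots,(N_m,\mathcal I_m)$ be finite matroids, $N=\bigcup_\ell N_\ell$, and call $S\subseteq N$ *independent* ($S\in\mathcal I$) if $S\cap N_\ell\in\mathcal I_\ell$ for all $\ell$. The pair $(N,\mathcal I)$ is a *$p$-matchoid* if every $e\in N$ lies in at most $p$ of the sets $N_\ell$. Let $f:2^N\to\mathbb R_{\ge 0}$ be submodular, i.e. $f(S\cup T)+f(S\cap T)\le f(S)+f(T)$ for all $S,T\subseteq N$, and let $\mathrm{OPT}=\max_{S\in\mathcal I}f(S)$. An *offline algorithm with approximation ratio $\gamma>0$* returns, for every $B\subseteq N$, a (possibly random) independent set $S\subseteq B$ with $\mathbb E[f(S)]\ge\gamma\cdot\max\{f(T): T\subseteq B,\ T\in\mathcal I\}$. A *one-pass streaming algorithm* reads the elements of $N$ one at a time, each exactly once, in an arbitrary order. Its memory is initially empty and is a list of words, each holding one stream element or one control bit; its space is the largest number of words held between two elements of the stream. Neither $N$, nor $f$, nor the matroids are known in advance ($m$, $k$ and $\varepsilon$ are). While processing an element, the algorithm may make random choices and may call a value oracle for $f$, oracles deciding $S\in\mathcal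 I_\ell$ and $e\in N_\ell$, and the offline algorithm as a black box, but only on elements that are in memory at that moment or are just being read, and it may keep only such elements; its output is computed in the same way from the final memory, and consists of elements in memory. **Theorem.** There are absolute constants $C$ and $d$ such that for all $m$, all $k\ge 2$ and all $\varepsilon>0$ there is a randomized one-pass streaming algorithm with the following property. Let $(N,\mathcal I)$ be a $p$-matchoid given by $m$ matroids in which every independent set has at most $k$ elements (for instance a $p$-matchoid of rank $k$), let $f:2^N\to\mathbb R_{\ge0}$ be nonnegative and submodular, and let an offline algorithm with approximation ratio $\gamma_p>0$ be given. Then, on every stream over $N$, the algorithm * uses at most $C\cdot\dfrac{k\log k}{\varepsilon^2}$ words of space, whatever its random choices; * makes at most $C\,(m+k+1/\varepsilon)^d$ calls (to the oracles, to the offline algorithm and to the source of randomness) for each element of the stream, and at most as many after the end of the stream; * always returns an independent set $\hat S\in\mathcal I$, and $$(1-\varepsilon)\,\mathrm{OPT}\;\le\;\Bigl(4p+\frac1{\gamma_p}\Bigr)\,\mathbb E\bigl[f(\hat S)\bigr].$$ -/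

import Mathlib

universe u

/-! ### Matchoids, submodular functions, the optimisation problem -/

section Problem

variable {E : Type u} {m : ℕ}

/-- The ground set `N = N₁ ∪ ⋯ ∪ N_m` of a family of matroids `(N_ℓ, I_ℓ)`. -/
def matchoidGround (M : Fin m → Matroid E) : Set E :=
  ⋃ ℓ, (M ℓ).E

/-- `S ⊆ N` is independent when `S ∩ N_ℓ ∈ I_ℓ` for all `ℓ`. -/
def MatchoidIndep (M : Fin m → Matroid E) (S : Finset E) : Prop :=
  (S : Set E) ⊆ matchoidGround M ∧ ∀ ℓ, (M ℓ).Indep ((S : Set E) ∩ (M ℓ).E)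

/-- The matroids are finite and every element lies in at most `p` of the ground sets `N_ℓ`. -/
structure IsMatchoid (p : ℕ) (M : Fin m → Matroid E) : Prop where
  finite : ∀ ℓ, (M ℓ).E.Finite
  mem_le : ∀ e ∈ matchoidGround M, {ℓ | e ∈ (M ℓ).E}.ncard ≤ p

open Classical in
/-- `f`, seen as a function on the subsets of `N`, is nonnegative and submodular. -/
structure IsNonnegSubmodularOn (N : Set E) (f : Finset E → ℝ) : Prop where
  nonneg : ∀ S : Finset E, (S : Set E) ⊆ N → 0 ≤ f S
  submodular : ∀ S T : Finset E, (S : Set E) ⊆ N → (T : Set E) ⊆ N →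
    f (S ∪ T) + f (S ∩ T) ≤ f S + f T

/-- The maximum of `f` over the independent subsets of `B`. For finite matroids this is the
supremum of a finite nonempty set. -/
noncomputable def matchoidOptIn (M : Fin m → Matroid E) (f : Finset E → ℝ) (B : Set E) : ℝ :=
  sSup (f '' {S | MatchoidIndep M S ∧ (S : Set E) ⊆ B})

/-- `OPT`, the maximum of `f` over all independent sets. -/
noncomputable def matchoidOpt (M : Fin m → Matroid E) (f : Finset E → ℝ) : ℝ :=
  matchoidOptIn M f (matchoidGround M)

/-- `𝔼[f(S)]` for a random finite set `S ∼ μ`. (It is used for finitely supported `μ` only.) -/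
noncomputable def expectedValue (μ : PMF (Finset E)) (f : Finset E → ℝ) : ℝ :=
  ∑' S, (μ S).toReal * f S

/-- `off` is a (possibly randomised) `γ`-approximate offline algorithm: `off B` is the law of its
output on the problem restricted to the elements of `B`. It always returns an independent subset
of `B`, and the expected value is at least `γ` times the maximum over such subsets. -/
structure IsOfflineAlgorithm (M : Fin m → Matroid E) (f : Finset E → ℝ) (γ : ℝ)
    (off : Finset E → PMF (Finset E)) : Prop where
  feasible : ∀ B : Finset E, (B : Set E) ⊆ matchoidGround M →
    ∀ S ∈ (off B).support, S ⊆ B ∧ MatchoidIndep M S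
  approx : ∀ B : Finset E, (B : Set E) ⊆ matchoidGround M →
    γ * matchoidOptIn M f (B : Set E) ≤ expectedValue (off B) f

/-- A stream over `N` presents every element of `N` exactly once, in any order. -/
def IsStreamOver (N : Set E) (stream : List E) : Prop :=
  stream.Nodup ∧ ∀ e, e ∈ stream ↔ e ∈ N

end Problem

/-! ### Randomised programs with oracles -/

/-- Randomised programs computing a result in `α`, with a value oracle for `f`, oracles for the
matroids `(N_ℓ, I_ℓ)` (is `S ∈ I_ℓ`? is `e ∈ N_ℓ`?), uniformly random choices and a black-box
offline algorithm. -/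
inductive OracleProgram (E : Type u) (m : ℕ) (α : Type u) : Type u where
  | ret (a : α) : OracleProgram E m α
  | value (S : Finset E) (next : ℝ → OracleProgram E m α) : OracleProgram E m α
  | isIndep (l : Fin m) (S : Finset E) (next : Bool → OracleProgram E m α) : OracleProgram E m α
  | inGround (l : Fin m) (e : E) (next : Bool → OracleProgram E m α) : OracleProgram E m α
  | uniform (n : ℕ) (next : Fin (n + 1) → OracleProgram E m α) : OracleProgram E m α
  | offline (B : Finset E) (next : Finset E → OracleProgram E m α) : OracleProgram E m α

namespace OracleProgram

variable {E : Type u} {m : ℕ} {α : Type u}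

open Classical in
/-- The law of the result of a program. All random choices and all runs of the offline algorithm
are independent. -/
noncomputable def run (M : Fin m → Matroid E) (f : Finset E → ℝ)
    (off : Finset E → PMF (Finset E)) : OracleProgram E m α → PMF α
  | ret a => PMF.pure a
  | value S next => run M f off (next (f S))
  | isIndep l S next => run M f off (next (decide ((M l).Indep (S : Set E))))
  | inGround l e next => run M f off (next (decide (e ∈ (M l).E)))
  | uniform n next =>
      (PMF.uniformOfFintype (Fin (n + 1))).bind fun i => run M f off (next i)
  | offline B next => (off B).bind fun S => run M f off (next S)

/-- All oracle calls are about elements of `A` only, and every possible result satisfies `R`,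
whatever the oracles answer (the offline algorithm answers with a subset of its input). -/
def Within (A : Set E) (R : α → Prop) : OracleProgram E m α → Prop
  | ret a => R a
  | value S next => (S : Set E) ⊆ A ∧ ∀ r, Within A R (next r)
  | isIndep _ S next => (S : Set E) ⊆ A ∧ ∀ b, Within A R (next b)
  | inGround _ e next => e ∈ A ∧ ∀ b, Within A R (next b)
  | uniform _ next => ∀ i, Within A R (next i)
  | offline B next => (B : Set E) ⊆ A ∧ ∀ S, S ⊆ B → Within A R (next S)

/-- The program makes at most `n` calls (to the oracles, to the offline algorithm or to the random
source), whatever the answers are. -/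
def CallsAtMost : OracleProgram E m α → ℕ → Prop
  | ret _, _ => True
  | value _ _, 0 => False
  | value _ next, n + 1 => ∀ r, CallsAtMost (next r) n
  | isIndep _ _ _, 0 => False
  | isIndep _ _ next, n + 1 => ∀ b, CallsAtMost (next b) n
  | inGround _ _ _, 0 => False
  | inGround _ _ next, n + 1 => ∀ b, CallsAtMost (next b) n
  | uniform _ _, 0 => False
  | uniform _ next, n + 1 => ∀ i, CallsAtMost (next i) n
  | offline _ _, 0 => False
  | offline _ next, n + 1 => ∀ S, CallsAtMost (next S) n

end OracleProgram

/-! ### One-pass streaming algorithms -/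

/-- The content of the memory: a list of words. A word holds one element of the stream or one
control bit, so that the length of the list is the total space. -/
abbrev StreamMemory (E : Type u) : Type u := List (E ⊕ Bool)

/-- The elements that are stored in the memory. -/
def StreamMemory.stored {E : Type u} (W : StreamMemory E) : Set E :=
  {x | Sum.inl x ∈ W}

/-- A one-pass randomised streaming algorithm. Nothing but the memory is kept from one element of
the stream to the next. While it processes the element `e`, the algorithm may call the oracles on,
and keep in memory, only elements that are stored at that moment and `e` itself; at the end of the
stream it computes its output from the memory in the same way. -/
structure StreamingAlgorithm (E : Type u) (m : ℕ) where
  step : StreamMemory E → E → OracleProgram E m (StreamMemory E)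
  finish : StreamMemory E → OracleProgram E m (Finset E)
  step_within : ∀ (W : StreamMemory E) (e : E),
    (step W e).Within (insert e W.stored) fun W₁ : StreamMemory E => W₁.stored ⊆ insert e W.stored
  finish_within : ∀ W : StreamMemory E,
    (finish W).Within W.stored fun S : Finset E => (S : Set E) ⊆ W.stored

namespace StreamingAlgorithm

variable {E : Type u} {m : ℕ}

/-- The law of the memory after the elements of the list `l` were read in order, starting with the
empty memory. -/
noncomputable def memoryAfter (A : StreamingAlgorithm E m) (M : Fin m → Matroid E)
    (f : Finset E → ℝ) (off : Finset E → PMF (Finset E)) (l : List E) : PMF (StreamMemory E) :=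
  l.foldl (fun μ e => μ.bind fun W => (A.step W e).run M f off) (PMF.pure [])

/-- The law of the output on a stream. -/
noncomputable def output (A : StreamingAlgorithm E m) (M : Fin m → Matroid E)
    (f : Finset E → ℝ) (off : Finset E → PMF (Finset E)) (stream : List E) : PMF (Finset E) :=
  (A.memoryAfter M f off stream).bind fun W => (A.finish W).run M f off

/-- At every point of the stream the memory has at most `s` words, whatever the random choices. -/
def UsesSpace (A : StreamingAlgorithm E m) (M : Fin m → Matroid E)
    (f : Finset E → ℝ) (off : Finset E → PMF (Finset E)) (stream : List E) (s : ℝ) : Prop :=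
  ∀ l, l <+: stream → ∀ W ∈ (A.memoryAfter M f off l).support, (W.length : ℝ) ≤ s

/-- At most `n` calls are made for each element of the stream, and at most `n` after its end,
whatever the random choices. -/
def UsesCalls (A : StreamingAlgorithm E m) (M : Fin m → Matroid E)
    (f : Finset E → ℝ) (off : Finset E → PMF (Finset E)) (stream : List E) (n : ℕ) : Prop :=
  (∀ l e, l ++ [e] <+: stream → ∀ W ∈ (A.memoryAfter M f off l).support,
    (A.step W e).CallsAtMost n) ∧
  ∀ W ∈ (A.memoryAfter M f off stream).support, (A.finish W).CallsAtMost n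

end StreamingAlgorithm

/-! Fix a threshold `α`. One copy of the algorithm keeps an independent solution `S` and a buffer
`B`. An element `x` is acceptable if `f(S + x) - f(S)` is at least `α` plus twice the incremental
values of the elements it evicts, namely the cheapest other element of the circuit that `x` closes,
in each matroid where it closes one. Acceptable elements wait in `B`, and the test is repeated
whenever an element arrives. When the buffer is full, a uniformly random element of it is exchanged
into `S`.

Deterministic part (`ExchangeInvariant.union_le`). Let `U` be the set of all elements that ever were
in `S`, and `X` the total value of the evicted ones at their eviction. Every exchange gains `α` plus
the value it evicts, so `X ≤ f(S) - f(∅)`; moreover `f(U) ≤ f(S) + X`. If `t` was rejected, its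
marginal value is at most `α` plus twice the values that blocked it, and in each matroid `t` stays
spanned by elements of `U` of at least the blocking value that were not evicted through this
matroid. Comparing ranks at every value level and matching by Hall's theorem charges the rejected
elements of an independent set `T` to `U`, where an element of `S` is charged at most `p` times and
an evicted one at most `p - 1` times (`Ledger.sum_rejected_le`). This gives `f(T ∪ U) ≤ kα + 4p f(S)
+ f(T ∩ B)`. The offline algorithm on `B` pays for the last term with `1/γ`.

Random part (`le_mean_historyLaw`). As `f` need not be monotone, `f(T ∪ U)` may be smaller than
`f(T)`. Inserting a random one of `n` elements loses at most the fraction `1/n` in expectation. Let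
`F = (f(S) - f(∅))/α`, which grows by at least 1 with every exchange. With `n ≥ κ√(F + 1)` the
losses are dominated by a telescoping sum of square roots, and with `κ = 2 ^ (b + 3a + 2)` they
amount to at most `4 ^ (-a)`. Here `4 ^ a` is of order `1/ε` and `4 ^ b` of order `k`.

Space. The right `α` is about `OPT / 4 ^ (a + b)`, which is unknown, so copies run for `α = 4 ^ (L -
i)`, `i ≤ a + b`, where `4 ^ L` approximates the best singleton value so far. A copy whose `α`
exceeds all singleton values stores nothing, so it can be started late
(`map_memorySlot_memoryAfter`). In copy `i` the progress `F` is at most `4 ^ (b + i + 1)`, so the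
buffers with `i < a` are geometrically smaller. Only `b + 1` buffers of full size remain, which is
why the bound has `log k` and not `log (k/ε)`. -/

/-! ### Expectations of extended nonnegative functions -/

section Expectation

open scoped ENNReal

variable {α β : Type*}

/-- The expectation of `h` under `μ`, with values in `[0, ∞]`. -/
noncomputable def PMF.mean (μ : PMF α) (h : α → ℝ≥0∞) : ℝ≥0∞ :=
  ∑' a, μ a * h a

namespace PMF

theorem mean_pure (a : α) (h : α → ℝ≥0∞) : (PMF.pure a).mean h = h a := by
  unfold mean
  rw [tsum_eq_single a]
  · simp
  · intro b hb
    simp [PMF.pure_apply, hb]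

theorem mean_bind (μ : PMF α) (κ : α → PMF β) (h : β → ℝ≥0∞) :
    (μ.bind κ).mean h = μ.mean fun a => (κ a).mean h := by
  unfold mean
  simp_rw [PMF.bind_apply, ← ENNReal.tsum_mul_right, ← ENNReal.tsum_mul_left]
  rw [ENNReal.tsum_comm]
  simp_rw [mul_assoc]

theorem mean_map (μ : PMF α) (φ : α → β) (h : β → ℝ≥0∞) :
    (μ.map φ).mean h = μ.mean fun a => h (φ a) := by
  have : μ.map φ = μ.bind fun a => PMF.pure (φ a) := rfl
  rw [this, mean_bind]
  simp_rw [mean_pure]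

theorem mean_mono (μ : PMF α) {h₁ h₂ : α → ℝ≥0∞} (hh : ∀ a ∈ μ.support, h₁ a ≤ h₂ a) :
    μ.mean h₁ ≤ μ.mean h₂ := by
  refine ENNReal.tsum_le_tsum fun a => ?_
  by_cases ha : μ a = 0
  · simp [ha]
  · exact mul_le_mul_right (hh a ((PMF.mem_support_iff _ _).2 ha)) _

theorem mean_add (μ : PMF α) (h₁ h₂ : α → ℝ≥0∞) :
    (μ.mean fun a => h₁ a + h₂ a) = μ.mean h₁ + μ.mean h₂ := by
  unfold mean
  rw [← ENNReal.tsum_add]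
  simp_rw [mul_add]

theorem mean_const_mul (μ : PMF α) (c : ℝ≥0∞) (h : α → ℝ≥0∞) :
    (μ.mean fun a => c * h a) = c * μ.mean h := by
  unfold mean
  rw [← ENNReal.tsum_mul_left]
  simp_rw [mul_left_comm]

theorem mean_const (μ : PMF α) (c : ℝ≥0∞) : (μ.mean fun _ => c) = c := by
  unfold mean
  rw [ENNReal.tsum_mul_right, PMF.tsum_coe, one_mul]

theorem mean_uniformOfFintype [Fintype α] [Nonempty α] (h : α → ℝ≥0∞) :
    (PMF.uniformOfFintype α).mean h = (Fintype.card α : ℝ≥0∞)⁻¹ * ∑ a, h a := by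
  unfold mean
  simp_rw [PMF.uniformOfFintype_apply]
  rw [tsum_fintype, Finset.mul_sum]

theorem bind_congr_support (μ : PMF α) {κ₁ κ₂ : α → PMF β} (h : ∀ a ∈ μ.support, κ₁ a = κ₂ a) :
    μ.bind κ₁ = μ.bind κ₂ := by
  ext b
  rw [PMF.bind_apply, PMF.bind_apply]
  refine tsum_congr fun a => ?_
  by_cases ha : μ a = 0
  · simp [ha]
  · rw [h a ((PMF.mem_support_iff _ _).2 ha)]

/-- Reducing a uniform random number below a multiple of `d` modulo `d` gives a uniform random
number below `d`. -/
theorem map_mod_uniformOfFintype {d q : ℕ} (hd : 0 < d) (hq : 0 < q) (h : ℕ → β) :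
    ((PMF.uniformOfFintype (Fin (q * d - 1 + 1))).map fun r => h (r.val % d)) =
      (PMF.uniformOfFintype (Fin (d - 1 + 1))).map fun r => h r.val := by
  have hqd : q * d - 1 + 1 = q * d := Nat.sub_add_cancel (Nat.mul_pos hq hd)
  have hd' : d - 1 + 1 = d := Nat.sub_add_cancel hd
  have key : ((PMF.uniformOfFintype (Fin (q * d - 1 + 1))).map fun r => r.val % d) =
      (PMF.uniformOfFintype (Fin (d - 1 + 1))).map fun r => r.val := by
    ext c
    simp only [PMF.map_apply, PMF.uniformOfFintype_apply, tsum_fintype, Fintype.card_fin]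
    rw [hqd, hd']
    rw [Fin.sum_univ_eq_sum_range (fun r => if c = r % d then ((q * d : ℕ) : ℝ≥0∞)⁻¹ else 0),
      Fin.sum_univ_eq_sum_range (fun r => if c = r then ((d : ℕ) : ℝ≥0∞)⁻¹ else 0)]
    rw [Finset.sum_ite_eq, ← Finset.sum_filter, Finset.sum_const, nsmul_eq_mul]
    split_ifs with hc
    · have hcd := Finset.mem_range.1 hc
      have hcard : ((Finset.range (q * d)).filter fun r => c = r % d).card = q := by
        have : ((Finset.range (q * d)).filter fun r => c = r % d) =
            (Finset.range q).image fun t => t * d + c := by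
          ext r
          simp only [Finset.mem_filter, Finset.mem_range, Finset.mem_image]
          constructor
          · rintro ⟨h1, h2⟩
            refine ⟨r / d, ?_, ?_⟩
            · exact (Nat.div_lt_iff_lt_mul hd).2 h1
            · rw [h2, mul_comm]; exact Nat.div_add_mod r d
          · rintro ⟨t, ht, rfl⟩
            refine ⟨?_, ?_⟩
            · calc t * d + c < t * d + d := by omega
                _ = (t + 1) * d := by ring
                _ ≤ q * d := Nat.mul_le_mul_right d ht
            · rw [Nat.mul_add_mod_of_lt hcd]
        rw [this, Finset.card_image_of_injective, Finset.card_range]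
        intro s t hst
        exact Nat.eq_of_mul_eq_mul_right hd (Nat.add_right_cancel hst)
      rw [hcard]
      have hq0 : (q : ℝ≥0∞) ≠ 0 := by exact_mod_cast hq.ne'
      have hqt : (q : ℝ≥0∞) ≠ ∞ := ENNReal.natCast_ne_top q
      push_cast
      rw [ENNReal.mul_inv (Or.inl hq0) (Or.inl hqt), ← mul_assoc, ENNReal.mul_inv_cancel hq0 hqt,
        one_mul]
    · have : ((Finset.range (q * d)).filter fun r => c = r % d) = ∅ := by
        refine Finset.filter_false_of_mem fun r _ hr => hc ?_
        rw [hr]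
        exact Finset.mem_range.2 (Nat.mod_lt r hd)
      rw [this]
      simp
  have := congrArg (PMF.map h) key
  rw [PMF.map_comp, PMF.map_comp] at this
  exact this

end PMF

/-- Estimates are made in `[0, ∞]`, where no summability is needed; this is the way back.
Nonnegativity on the support suffices, because other sets carry no mass. -/
theorem toReal_mean_ofReal {μ : PMF (Finset α)} {f : Finset α → ℝ}
    (hf : ∀ S ∈ μ.support, 0 ≤ f S) :
    (μ.mean fun S => ENNReal.ofReal (f S)).toReal = expectedValue μ f := by
  unfold PMF.mean expectedValue
  rw [ENNReal.tsum_toReal_eq]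
  · refine tsum_congr fun S => ?_
    by_cases hS : μ S = 0
    · simp [hS]
    · rw [ENNReal.toReal_mul, ENNReal.toReal_ofReal (hf S ((PMF.mem_support_iff _ _).2 hS))]
  · intro S
    exact ENNReal.mul_ne_top (PMF.apply_ne_top μ S) ENNReal.ofReal_ne_top

/-- Without finiteness only this inequality is available: if the mean is infinite, the real
expectation takes the default value 0. -/
theorem ofReal_expectedValue_le {μ : PMF (Finset α)} {f : Finset α → ℝ}
    (hf : ∀ S ∈ μ.support, 0 ≤ f S) :
    ENNReal.ofReal (expectedValue μ f) ≤ μ.mean fun S => ENNReal.ofReal (f S) := by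
  rw [← toReal_mean_ofReal hf]
  exact ENNReal.ofReal_toReal_le

end Expectation

/-! ### Non-adaptive queries -/

namespace OracleProgram

open scoped Classical

variable {E : Type u} {m : ℕ} {α : Type u}

theorem CallsAtMost.mono {P : OracleProgram E m α} {n n' : ℕ} (h : P.CallsAtMost n)
    (hn : n ≤ n') : P.CallsAtMost n' := by
  induction P generalizing n n' with
  | ret a => cases n' <;> trivial
  | value S next ih | isIndep l S next ih | inGround l e next ih | uniform k next ih
  | offline B next ih =>
    obtain _ | n := n
    · exact h.elim
    obtain _ | n' := n'
    · omega
    · exact fun r => ih r (h r) (by omega)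

/-- Ask for the values of `f` on a list of sets. -/
noncomputable def askValues :
    List (Finset E) → ((Finset E → ℝ) → OracleProgram E m α) → OracleProgram E m α
  | [], next => next fun _ => 0
  | S :: L, next => value S fun r => askValues L fun g => next fun T => if T = S then r else g T

/-- Ask for the independence of a list of sets. -/
noncomputable def askIndep :
    List (Fin m × Finset E) → ((Fin m → Finset E → Prop) → OracleProgram E m α) →
      OracleProgram E m α
  | [], next => next fun _ _ => False
  | q :: L, next => isIndep q.1 q.2 fun b =>
      askIndep L fun I => next fun l S => if (l, S) = q then b = true else I l S

/-- Ask for membership of a list of elements in the ground sets. -/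
noncomputable def askGround :
    List (Fin m × E) → ((Fin m → E → Prop) → OracleProgram E m α) → OracleProgram E m α
  | [], next => next fun _ _ => False
  | q :: L, next => inGround q.1 q.2 fun b =>
      askGround L fun G => next fun l x => if (l, x) = q then b = true else G l x

section Run

variable (M : Fin m → Matroid E) (f : Finset E → ℝ) (off : Finset E → PMF (Finset E))

/-- The continuation depends on a table of answers whose entries that were not asked for hold the
default 0. That these entries do not matter is shown separately, in `AgreeOn`. -/
theorem run_askValues (L : List (Finset E)) (next : (Finset E → ℝ) → OracleProgram E m α) :
    (askValues L next).run M f off =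
      (next fun S => if S ∈ L then f S else 0).run M f off := by
  induction L generalizing next with
  | nil => simp [askValues]
  | cons S L ih =>
    simp only [askValues, run]
    rw [ih]
    congr 2
    funext T
    by_cases h : T = S <;> simp [h]

theorem run_askIndep (L : List (Fin m × Finset E))
    (next : (Fin m → Finset E → Prop) → OracleProgram E m α) :
    (askIndep L next).run M f off =
      (next fun l S => (l, S) ∈ L ∧ (M l).Indep (S : Set E)).run M f off := by
  induction L generalizing next with
  | nil => simp [askIndep]
  | cons q L ih =>
    simp only [askIndep, run]
    rw [ih]
    congr 2
    funext l S
    by_cases h : (l, S) = q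
    · subst h; simp
    · simp [h]

theorem run_askGround (L : List (Fin m × E)) (next : (Fin m → E → Prop) → OracleProgram E m α) :
    (askGround L next).run M f off =
      (next fun l x => (l, x) ∈ L ∧ x ∈ (M l).E).run M f off := by
  induction L generalizing next with
  | nil => simp [askGround]
  | cons q L ih =>
    simp only [askGround, run]
    rw [ih]
    congr 2
    funext l S
    by_cases h : (l, S) = q
    · subst h; simp
    · simp [h]

end Run

theorem within_askValues {A : Set E} {R : α → Prop} {L : List (Finset E)}
    {next : (Finset E → ℝ) → OracleProgram E m α} (hL : ∀ S ∈ L, (S : Set E) ⊆ A)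
    (h : ∀ g, (next g).Within A R) : (askValues L next).Within A R := by
  induction L generalizing next with
  | nil => exact h _
  | cons S L ih =>
    exact ⟨hL S (by simp), fun r => ih (fun T hT => hL T (by simp [hT])) fun g => h _⟩

theorem within_askIndep {A : Set E} {R : α → Prop} {L : List (Fin m × Finset E)}
    {next : (Fin m → Finset E → Prop) → OracleProgram E m α}
    (hL : ∀ q ∈ L, (q.2 : Set E) ⊆ A) (h : ∀ I, (next I).Within A R) :
    (askIndep L next).Within A R := by
  induction L generalizing next with
  | nil => exact h _
  | cons S L ih =>
    exact ⟨hL S (by simp), fun r => ih (fun T hT => hL T (by simp [hT])) fun g => h _⟩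

theorem within_askGround {A : Set E} {R : α → Prop} {L : List (Fin m × E)}
    {next : (Fin m → E → Prop) → OracleProgram E m α}
    (hL : ∀ q ∈ L, q.2 ∈ A) (h : ∀ I, (next I).Within A R) :
    (askGround L next).Within A R := by
  induction L generalizing next with
  | nil => exact h _
  | cons S L ih =>
    exact ⟨hL S (by simp), fun r => ih (fun T hT => hL T (by simp [hT])) fun g => h _⟩

theorem callsAtMost_askValues {L : List (Finset E)}
    {next : (Finset E → ℝ) → OracleProgram E m α} {n : ℕ} (h : ∀ g, (next g).CallsAtMost n) :
    (askValues L next).CallsAtMost (L.length + n) := by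
  induction L generalizing next with
  | nil => simpa [askValues] using h _
  | cons S L ih =>
    rw [List.length_cons, Nat.add_right_comm]
    exact fun r => ih fun g => h _

theorem callsAtMost_askIndep {L : List (Fin m × Finset E)}
    {next : (Fin m → Finset E → Prop) → OracleProgram E m α} {n : ℕ}
    (h : ∀ g, (next g).CallsAtMost n) : (askIndep L next).CallsAtMost (L.length + n) := by
  induction L generalizing next with
  | nil => simpa [askIndep] using h _
  | cons S L ih =>
    rw [List.length_cons, Nat.add_right_comm]
    exact fun r => ih fun g => h _

theorem callsAtMost_askGround {L : List (Fin m × E)}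
    {next : (Fin m → E → Prop) → OracleProgram E m α} {n : ℕ}
    (h : ∀ g, (next g).CallsAtMost n) : (askGround L next).CallsAtMost (L.length + n) := by
  induction L generalizing next with
  | nil => simpa [askGround] using h _
  | cons S L ih =>
    rw [List.length_cons, Nat.add_right_comm]
    exact fun r => ih fun g => h _

end OracleProgram

/-! ### Submodular functions -/

section Submodular

open scoped Classical

variable {E : Type u} {N : Set E} {f : Finset E → ℝ}

namespace IsNonnegSubmodularOn

/-- Submodularity for `B` and `A ∪ D`, whose intersection is `A`: diminishing returns for adding a
whole set. -/
theorem union_add_le (hf : IsNonnegSubmodularOn N f) {A B D : Finset E} (hB : (B : Set E) ⊆ N)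
    (hD : (D : Set E) ⊆ N) (hAB : A ⊆ B) (hBD : B ∩ D ⊆ A) :
    f (B ∪ D) + f A ≤ f B + f (A ∪ D) := by
  have h := hf.submodular B (A ∪ D) hB (by
    rw [Finset.coe_union]; exact Set.union_subset ((Finset.coe_subset.2 hAB).trans hB) hD)
  rwa [← Finset.union_assoc, Finset.union_eq_left.2 hAB, Finset.inter_union_distrib_left,
    Finset.inter_eq_right.2 hAB, Finset.union_eq_left.2 hBD] at h

theorem insert_sub_le (hf : IsNonnegSubmodularOn N f) {A B : Finset E} {x : E}
    (hB : (B : Set E) ⊆ N) (hx : x ∈ N) (hAB : A ⊆ B) (hxB : x ∉ B) :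
    f (insert x B) - f B ≤ f (insert x A) - f A := by
  have h := hf.union_add_le (D := {x}) hB (by simpa using hx) hAB (by simp [hxB])
  rw [Finset.union_comm B, Finset.union_comm A, ← Finset.insert_eq, ← Finset.insert_eq] at h
  linarith

/-- The elements of `T` are added one by one, each with a marginal value at most that over `U`.
Nonnegativity of `c` covers those already present, which add nothing. -/
theorem union_le_add_sum (hf : IsNonnegSubmodularOn N f) {U T : Finset E} {c : E → ℝ}
    (hU : (U : Set E) ⊆ N) (hT : (T : Set E) ⊆ N) (hc : ∀ t ∈ T, 0 ≤ c t)
    (h : ∀ t ∈ T, t ∉ U → f (insert t U) - f U ≤ c t) :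
    f (U ∪ T) ≤ f U + ∑ t ∈ T, c t := by
  induction T using Finset.induction_on with
  | empty => simp
  | insert t T ht ih =>
    have hT' : (T : Set E) ⊆ N := fun y hy => hT (by simp [Finset.mem_coe.1 hy])
    have htN : t ∈ N := hT (by simp)
    have ih' := ih hT' (fun y hy => hc y (by simp [hy])) fun y hy => h y (by simp [hy])
    rw [Finset.sum_insert ht, Finset.union_insert]
    by_cases htU : t ∈ U ∪ T
    · rw [Finset.insert_eq_of_mem htU]
      have := hc t (by simp)
      linarith
    · have h1 := hf.insert_sub_le (A := U) (B := U ∪ T) (x := t)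
        (by rw [Finset.coe_union]; exact Set.union_subset hU hT') htN Finset.subset_union_left htU
      have h2 := h t (by simp) fun hh => htU (by simp [hh])
      linarith

theorem sub_empty_le_sum_singleton (hf : IsNonnegSubmodularOn N f) {X : Finset E}
    (hX : (X : Set E) ⊆ N) : f X - f ∅ ≤ ∑ x ∈ X, f {x} := by
  have h0 : 0 ≤ f ∅ := hf.nonneg ∅ (by simp)
  have := hf.union_le_add_sum (U := ∅) (c := fun x => f {x}) (by simp) hX
    (fun t ht => hf.nonneg _ (by simpa using hX ht)) fun t ht _ => by
      rw [insert_empty_eq]; linarith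
  rw [Finset.empty_union] at this
  linarith

/-- Adding a uniformly random element of `L` costs at most a fraction `1 / #L`. -/
theorem card_sub_one_mul_le_sum (hf : IsNonnegSubmodularOn N f) {U L : Finset E}
    (hU : (U : Set E) ⊆ N) (hL : (L : Set E) ⊆ N) :
    ((L.card : ℝ) - 1) * f U ≤ ∑ x ∈ L, f (insert x U) := by
  -- The marginal values over `U` sum to at least `f(U ∪ L) - f(U)`. Dropping `f(U ∪ L) ≥ 0`
  -- afterwards is where nonnegativity of `f` replaces monotonicity.
  have key : (L.card : ℝ) * f U + f (U ∪ L) ≤ ∑ x ∈ L, f (insert x U) + f U := by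
    induction L using Finset.induction_on with
    | empty => simp
    | insert x L hx ih =>
      have hL' : (L : Set E) ⊆ N := fun y hy => hL (by simp [Finset.mem_coe.1 hy])
      have hxN : x ∈ N := hL (by simp)
      have hUL : ((U ∪ L : Finset E) : Set E) ⊆ N := by
        rw [Finset.coe_union]; exact Set.union_subset hU hL'
      have h1 := hf.union_add_le (A := U) (B := U ∪ L) (D := {x}) hUL (by simpa using hxN)
        Finset.subset_union_left (by
          intro y hy
          simp only [Finset.mem_inter, Finset.mem_union, Finset.mem_singleton] at hy
          obtain ⟨h | h, rfl⟩ := hy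
          · exact h
          · exact absurd h hx)
      rw [Finset.union_comm (U ∪ L), ← Finset.insert_eq, Finset.union_comm U {x},
        ← Finset.insert_eq] at h1
      rw [Finset.sum_insert hx, Finset.card_insert_of_notMem hx, Finset.union_insert]
      push_cast
      linarith [ih hL']
  have h2 := hf.nonneg (U ∪ L) (by rw [Finset.coe_union]; exact Set.union_subset hU hL)
  linarith

/-- Joining a fixed set preserves submodularity. -/
theorem union_left (hf : IsNonnegSubmodularOn N f) {T : Finset E} (hT : (T : Set E) ⊆ N) :
    IsNonnegSubmodularOn N fun X => f (T ∪ X) where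
  nonneg S hS := hf.nonneg _ (by rw [Finset.coe_union]; exact Set.union_subset hT hS)
  submodular A B hA hB := by
    have := hf.submodular (T ∪ A) (T ∪ B)
      (by rw [Finset.coe_union]; exact Set.union_subset hT hA)
      (by rw [Finset.coe_union]; exact Set.union_subset hT hB)
    rwa [← Finset.union_union_distrib_left, ← Finset.union_inter_distrib_left] at this

end IsNonnegSubmodularOn

/-- If every superlevel set of `a` is at most as large as that of `b`, the sum of `a` is at most
that of `b`. -/
theorem sum_le_sum_of_card_filter_le {ι κ : Type*} (A : Finset ι) (Z : Finset κ) (a : ι → ℝ)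
    (b : κ → ℝ) (hb : ∀ z ∈ Z, 0 ≤ b z)
    (h : ∀ θ, 0 < θ → (A.filter fun i => θ ≤ a i).card ≤ (Z.filter fun z => θ ≤ b z).card) :
    ∑ i ∈ A, a i ≤ ∑ z ∈ Z, b z := by
  -- Hall's theorem for the relation `a i ≤ b z`, on the indices of positive value because `h` needs
  -- `θ > 0`. A set `s` with smallest value `a i` lies in the superlevel set at `a i`, and the
  -- neighbours of this single `i` are already numerous enough.
  set P := A.filter fun i => 0 < a i with hP
  let t : P → Finset κ := fun i => Z.filter fun z => a i ≤ b z
  have hall : ∀ s : Finset P, s.card ≤ (s.biUnion t).card := by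
    intro s
    rcases s.eq_empty_or_nonempty with rfl | hs
    · simp
    obtain ⟨i, his, hi⟩ := s.exists_min_image (fun i => a i) hs
    have hi0 : 0 < a i := (Finset.mem_filter.1 i.2).2
    calc s.card = (s.map (Function.Embedding.subtype _)).card := (Finset.card_map _).symm
      _ ≤ (A.filter fun j => a i ≤ a j).card := by
        refine Finset.card_le_card fun j hj => ?_
        obtain ⟨j', hj', rfl⟩ := Finset.mem_map.1 hj
        exact Finset.mem_filter.2 ⟨(Finset.mem_filter.1 j'.2).1, hi j' hj'⟩
      _ ≤ (t i).card := h _ hi0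
      _ ≤ (s.biUnion t).card := Finset.card_le_card (Finset.subset_biUnion_of_mem t his)
  obtain ⟨φ, hφ, hφt⟩ := (Finset.all_card_le_biUnion_card_iff_exists_injective t).1 hall
  calc ∑ i ∈ A, a i ≤ ∑ i ∈ P, a i := by
        rw [hP, Finset.sum_filter]
        refine Finset.sum_le_sum fun i _ => ?_
        split_ifs with hi
        · exact le_rfl
        · exact not_lt.1 hi
    _ = ∑ i : P, a i := (Finset.sum_coe_sort P a).symm
    _ ≤ ∑ i : P, b (φ i) := Finset.sum_le_sum fun i _ => (Finset.mem_filter.1 (hφt i)).2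
    _ = ∑ z ∈ Finset.univ.image φ, b z := (Finset.sum_image fun i _ j _ hij => hφ hij).symm
    _ ≤ ∑ z ∈ Z, b z := by
        refine Finset.sum_le_sum_of_subset_of_nonneg ?_ fun z hz _ => hb z hz
        intro z hz
        obtain ⟨i, _, rfl⟩ := Finset.mem_image.1 hz
        exact (Finset.mem_filter.1 (hφt i)).1

/-! ### Incremental values -/

/-- The elements before `s` in the list `S`. -/
noncomputable def prefixSet (S : List E) (s : E) : Finset E :=
  (S.takeWhile fun y => decide (y ≠ s)).toFinset

/-- The marginal value of `s` with respect to the elements before it in the list `S`. -/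
noncomputable def increment (g : Finset E → ℝ) (S : List E) (s : E) : ℝ :=
  if s ∈ S then g (insert s (prefixSet S s)) - g (prefixSet S s) else 0

theorem prefixSet_subset (S : List E) (s : E) : prefixSet S s ⊆ S.toFinset := by
  intro y hy
  exact List.mem_toFinset.2 ((List.takeWhile_prefix _).subset (List.mem_toFinset.1 hy))

theorem notMem_prefixSet (S : List E) (s : E) : s ∉ prefixSet S s := by
  intro h
  have := List.mem_takeWhile_imp (List.mem_toFinset.1 h)
  simp at this

theorem prefixSet_append_of_mem {S : List E} {s : E} (hs : s ∈ S) (T : List E) :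
    prefixSet (S ++ T) s = prefixSet S s := by
  unfold prefixSet
  rw [List.takeWhile_append, if_neg]
  intro h
  have := (List.takeWhile_prefix (p := fun y => decide (y ≠ s)) (l := S)).eq_of_length h
  rw [← this] at hs
  simpa using List.mem_takeWhile_imp hs

theorem prefixSet_append_singleton {S : List E} {x : E} (hx : x ∉ S) :
    prefixSet (S ++ [x]) x = S.toFinset := by
  unfold prefixSet
  have h : S.takeWhile (fun y => decide (y ≠ x)) = S := by
    rw [List.takeWhile_eq_self_iff]
    intro y hy
    simpa using fun h : y = x => hx (h ▸ hy)
  rw [List.takeWhile_append, h, if_pos rfl]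
  simp

theorem prefixSet_filter_subset (p : E → Prop) [DecidablePred p] {S : List E} {s : E} (hs : p s) :
    prefixSet (S.filter fun y => decide (p y)) s ⊆ prefixSet S s := by
  induction S with
  | nil => simp [prefixSet]
  | cons y S ih =>
    unfold prefixSet at ih ⊢
    by_cases hy : y = s
    · subst hy; simp [hs]
    · by_cases hp : p y
      · simp only [List.filter_cons, hp, decide_true, if_true, List.takeWhile_cons, ne_eq, hy,
          not_false_eq_true, List.toFinset_cons]
        exact Finset.insert_subset_insert _ ih
      · simp only [List.filter_cons, hp, decide_false, List.takeWhile_cons, ne_eq, hy,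
          not_false_eq_true, decide_true, if_true, List.toFinset_cons]
        exact ih.trans (Finset.subset_insert _ _)

theorem increment_append_of_mem (g : Finset E → ℝ) {S : List E} {s : E} (hs : s ∈ S)
    (T : List E) : increment g (S ++ T) s = increment g S s := by
  simp [increment, hs, prefixSet_append_of_mem hs]

theorem increment_append_singleton (g : Finset E → ℝ) {S : List E} {x : E} (hx : x ∉ S) :
    increment g (S ++ [x]) x = g (insert x S.toFinset) - g S.toFinset := by
  simp [increment, prefixSet_append_singleton hx]

theorem toFinset_append_singleton (S : List E) (x : E) :
    (S ++ [x]).toFinset = insert x S.toFinset := by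
  ext y; simp

theorem sum_increment (g : Finset E → ℝ) {S : List E} (hS : S.Nodup) :
    ∑ s ∈ S.toFinset, increment g S s = g S.toFinset - g ∅ := by
  induction S using List.reverseRecOn with
  | nil => simp
  | append_singleton S x ih =>
    have hx : x ∉ S := fun h => (List.nodup_append.1 hS).2.2 x h x (by simp) rfl
    rw [toFinset_append_singleton, Finset.sum_insert (by simpa using hx),
      increment_append_singleton g hx, Finset.sum_congr rfl fun s hs =>
        increment_append_of_mem g (List.mem_toFinset.1 hs) [x], ih (List.nodup_append.1 hS).1]
    ring

/-- Deleting elements shrinks the prefix of `s`. Hence incremental values never fall while an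
element stays in the solution. -/
theorem increment_le_increment_filter (hf : IsNonnegSubmodularOn N f) {S : List E}
    (hS : ∀ y ∈ S, y ∈ N) {p : E → Prop} [DecidablePred p] {s : E} (hs : s ∈ S) (hp : p s) :
    increment f S s ≤ increment f (S.filter fun y => decide (p y)) s := by
  have hs' : s ∈ S.filter fun y => decide (p y) := by simp [hs, hp]
  rw [increment, increment, if_pos hs, if_pos hs']
  refine hf.insert_sub_le (fun y hy => hS y ?_) (hS s hs) (prefixSet_filter_subset p hp)
    (notMem_prefixSet S s)
  exact List.mem_toFinset.1 (prefixSet_subset S s hy)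

/-- Build up `S` in its order: an element of `C` accounts for its increment, and an element that is
kept adds at least as much to the filtered prefix as to the full one. -/
theorem sub_filter_le_sum_increment (hf : IsNonnegSubmodularOn N f) {S : List E} (hS : S.Nodup)
    (hSN : ∀ y ∈ S, y ∈ N) (C : Finset E) :
    f S.toFinset - f (S.filter fun y => decide (y ∉ C)).toFinset ≤
      ∑ s ∈ S.toFinset.filter (· ∈ C), increment f S s := by
  induction S using List.reverseRecOn with
  | nil => simp
  | append_singleton S x ih =>
    have hx : x ∉ S := fun h => (List.nodup_append.1 hS).2.2 x h x (by simp) rfl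
    have hSN' : ∀ y ∈ S, y ∈ N := fun y hy => hSN y (by simp [hy])
    have ih' := ih (List.nodup_append.1 hS).1 hSN'
    have hsum : ∀ s ∈ S.toFinset.filter (· ∈ C), increment f (S ++ [x]) s = increment f S s :=
      fun s hs => increment_append_of_mem f (List.mem_toFinset.1 (Finset.mem_filter.1 hs).1) [x]
    rw [toFinset_append_singleton, Finset.filter_insert, List.filter_append]
    by_cases hC : x ∈ C
    · rw [if_pos hC, Finset.sum_insert (by simp [hx]), Finset.sum_congr rfl hsum,
        increment_append_singleton f hx]
      simp only [List.filter_cons, hC, not_true_eq_false, decide_false, List.filter_nil]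
      simp only [Bool.false_eq_true, if_false, List.append_nil]
      linarith
    · rw [if_neg hC, Finset.sum_congr rfl hsum]
      simp only [List.filter_cons, hC, not_false_eq_true, decide_true, if_true, List.filter_nil]
      rw [toFinset_append_singleton]
      have := hf.insert_sub_le (A := (S.filter fun y => decide (y ∉ C)).toFinset)
        (B := S.toFinset) (x := x) (fun y hy => hSN' y (List.mem_toFinset.1 hy))
        (hSN x (by simp)) (fun y hy => by simp at hy ⊢; exact hy.1) (by simpa using hx)
      linarith

end Submodular

/-! ### One copy of the exchange algorithm -/

/-- The answers of the value oracle, the independence oracles and the membership oracles. -/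
structure Answers (E : Type u) (m : ℕ) where
  val : Finset E → ℝ
  ind : Fin m → Finset E → Prop
  grd : Fin m → E → Prop

/-- The answers of the oracles for `f` and the matroids `M`. -/
def trueAnswers {E : Type u} {m : ℕ} (M : Fin m → Matroid E) (f : Finset E → ℝ) : Answers E m where
  val := f
  ind l S := (M l).Indep (S : Set E)
  grd l x := x ∈ (M l).E

section Exchange

open scoped Classical

variable {E : Type u} {m : ℕ}

namespace Answers

variable (O : Answers E m)

/-- The elements of `S` in the `l`-th ground set. -/
noncomputable def part (S : List E) (l : Fin m) : Finset E :=
  S.toFinset.filter fun y => O.grd l y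

/-- The elements of `S` that can be exchanged for `x` in the `l`-th matroid. -/
noncomputable def candidates (S : List E) (x : E) (l : Fin m) : List E :=
  S.filter fun c => decide (O.grd l c ∧ O.ind l (insert x ((O.part S l).erase c)))

/-- The element of smallest incremental value that makes room for `x` in the `l`-th matroid. -/
noncomputable def evicted (S : List E) (x : E) (l : Fin m) : Option E :=
  if O.grd l x ∧ ¬ O.ind l (insert x (O.part S l)) then
    (O.candidates S x l).argmin (increment O.val S) else none

/-- An element evicted through several matroids is counted once here. -/
noncomputable def evictedSet (S : List E) (x : E) : Finset E :=
  S.toFinset.filter fun c => ∃ l, O.evicted S x l = some c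

/-- Room for `x` can be made in every matroid. -/
def Feasible (S : List E) (x : E) : Prop :=
  ∀ l, O.grd l x → O.ind l (insert x (O.part S l)) ∨ O.candidates S x l ≠ []

/-- The test which an element has to pass in order to be exchanged into `S`. -/
def Accepts (α : ℝ) (S : List E) (x : E) : Prop :=
  O.Feasible S x ∧
    -- Factor 2: removing the evicted elements costs at most the sum of their increments, so the
    -- same amount is left as net gain.
    α + 2 * ∑ c ∈ O.evictedSet S x, increment O.val S c ≤
      O.val (insert x S.toFinset) - O.val S.toFinset

noncomputable def exchange (S : List E) (x : E) : List E :=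
  (S.filter fun y => decide (y ∉ O.evictedSet S x)) ++ [x]

/-- The buffered elements, and the new one, which pass the test. -/
noncomputable def pool (α : ℝ) (s : List E × List E) (e : E) : List E :=
  (s.2 ++ [e]).filter fun x => decide (O.Accepts α s.1 x)

/-- The value of the current solution above that of the empty set, in multiples of `α`. -/
noncomputable def progress (α : ℝ) (S : List E) : ℝ :=
  (O.val S.toFinset - O.val ∅) / α

/-- A buffer of `n` elements is full. -/
def Full (a b : ℕ) (α : ℝ) (S : List E) (n : ℕ) : Prop :=
  -- With `F` the progress, full means `n ≥ 2 ^ (b + 3a + 2) * √(F + 1)`: small buffers suffice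
  -- while `F` is small. The cap limits the space of copies whose `α` is too small; it is not active
  -- for the `α` used in the analysis.
  (4 : ℝ) ^ (b + 3 * a + 2) * min (O.progress α S + 1) (4 ^ (a + b + 2)) ≤ (n : ℝ) ^ 2

/-- Process the element `e`, given the random number `r`. The state consists of the current
solution, in the order of insertion, and the buffer. -/
noncomputable def instStep (a b : ℕ) (α : ℝ) (s : List E × List E) (e : E) (r : ℕ) :
    List E × List E :=
  if O.Full a b α s.1 (O.pool α s e).length then
    (O.exchange s.1 ((O.pool α s e).getD (r % (O.pool α s e).length) e),
      (O.pool α s e).erase ((O.pool α s e).getD (r % (O.pool α s e).length) e))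
  else (s.1, O.pool α s e)

end Answers

/-! #### Exchanges in the matroids -/

section Matroid

variable (M : Fin m → Matroid E) (f : Finset E → ℝ)

theorem coe_part (S : List E) (l : Fin m) :
    (((trueAnswers M f).part S l : Finset E) : Set E) = {y | y ∈ S ∧ y ∈ (M l).E} := by
  unfold Answers.part
  simp only [Finset.coe_filter, List.mem_toFinset]
  rfl

variable {M f}

theorem mem_candidates {S : List E} {x c : E} {l : Fin m} :
    c ∈ (trueAnswers M f).candidates S x l ↔ c ∈ S ∧ c ∈ (M l).E ∧
      (M l).Indep (insert x ({y | y ∈ S ∧ y ∈ (M l).E} \ {c})) := by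
  simp only [Answers.candidates, List.mem_filter, decide_eq_true_eq]
  rw [← coe_part M f]
  simp [trueAnswers]

theorem insert_part_indep_iff {S : List E} {x : E} {l : Fin m} :
    (trueAnswers M f).ind l (insert x ((trueAnswers M f).part S l)) ↔
      (M l).Indep (insert x {y | y ∈ S ∧ y ∈ (M l).E}) := by
  rw [← coe_part M f]
  simp [trueAnswers]

/-- The candidates form the fundamental circuit of `x` without `x`, so the evicted element is a
cheapest element of a circuit. -/
theorem mem_fundCircuit_iff_mem_candidates {S : List E} {x y : E} {l : Fin m}
    (hI : (M l).Indep {y | y ∈ S ∧ y ∈ (M l).E}) (hxS : x ∉ S) (hx : x ∈ (M l).E)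
    (hdep : ¬ (M l).Indep (insert x {y | y ∈ S ∧ y ∈ (M l).E})) (hyx : y ≠ x) :
    y ∈ (M l).fundCircuit x {y | y ∈ S ∧ y ∈ (M l).E} ↔
      y ∈ (trueAnswers M f).candidates S x l := by
  have hxcl : x ∈ (M l).closure {y | y ∈ S ∧ y ∈ (M l).E} :=
    hI.mem_closure_iff'.2 ⟨hx, fun h => absurd h hdep⟩
  have hiff := hI.mem_fundCircuit_iff (x := y) hxcl fun h => hxS h.1
  rw [mem_candidates]
  constructor
  · intro hy
    obtain h | h := (M l).fundCircuit_subset_insert x _ hy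
    · exact absurd h hyx
    · refine ⟨h.1, h.2, ?_⟩
      rw [hiff] at hy
      rwa [Set.insert_sdiff_of_notMem _ (by simpa using hyx.symm)] at hy
  · rintro ⟨-, -, h⟩
    rw [hiff, Set.insert_sdiff_of_notMem _ (by simpa using hyx.symm)]
    exact h

theorem candidates_ne_nil {S : List E} {x : E} {l : Fin m}
    (hI : (M l).Indep {y | y ∈ S ∧ y ∈ (M l).E}) (hxS : x ∉ S) (hx : x ∈ (M l).E)
    (hloop : (M l).Indep {x})
    (hdep : ¬ (M l).Indep (insert x {y | y ∈ S ∧ y ∈ (M l).E})) :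
    (trueAnswers M f).candidates S x l ≠ [] := by
  have hxcl : x ∈ (M l).closure {y | y ∈ S ∧ y ∈ (M l).E} :=
    hI.mem_closure_iff'.2 ⟨hx, fun h => absurd h hdep⟩
  have hC := hI.fundCircuit_isCircuit hxcl fun h => hxS h.1
  have : ∃ y ∈ (M l).fundCircuit x {y | y ∈ S ∧ y ∈ (M l).E}, y ≠ x := by
    by_contra! h
    exact hC.dep.not_indep (hloop.subset h)
  obtain ⟨y, hy, hyx⟩ := this
  exact List.ne_nil_of_mem ((mem_fundCircuit_iff_mem_candidates hI hxS hx hdep hyx).1 hy)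

/-- Infeasibility excludes only loops. Thus an element that occurs in an independent set can be
rejected only because of its value. -/
theorem feasible_of_nonloop {S : List E} {x : E}
    (hI : ∀ l, (M l).Indep {y | y ∈ S ∧ y ∈ (M l).E}) (hxS : x ∉ S)
    (hloop : ∀ l, x ∈ (M l).E → (M l).Indep {x}) : (trueAnswers M f).Feasible S x := by
  intro l hl
  rw [insert_part_indep_iff]
  by_cases h : (M l).Indep (insert x {y | y ∈ S ∧ y ∈ (M l).E})
  · exact Or.inl h
  · exact Or.inr (candidates_ne_nil (hI l) hxS hl (hloop l hl) h)

/-- Every element of a circuit is spanned by the others. In the circuit closed by `x`, all elements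
other than `x` have at least the increment of the minimiser `c`; removing `x` or `c` from the
circuit gives the two closure statements. -/
theorem evicted_spec {S : List E} {x c : E} {l : Fin m}
    (hI : (M l).Indep {y | y ∈ S ∧ y ∈ (M l).E}) (hxS : x ∉ S)
    (hc : (trueAnswers M f).evicted S x l = some c) :
    c ∈ S ∧ c ∈ (M l).E ∧ x ∈ (M l).E ∧
      (M l).Indep (insert x ({y | y ∈ S ∧ y ∈ (M l).E} \ {c})) ∧
      x ∈ (M l).closure {s | s ∈ S ∧ s ∈ (M l).E ∧ increment f S c ≤ increment f S s} ∧
      c ∈ (M l).closure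
        (insert x {s | s ∈ S ∧ s ∈ (M l).E ∧ s ≠ c ∧ increment f S c ≤ increment f S s}) := by
  unfold Answers.evicted at hc
  split_ifs at hc with h
  obtain ⟨hx, hdep⟩ := h
  rw [insert_part_indep_iff] at hdep
  have hx : x ∈ (M l).E := hx
  have hcc := List.argmin_mem hc
  have hmin : ∀ y ∈ (trueAnswers M f).candidates S x l, increment f S c ≤ increment f S y :=
    fun y hy => List.le_of_mem_argmin hy hc
  obtain ⟨hcS, hcE, hcI⟩ := mem_candidates.1 hcc
  have hcx : c ≠ x := fun h => hxS (h ▸ hcS)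
  have hxcl : x ∈ (M l).closure {y | y ∈ S ∧ y ∈ (M l).E} :=
    hI.mem_closure_iff'.2 ⟨hx, fun h => absurd h hdep⟩
  have hC := hI.fundCircuit_isCircuit hxcl fun h => hxS h.1
  have hcirc : ∀ y ∈ (M l).fundCircuit x {y | y ∈ S ∧ y ∈ (M l).E}, y ≠ x →
      y ∈ S ∧ y ∈ (M l).E ∧ increment f S c ≤ increment f S y := by
    intro y hy hyx
    have hyc := (mem_fundCircuit_iff_mem_candidates (f := f) hI hxS hx hdep hyx).1 hy
    exact ⟨(mem_candidates.1 hyc).1, (mem_candidates.1 hyc).2.1, hmin y hyc⟩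
  refine ⟨hcS, hcE, hx, hcI, ?_, ?_⟩
  · refine (M l).closure_mono ?_ (hC.mem_closure_sdiff_singleton_of_mem ((M l).mem_fundCircuit x _))
    exact fun y hy => hcirc y hy.1 hy.2
  · refine (M l).closure_mono ?_ (hC.mem_closure_sdiff_singleton_of_mem
      ((mem_fundCircuit_iff_mem_candidates (f := f) hI hxS hx hdep hcx).2 hcc))
    intro y hy
    by_cases hyx : y = x
    · exact Or.inl hyx
    · obtain ⟨h1, h2, h3⟩ := hcirc y hy.1 hyx
      exact Or.inr ⟨h1, h2, hy.2, h3⟩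

theorem mem_evictedSet {S : List E} {x c : E} :
    c ∈ (trueAnswers M f).evictedSet S x ↔
      c ∈ S ∧ ∃ l, (trueAnswers M f).evicted S x l = some c := by
  simp [Answers.evictedSet]

theorem mem_exchange {O : Answers E m} {S : List E} {x y : E} :
    y ∈ O.exchange S x ↔ (y ∈ S ∧ y ∉ O.evictedSet S x) ∨ y = x := by
  simp [Answers.exchange]

theorem exchange_indep {S : List E} {x : E} (hxS : x ∉ S)
    (hI : ∀ l, (M l).Indep {y | y ∈ S ∧ y ∈ (M l).E})
    (hx : (trueAnswers M f).Feasible S x) (l : Fin m) :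
    (M l).Indep {y | y ∈ (trueAnswers M f).exchange S x ∧ y ∈ (M l).E} := by
  by_cases hxl : x ∈ (M l).E
  · have hfeas := hx l hxl
    rw [insert_part_indep_iff] at hfeas
    by_cases hins : (M l).Indep (insert x {y | y ∈ S ∧ y ∈ (M l).E})
    · refine hins.subset ?_
      rintro y ⟨hy, hyl⟩
      obtain h | h := mem_exchange.1 hy
      · exact Or.inr ⟨h.1, hyl⟩
      · exact Or.inl h
    · have hne := hfeas.resolve_left hins
      have hev : (trueAnswers M f).evicted S x l =
          ((trueAnswers M f).candidates S x l).argmin (increment f S) := by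
        unfold Answers.evicted
        rw [insert_part_indep_iff, if_pos ⟨hxl, hins⟩]
        rfl
      obtain ⟨c, hc⟩ := Option.ne_none_iff_exists'.1
        (mt (List.argmin_eq_none (f := increment f S)).1 hne)
      rw [hc] at hev
      obtain ⟨hcS, -, -, hcI, -⟩ := evicted_spec (hI l) hxS hev
      refine hcI.subset ?_
      rintro y ⟨hy, hyl⟩
      obtain h | h := mem_exchange.1 hy
      · refine Or.inr ⟨⟨h.1, hyl⟩, ?_⟩
        rintro rfl
        exact h.2 (mem_evictedSet.2 ⟨h.1, l, hev⟩)
      · exact Or.inl h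
  · refine (hI l).subset ?_
    rintro y ⟨hy, hyl⟩
    obtain h | h := mem_exchange.1 hy
    · exact ⟨h.1, hyl⟩
    · exact absurd (h ▸ hyl) hxl

end Matroid

end Exchange

/-! ### The accounts kept along a run of one copy -/

section Analysis

open scoped Classical

variable {E : Type u} {m : ℕ} {M : Fin m → Matroid E} {f : Finset E → ℝ}

theorem increment_le_increment_exchange (hf : IsNonnegSubmodularOn (matchoidGround M) f)
    {O : Answers E m} {S : List E} (hS : ∀ y ∈ S, y ∈ matchoidGround M) {x s : E} (hs : s ∈ S)
    (hsx : s ∉ O.evictedSet S x) : increment f S s ≤ increment f (O.exchange S x) s := by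
  unfold Answers.exchange
  rw [increment_append_of_mem _ (by simp [hs, hsx])]
  exact increment_le_increment_filter hf hS (p := fun y => y ∉ O.evictedSet S x) hs hsx

/-- As `x` comes last, its increment is its marginal value over the survivors of `S`, which is at
least that over `S`. -/
theorem le_increment_exchange_self (hf : IsNonnegSubmodularOn (matchoidGround M) f)
    {S : List E} (hS : ∀ y ∈ S, y ∈ matchoidGround M) {x : E} (hxS : x ∉ S)
    (hx : x ∈ matchoidGround M) {α : ℝ} (hacc : (trueAnswers M f).Accepts α S x) :
    α + 2 * ∑ c ∈ (trueAnswers M f).evictedSet S x, increment f S c ≤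
      increment f ((trueAnswers M f).exchange S x) x := by
  unfold Answers.exchange
  rw [increment_append_singleton _ (by simp [hxS])]
  refine hacc.2.trans (hf.insert_sub_le (fun y hy => hS y (by simpa using hy)) hx ?_
    (by simpa using hxS))
  intro y hy
  simp only [List.mem_toFinset, List.mem_filter] at hy ⊢
  exact hy.1

/-- Of the two multiples of the evicted value in the test, one pays for the removal and one remains.
This makes the total evicted value at most the value gained. -/
theorem exchange_gain (hf : IsNonnegSubmodularOn (matchoidGround M) f)
    {S : List E} (hnd : S.Nodup) (hS : ∀ y ∈ S, y ∈ matchoidGround M) {x : E} (hxS : x ∉ S)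
    (hx : x ∈ matchoidGround M) {α : ℝ} (hacc : (trueAnswers M f).Accepts α S x) :
    f S.toFinset + α + ∑ c ∈ (trueAnswers M f).evictedSet S x, increment f S c ≤
      f ((trueAnswers M f).exchange S x).toFinset := by
  have h1 := le_increment_exchange_self hf hS hxS hx hacc
  unfold Answers.exchange at h1 ⊢
  rw [increment_append_singleton _ (by simp [hxS])] at h1
  rw [toFinset_append_singleton]
  have h2 := sub_filter_le_sum_increment hf hnd hS ((trueAnswers M f).evictedSet S x)
  have h3 : S.toFinset.filter (· ∈ (trueAnswers M f).evictedSet S x) =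
      (trueAnswers M f).evictedSet S x := by
    ext y
    simp only [Finset.mem_filter, List.mem_toFinset, mem_evictedSet]
    tauto
  rw [h3] at h2
  linarith

/-- The final value of the elements of the current solution, and the given value of the others. -/
noncomputable def weight (f : Finset E → ℝ) (S : List E) (χ : E → ℝ) (z : E) : ℝ :=
  if z ∈ S then increment f S z else χ z

/-- The accounts which relate the elements that were rejected to those that were in the solution
at some time: `χ` is the value of an element when it was evicted, `K z l` says that `z` was evicted
because of the `l`-th matroid, and `a t l` is the value of the element which rejected `t` in the
`l`-th matroid. -/
structure Ledger (M : Fin m → Matroid E) (f : Finset E → ℝ) (α : ℝ) (seen : Set E) (S B : List E)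
    (U : Finset E) (χ : E → ℝ) (K : E → Fin m → Prop) (a : E → Fin m → ℝ) : Prop where
  nonneg : ∀ d ∈ U, d ∉ S → 0 ≤ χ d
  killed : ∀ d ∈ U, d ∉ S → ∃ l, K d l ∧ d ∈ (M l).E
  energy : ∑ d ∈ U \ S.toFinset, χ d ≤ f S.toFinset - f ∅
  union : f U ≤ f S.toFinset + ∑ d ∈ U \ S.toFinset, χ d
  rejected_nonneg : ∀ t l, 0 ≤ a t l
  -- The set spanning `t` leaves out what was evicted through the `l`-th matroid itself; this saves
  -- one charge for every evicted element. Loops are excluded, as they are rejected regardless of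
  -- value.
  rejected : ∀ t ∈ seen, t ∉ B → t ∉ U → (∀ l, t ∈ (M l).E → (M l).Indep {t}) →
    f (insert t U) - f U ≤ α + 2 * ∑ l, a t l ∧
    ∀ l, 0 < a t l → t ∈ (M l).E ∧ t ∈ (M l).closure
      {z | z ∈ U ∧ z ∈ (M l).E ∧ (z ∉ S → ¬ K z l) ∧ a t l ≤ weight f S χ z}

/-- The invariant of the algorithm: `seen` is the set of elements read so far, `S` the current
solution, `B` the buffer, and `U` the set of all elements that ever were in the solution. -/
structure ExchangeInvariant (M : Fin m → Matroid E) (f : Finset E → ℝ) (α : ℝ) (seen : Set E)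
    (S B : List E) (U : Finset E) : Prop where
  nodup : S.Nodup
  nodup_buffer : B.Nodup
  mem_union : ∀ x ∈ S, x ∈ U
  union_seen : ∀ x ∈ U, x ∈ seen
  buffer_seen : ∀ x ∈ B, x ∈ seen ∧ x ∉ U
  indep : ∀ l, (M l).Indep {y | y ∈ S ∧ y ∈ (M l).E}
  increment_nonneg : ∀ s ∈ S, 0 ≤ increment f S s
  ledger : ∃ χ K a, Ledger M f α seen S B U χ K a

theorem exchangeInvariant_empty (M : Fin m → Matroid E) (f : Finset E → ℝ) (α : ℝ) :
    ExchangeInvariant M f α ∅ [] [] ∅ where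
  nodup := List.nodup_nil
  nodup_buffer := List.nodup_nil
  mem_union := by simp
  union_seen := by simp
  buffer_seen := by simp
  indep l := by simp
  increment_nonneg := by simp
  ledger := ⟨fun _ => 0, fun _ _ => False, fun _ _ => 0, by
    constructor <;> simp⟩

/-- The value of the element which has to make room for `t` in the `l`-th matroid. -/
noncomputable def rejectionValue (M : Fin m → Matroid E) (f : Finset E → ℝ) (S : List E) (t : E)
    (l : Fin m) : ℝ :=
  ((trueAnswers M f).evicted S t l).elim 0 (increment f S)

/-- Every evicted element is counted on the right for at least one matroid; since it may be counted
for several, its increment has to be nonnegative. -/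
theorem sum_evictedSet_le {S : List E} {t : E} (hpos : ∀ s ∈ S, 0 ≤ increment f S s) :
    ∑ c ∈ (trueAnswers M f).evictedSet S t, increment f S c ≤ ∑ l, rejectionValue M f S t l := by
  calc ∑ c ∈ (trueAnswers M f).evictedSet S t, increment f S c
      ≤ ∑ c ∈ (trueAnswers M f).evictedSet S t, ∑ l,
          if (trueAnswers M f).evicted S t l = some c then increment f S c else 0 := by
        refine Finset.sum_le_sum fun c hc => ?_
        obtain ⟨hcS, l, hl⟩ := mem_evictedSet.1 hc
        have := Finset.single_le_sum (s := Finset.univ)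
          (f := fun l => if (trueAnswers M f).evicted S t l = some c then increment f S c else 0)
          (fun i _ => by
            split_ifs
            · exact hpos c hcS
            · exact le_rfl) (Finset.mem_univ l)
        simpa [hl] using this
    _ = ∑ l, ∑ c ∈ (trueAnswers M f).evictedSet S t,
          if (trueAnswers M f).evicted S t l = some c then increment f S c else 0 :=
        Finset.sum_comm
    _ ≤ ∑ l, rejectionValue M f S t l := by
        refine Finset.sum_le_sum fun l _ => ?_
        unfold rejectionValue
        cases h : (trueAnswers M f).evicted S t l with
        | none => simp
        | some c =>
          simp only [Option.some.injEq, Option.elim_some, Finset.sum_ite_eq]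
          split_ifs with hc
          · exact le_rfl
          · unfold increment
            split_ifs with hcS
            · exact absurd (mem_evictedSet.2 ⟨hcS, l, h⟩) hc
            · exact le_rfl

/-- Buffered elements that fail the repeated test are treated like a failing new one: their accounts
refer to the current `S`. The test bounds the marginal value over `S`, hence over the larger set
`U`. Accounts of elements that pass are overwritten too, which is harmless because they stay in the
buffer. -/
theorem Ledger.reject {α : ℝ} {seen : Set E} {S B : List E} {U : Finset E} {χ : E → ℝ}
    {K : E → Fin m → Prop} {a : E → Fin m → ℝ}
    (hf : IsNonnegSubmodularOn (matchoidGround M) f) (h : Ledger M f α seen S B U χ K a)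
    (hSU : ∀ x ∈ S, x ∈ U) (hseen : ∀ x ∈ seen, x ∈ matchoidGround M) (hU : ∀ x ∈ U, x ∈ seen)
    (hindep : ∀ l, (M l).Indep {y | y ∈ S ∧ y ∈ (M l).E})
    (hpos : ∀ s ∈ S, 0 ≤ increment f S s) (hBseen : ∀ x ∈ B, x ∈ seen)
    {e : E} (he : e ∈ matchoidGround M) :
    Ledger M f α (insert e seen) S ((trueAnswers M f).pool α (S, B) e) U χ K fun t l =>
      if t ∈ B ∨ t = e then rejectionValue M f S t l else a t l where
  nonneg := h.nonneg
  killed := h.killed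
  energy := h.energy
  union := h.union
  rejected_nonneg t l := by
    split_ifs
    · unfold rejectionValue
      cases hc : (trueAnswers M f).evicted S t l with
      | none => simp
      | some c =>
        simp only [Option.elim_some]
        unfold increment
        split_ifs with hcS
        · have := hpos c hcS
          rwa [increment, if_pos hcS] at this
        · exact le_rfl
    · exact h.rejected_nonneg t l
  rejected t ht htP htU hloop := by
    by_cases htB : t ∈ B ∨ t = e
    · simp only [htB, if_true]
      have htS : t ∉ S := fun h => htU (hSU t h)
      have htN : t ∈ matchoidGround M := by
        obtain h | rfl := htB
        · exact hseen t (hBseen t h)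
        · exact he
      have hnacc : ¬ (trueAnswers M f).Accepts α S t := by
        intro hacc
        refine htP ?_
        simp only [Answers.pool, List.mem_filter, List.mem_append, List.mem_singleton,
          decide_eq_true_eq]
        exact ⟨htB, hacc⟩
      have hlt : f (insert t S.toFinset) - f S.toFinset <
          α + 2 * ∑ c ∈ (trueAnswers M f).evictedSet S t, increment f S c := by
        by_contra! hle
        exact hnacc ⟨feasible_of_nonloop hindep htS hloop, hle⟩
      have hanti := hf.insert_sub_le (A := S.toFinset) (B := U) (x := t)
        (fun y hy => hseen y (hU y hy)) htN (fun y hy => hSU y (by simpa using hy)) htU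
      refine ⟨?_, ?_⟩
      · have := sum_evictedSet_le (M := M) (t := t) hpos
        linarith
      · intro l hl
        unfold rejectionValue at hl ⊢
        cases hc : (trueAnswers M f).evicted S t l with
        | none => simp [hc] at hl
        | some c =>
          obtain ⟨-, -, h1, -, h2, -⟩ := evicted_spec (hindep l) htS hc
          refine ⟨h1, (M l).closure_mono ?_ h2⟩
          rintro s ⟨hs, hsl, hle⟩
          refine ⟨hSU s hs, hsl, fun h => absurd hs h, ?_⟩
          simpa [weight, hs] using hle
    · simp only [htB, if_false]
      rw [not_or] at htB
      exact h.rejected t (ht.resolve_left htB.2) htB.1 htU hloop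

theorem ExchangeInvariant.reject {α : ℝ} {seen : Set E} {S B : List E} {U : Finset E}
    (hf : IsNonnegSubmodularOn (matchoidGround M) f) (h : ExchangeInvariant M f α seen S B U)
    (hseen : ∀ x ∈ seen, x ∈ matchoidGround M) {e : E} (he : e ∈ matchoidGround M)
    (hes : e ∉ seen) :
    ExchangeInvariant M f α (insert e seen) S ((trueAnswers M f).pool α (S, B) e) U where
  nodup := h.nodup
  nodup_buffer := by
    refine List.Nodup.filter _ (List.nodup_append.2 ⟨h.nodup_buffer, by simp, ?_⟩)
    rintro x hx y hy rfl
    rw [List.mem_singleton] at hy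
    exact hes (hy ▸ (h.buffer_seen x hx).1)
  mem_union := h.mem_union
  union_seen x hx := Or.inr (h.union_seen x hx)
  buffer_seen x hx := by
    simp only [Answers.pool, List.mem_filter, List.mem_append, List.mem_singleton] at hx
    obtain ⟨hx | rfl, -⟩ := hx
    · exact ⟨Or.inr (h.buffer_seen x hx).1, (h.buffer_seen x hx).2⟩
    · exact ⟨Or.inl rfl, fun hU => hes (h.union_seen x hU)⟩
  indep := h.indep
  increment_nonneg := h.increment_nonneg
  ledger := by
    obtain ⟨χ, K, a, hL⟩ := h.ledger
    exact ⟨_, _, _, hL.reject hf h.mem_union hseen h.union_seen h.indep h.increment_nonneg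
      (fun x hx => (h.buffer_seen x hx).1) he⟩

/-- In the `l`-th matroid only the element evicted through it leaves the spanning sets. It is
spanned by `x` and the elements of its circuit that are at least as valuable. These stay available:
`x` is worth at least twice all that it evicts, survivors do not lose value, and an element evicted
only through other matroids keeps its last increment as `χ`. -/
theorem Ledger.exchange {α : ℝ} (hα : 0 ≤ α) {seen : Set E} {S P : List E} {U : Finset E}
    {χ : E → ℝ} {K : E → Fin m → Prop} {a : E → Fin m → ℝ}
    (hf : IsNonnegSubmodularOn (matchoidGround M) f) (h : Ledger M f α seen S P U χ K a)
    (hnd : S.Nodup) (hSU : ∀ x ∈ S, x ∈ U) (hseen : ∀ x ∈ seen, x ∈ matchoidGround M)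
    (hU : ∀ x ∈ U, x ∈ seen) (hindep : ∀ l, (M l).Indep {y | y ∈ S ∧ y ∈ (M l).E})
    (hpos : ∀ s ∈ S, 0 ≤ increment f S s) {x : E} (hx : x ∈ seen) (hxU : x ∉ U)
    (hacc : (trueAnswers M f).Accepts α S x) :
    Ledger M f α seen ((trueAnswers M f).exchange S x) (P.erase x) (insert x U)
      (fun z => if z ∈ S then increment f S z else χ z)
      (fun z l => if z ∈ S then (trueAnswers M f).evicted S x l = some z else K z l) a := by
  set O := trueAnswers M f with hO
  set C := O.evictedSet S x with hC
  have hxS : x ∉ S := fun h => hxU (hSU x h)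
  have hxN := hseen x hx
  have hSN : ∀ y ∈ S, y ∈ matchoidGround M := fun y hy => hseen y (hU y (hSU y hy))
  have hUN : (U : Set E) ⊆ matchoidGround M := fun y hy => hseen y (hU y hy)
  have hCS : C ⊆ S.toFinset := Finset.filter_subset _ _
  have hCpos : ∀ c ∈ C, 0 ≤ increment f S c := fun c hc => hpos c (by simpa using hCS hc)
  have hgain := exchange_gain hf hnd hSN hxS hxN hacc
  have hself := le_increment_exchange_self hf hSN hxS hxN hacc
  rw [← hO, ← hC] at hgain hself
  -- Since `x` is new to `U`, no element returns to the solution, so no eviction is forgotten or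
  -- counted twice.
  have hout : insert x U \ (O.exchange S x).toFinset = (U \ S.toFinset) ∪ C := by
    ext y
    simp only [Finset.mem_sdiff, Finset.mem_insert, List.mem_toFinset, mem_exchange,
      Finset.mem_union, ← hC]
    have hCS' : y ∈ C → y ∈ S := fun hy => by simpa using hCS hy
    have := hSU y
    constructor
    · rintro ⟨rfl | h1, h2⟩
      · tauto
      · tauto
    · rintro (⟨h1, h2⟩ | h1)
      · refine ⟨Or.inr h1, ?_⟩
        rintro (h | rfl)
        · exact h2 h.1
        · exact hxU h1
      · refine ⟨Or.inr (this (hCS' h1)), ?_⟩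
        rintro (h | rfl)
        · exact h.2 h1
        · exact hxS (hCS' h1)
  have hdisj : Disjoint (U \ S.toFinset) C := by
    rw [Finset.disjoint_left]
    intro y hy hyC
    exact (Finset.mem_sdiff.1 hy).2 (hCS hyC)
  have hsum : ∑ d ∈ insert x U \ (O.exchange S x).toFinset,
      (if d ∈ S then increment f S d else χ d) =
      ∑ d ∈ U \ S.toFinset, χ d + ∑ c ∈ C, increment f S c := by
    rw [hout, Finset.sum_union hdisj]
    congr 1
    · refine Finset.sum_congr rfl fun d hd => if_neg ?_
      simpa using (Finset.mem_sdiff.1 hd).2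
    · exact Finset.sum_congr rfl fun d hd => if_pos (by simpa using hCS hd)
  have hcases : ∀ d ∈ insert x U, d ∉ O.exchange S x → d ∈ C ∨ (d ∈ U ∧ d ∉ S) := by
    intro d hd hdS
    have : d ∈ insert x U \ (O.exchange S x).toFinset := by
      simp only [Finset.mem_sdiff, List.mem_toFinset]; exact ⟨hd, hdS⟩
    rw [hout] at this
    simp only [Finset.mem_union, Finset.mem_sdiff, List.mem_toFinset] at this
    tauto
  refine
    { nonneg := ?_, killed := ?_, energy := ?_, union := ?_, rejected_nonneg := h.rejected_nonneg
      rejected := ?_ }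
  · intro d hd hdS
    obtain hdC | ⟨hdU, hdS⟩ := hcases d hd hdS
    · rw [if_pos (by simpa using hCS hdC)]
      exact hCpos d hdC
    · rw [if_neg hdS]
      exact h.nonneg d hdU hdS
  · intro d hd hdS
    obtain hdC | ⟨hdU, hdS⟩ := hcases d hd hdS
    · obtain ⟨hdS, l, hl⟩ := mem_evictedSet.1 hdC
      refine ⟨l, ?_, (evicted_spec (hindep l) hxS hl).2.1⟩
      rw [if_pos hdS]
      exact hl
    · simp only [hdS, if_false]
      exact h.killed d hdU hdS
  · rw [hsum]
    linarith [h.energy]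
  · rw [hsum]
    have h1 := hf.insert_sub_le (A := S.toFinset) (B := U) (x := x) hUN hxN
      (fun y hy => hSU y (by simpa using hy)) hxU
    -- `f(S + x) - f(S')` is what removing `C` costs in the presence of `x`, which is at most what
    -- it costs in `S`.
    have h2 : f (insert x S.toFinset) - f (O.exchange S x).toFinset ≤
        ∑ c ∈ C, increment f S c := by
      have h3 := sub_filter_le_sum_increment hf hnd hSN C
      have h4 : S.toFinset.filter (· ∈ C) = C := Finset.filter_mem_eq_inter.trans
        (Finset.inter_eq_right.2 hCS)
      rw [h4] at h3
      have h5 := hf.insert_sub_le (A := (S.filter fun y => decide (y ∉ C)).toFinset)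
        (B := S.toFinset) (x := x) (fun y hy => hSN y (by simpa using hy)) hxN
        (fun y hy => by simp only [List.mem_toFinset, List.mem_filter] at hy ⊢; exact hy.1)
        (by simpa using hxS)
      unfold Answers.exchange
      rw [toFinset_append_singleton, ← hC]
      linarith
    linarith [h.union]
  · intro t ht htP htU hloop
    have htx : t ≠ x := fun h => htU (by simp [h])
    have htU' : t ∉ U := fun h => htU (by simp [h])
    have htP' : t ∉ P := fun h => htP ((List.mem_erase_of_ne htx).2 h)
    obtain ⟨h1, h2⟩ := h.rejected t ht htP' htU' hloop
    refine ⟨?_, ?_⟩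
    · have := hf.insert_sub_le (A := U) (B := insert x U) (x := t)
        (by rw [Finset.coe_insert]; exact Set.insert_subset hxN hUN) (hseen t ht)
        (Finset.subset_insert _ _) htU
      linarith
    · intro l hl
      obtain ⟨htl, hcl⟩ := h2 l hl
      refine ⟨htl, (M l).closure_subset_closure_of_subset_closure ?_ hcl⟩
      set θ := a t l
      set Z' : Set E := {z | z ∈ insert x U ∧ z ∈ (M l).E ∧
        (z ∉ O.exchange S x → ¬ (if z ∈ S then O.evicted S x l = some z else K z l)) ∧
        θ ≤ weight f (O.exchange S x) (fun z => if z ∈ S then increment f S z else χ z) z} with hZ'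
      have hZE : Z' ⊆ (M l).E := fun z hz => hz.2.1
      have hkeep : ∀ z ∈ S, z ∈ (M l).E → O.evicted S x l ≠ some z → θ ≤ increment f S z →
          z ∈ Z' := by
        intro z hzS hzl hzev hzθ
        refine ⟨Finset.mem_insert_of_mem (hSU z hzS), hzl, fun _ => ?_, ?_⟩
        · rwa [if_pos hzS]
        · unfold weight
          split_ifs with hz'
          · refine hzθ.trans (increment_le_increment_exchange hf hSN hzS ?_)
            obtain hz' | rfl := mem_exchange.1 hz'
            · exact hz'.2
            · exact absurd hzS hxS
          · simpa [hzS] using hzθ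
      rintro z ⟨hzU, hzl, hzK, hzw⟩
      by_cases hzS : z ∈ S
      · rw [weight, if_pos hzS] at hzw
        -- The only element to be replaced. Its substitutes are `x`, whose increment exceeds that of
        -- `z` by the factor 2 in the test, and the rest of the circuit.
        by_cases hev : O.evicted S x l = some z
        · obtain ⟨-, -, hxl, -, -, hzcl⟩ := evicted_spec (hindep l) hxS hev
          refine (M l).closure_mono ?_ hzcl
          intro s hs
          obtain rfl | ⟨hsS, hsl, hsz, hsle⟩ := hs
          · have hmem : s ∈ O.exchange S s := mem_exchange.2 (Or.inr rfl)
            refine ⟨Finset.mem_insert_self _ _, hxl, fun h => absurd hmem h, ?_⟩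
            rw [weight, if_pos hmem]
            have hzC : z ∈ C := mem_evictedSet.2 ⟨hzS, l, hev⟩
            have := Finset.single_le_sum hCpos hzC
            have := hCpos z hzC
            linarith
          · refine hkeep s hsS hsl ?_ (hzw.trans hsle)
            rw [hev]
            exact fun h => hsz (Option.some.inj h).symm
        · exact (M l).mem_closure_of_mem (hkeep z hzS hzl hev hzw) hZE
      · rw [weight, if_neg hzS] at hzw
        refine (M l).mem_closure_of_mem ⟨Finset.mem_insert_of_mem hzU, hzl, fun _ => ?_, ?_⟩ hZE
        · rw [if_neg hzS]
          exact hzK hzS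
        · have hzx : z ≠ x := fun h => hxU (h ▸ hzU)
          rw [weight, if_neg, if_neg hzS]
          · exact hzw
          · intro h
            obtain h | h := mem_exchange.1 h
            · exact hzS h.1
            · exact hzx h

theorem ExchangeInvariant.exchange {α : ℝ} (hα : 0 ≤ α) {seen : Set E} {S P : List E}
    {U : Finset E} (hf : IsNonnegSubmodularOn (matchoidGround M) f)
    (h : ExchangeInvariant M f α seen S P U) (hseen : ∀ x ∈ seen, x ∈ matchoidGround M) {x : E}
    (hx : x ∈ P) (hacc : (trueAnswers M f).Accepts α S x) :
    ExchangeInvariant M f α seen ((trueAnswers M f).exchange S x) (P.erase x) (insert x U) := by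
  obtain ⟨hxs, hxU⟩ := h.buffer_seen x hx
  have hxS : x ∉ S := fun hS => hxU (h.mem_union x hS)
  have hSN : ∀ y ∈ S, y ∈ matchoidGround M :=
    fun y hy => hseen y (h.union_seen y (h.mem_union y hy))
  refine
    { nodup := ?_, nodup_buffer := h.nodup_buffer.erase x, mem_union := ?_, union_seen := ?_
      buffer_seen := ?_, indep := exchange_indep hxS h.indep hacc.1, increment_nonneg := ?_
      ledger := ?_ }
  · refine List.nodup_append.2 ⟨h.nodup.filter _, by simp, ?_⟩
    rintro y hy z hz rfl
    rw [List.mem_singleton] at hz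
    exact hxS (hz ▸ (List.mem_filter.1 hy).1)
  · intro y hy
    obtain hy | rfl := mem_exchange.1 hy
    · exact Finset.mem_insert_of_mem (h.mem_union y hy.1)
    · exact Finset.mem_insert_self _ _
  · intro y hy
    obtain rfl | hy := Finset.mem_insert.1 hy
    · exact hxs
    · exact h.union_seen y hy
  · intro y hy
    rw [h.nodup_buffer.mem_erase_iff] at hy
    refine ⟨(h.buffer_seen y hy.2).1, ?_⟩
    rw [Finset.mem_insert, not_or]
    exact ⟨hy.1, (h.buffer_seen y hy.2).2⟩
  · intro s hs
    obtain hs | rfl := mem_exchange.1 hs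
    · exact (h.increment_nonneg s hs.1).trans
        (increment_le_increment_exchange hf hSN hs.1 hs.2)
    · refine le_trans ?_ (le_increment_exchange_self hf hSN hxS (hseen s hxs) hacc)
      have : 0 ≤ ∑ c ∈ (trueAnswers M f).evictedSet S s, increment f S c :=
        Finset.sum_nonneg fun c hc => h.increment_nonneg c (mem_evictedSet.1 hc).1
      linarith
  · obtain ⟨χ, K, a, hL⟩ := h.ledger
    exact ⟨_, _, _, hL.exchange hα hf h.nodup h.mem_union hseen h.union_seen h.indep
      h.increment_nonneg hxs hxU hacc⟩

end Analysis

/-! ### Charging rejected elements, and the bound that holds on every run -/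

section Analysis

open scoped Classical

variable {E : Type u} {m : ℕ} {M : Fin m → Matroid E} {f : Finset E → ℝ}

theorem Matroid.Indep.card_le_of_subset_closure {N : Matroid E} {A Z : Finset E}
    (hA : N.Indep (A : Set E)) (h : (A : Set E) ⊆ N.closure (Z : Set E)) : A.card ≤ Z.card := by
  have h1 : (A : Set E).encard ≤ (Z : Set E).encard := by
    calc (A : Set E).encard ≤ N.eRk (N.closure (Z : Set E)) := hA.encard_le_eRk_of_subset h
      _ = N.eRk (Z : Set E) := N.eRk_closure_eq _
      _ ≤ (Z : Set E).encard := N.eRk_le_encard _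
  rw [Set.encard_coe_eq_coe_finsetCard, Set.encard_coe_eq_coe_finsetCard] at h1
  exact_mod_cast h1

theorem MatchoidIndep.nonloop {T : Finset E} (hT : MatchoidIndep M T) {t : E} (ht : t ∈ T)
    (l : Fin m) (htl : t ∈ (M l).E) : (M l).Indep {t} :=
  (hT.2 l).subset (by simpa using ⟨ht, htl⟩)

theorem IsMatchoid.card_filter_le {p : ℕ} (hM : IsMatchoid p M) {z : E}
    (hz : z ∈ matchoidGround M) : (Finset.univ.filter fun l => z ∈ (M l).E).card ≤ p := by
  have h := hM.mem_le z hz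
  rwa [show {l | z ∈ (M l).E} = ((Finset.univ.filter fun l => z ∈ (M l).E : Finset (Fin m)) :
    Set (Fin m)) by ext; simp, Set.ncard_coe_finset] at h

/-- The total value of the elements that rejected elements of an independent set. -/
theorem Ledger.sum_rejected_le {p : ℕ} {α : ℝ} {seen : Set E} {S B : List E} {U : Finset E}
    {χ : E → ℝ} {K : E → Fin m → Prop} {a : E → Fin m → ℝ} (hM : IsMatchoid p M)
    (h : Ledger M f α seen S B U χ K a) (hSU : ∀ x ∈ S, x ∈ U) (hnd : S.Nodup)
    (hU : ∀ x ∈ U, x ∈ matchoidGround M)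
    (hpos : ∀ s ∈ S, 0 ≤ increment f S s) {R : Finset E} (hR : MatchoidIndep M R)
    (hRs : ∀ t ∈ R, t ∈ seen ∧ t ∉ B ∧ t ∉ U) :
    ∑ t ∈ R, ∑ l, a t l ≤ p * (f S.toFinset - f ∅) +
      (p - 1) * ∑ d ∈ U \ S.toFinset, χ d := by
  have hw : ∀ z ∈ U, 0 ≤ weight f S χ z := by
    intro z hz
    unfold weight
    split_ifs with hzS
    · exact hpos z hzS
    · exact h.nonneg z hz hzS
  -- `Z l` consists of the elements that may be charged in the `l`-th matroid. The rejected elements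
  -- of account at least `θ` are independent and spanned by the elements of `Z l` of weight at least
  -- `θ`, so there are no more of them.
  set Z : Fin m → Finset E := fun l => U.filter fun z => z ∈ (M l).E ∧ (z ∉ S → ¬ K z l) with hZ
  have hl : ∀ l, ∑ t ∈ R, a t l ≤ ∑ z ∈ Z l, weight f S χ z := by
    intro l
    refine sum_le_sum_of_card_filter_le R (Z l) (fun t => a t l) _
      (fun z hz => hw z (Finset.mem_filter.1 hz).1) ?_
    intro θ hθ
    have hrej : ∀ t ∈ R.filter fun t => θ ≤ a t l, t ∈ (M l).E ∧ t ∈ (M l).closure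
        {z | z ∈ U ∧ z ∈ (M l).E ∧ (z ∉ S → ¬ K z l) ∧ a t l ≤ weight f S χ z} := by
      intro t ht
      rw [Finset.mem_filter] at ht
      obtain ⟨h1, h2, h3⟩ := hRs t ht.1
      exact (h.rejected t h1 h2 h3 (hR.nonloop ht.1)).2 l (hθ.trans_le ht.2)
    refine Matroid.Indep.card_le_of_subset_closure (N := M l) ((hR.2 l).subset ?_) ?_
    · intro t ht
      exact ⟨(Finset.mem_filter.1 ht).1, (hrej t ht).1⟩
    · intro t ht
      refine (M l).closure_mono ?_ (hrej t ht).2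
      rintro z ⟨h1, h2, h3, h4⟩
      have := (Finset.mem_filter.1 ht).2
      simp only [hZ, Finset.coe_filter, Set.mem_ofPred_eq, Finset.mem_filter]
      exact ⟨⟨h1, h2, h3⟩, this.trans h4⟩
  have hSsub : S.toFinset ⊆ U := fun y hy => hSU y (by simpa using hy)
  calc ∑ t ∈ R, ∑ l, a t l = ∑ l, ∑ t ∈ R, a t l := Finset.sum_comm
    _ ≤ ∑ l, ∑ z ∈ Z l, weight f S χ z := Finset.sum_le_sum fun l _ => hl l
    _ = ∑ z ∈ U, ((Finset.univ.filter fun l => z ∈ (M l).E ∧ (z ∉ S → ¬ K z l)).card : ℝ) *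
          weight f S χ z := by
        simp_rw [hZ, Finset.sum_filter]
        rw [Finset.sum_comm]
        refine Finset.sum_congr rfl fun z _ => ?_
        rw [← Finset.sum_filter, Finset.sum_const, nsmul_eq_mul]
    _ = ∑ z ∈ U \ S.toFinset,
          ((Finset.univ.filter fun l => z ∈ (M l).E ∧ (z ∉ S → ¬ K z l)).card : ℝ) *
            weight f S χ z +
        ∑ z ∈ S.toFinset,
          ((Finset.univ.filter fun l => z ∈ (M l).E ∧ (z ∉ S → ¬ K z l)).card : ℝ) *
            weight f S χ z := (Finset.sum_sdiff hSsub).symm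
    _ ≤ ∑ z ∈ U \ S.toFinset, ((p : ℝ) - 1) * χ z +
        ∑ z ∈ S.toFinset, (p : ℝ) * increment f S z := by
        refine add_le_add (Finset.sum_le_sum fun z hz => ?_) (Finset.sum_le_sum fun z hz => ?_)
        · rw [Finset.mem_sdiff, List.mem_toFinset] at hz
          obtain ⟨l, hKl, hzl⟩ := h.killed z hz.1 hz.2
          rw [weight, if_neg hz.2]
          refine mul_le_mul_of_nonneg_right ?_ (h.nonneg z hz.1 hz.2)
          -- The matroid through which `z` was evicted does not charge it: hence `p - 1`.
          have : (Finset.univ.filter fun l => z ∈ (M l).E ∧ (z ∉ S → ¬ K z l)).card <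
              (Finset.univ.filter fun l => z ∈ (M l).E).card := by
            refine Finset.card_lt_card ⟨fun i hi => ?_, fun hsub => ?_⟩
            · simp only [Finset.mem_filter] at hi ⊢
              exact ⟨hi.1, hi.2.1⟩
            · have := hsub (Finset.mem_filter.2 ⟨Finset.mem_univ l, hzl⟩)
              exact (Finset.mem_filter.1 this).2.2 hz.2 hKl
          have h2 := this.trans_le (hM.card_filter_le (hU z hz.1))
          have h3 : ((Finset.univ.filter fun l => z ∈ (M l).E ∧ (z ∉ S → ¬ K z l)).card : ℝ) + 1
              ≤ p := by exact_mod_cast h2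
          linarith
        · rw [List.mem_toFinset] at hz
          rw [weight, if_pos hz]
          refine mul_le_mul_of_nonneg_right ?_ (hpos z hz)
          have : (Finset.univ.filter fun l => z ∈ (M l).E ∧ (z ∉ S → ¬ K z l)).card ≤ p :=
            (Finset.card_le_card fun i hi => by
              simp only [Finset.mem_filter] at hi ⊢
              exact ⟨hi.1, hi.2.1⟩).trans (hM.card_filter_le (hU z (hSU z hz)))
          exact_mod_cast this
    _ = p * (f S.toFinset - f ∅) + (p - 1) * ∑ d ∈ U \ S.toFinset, χ d := by
        rw [← Finset.mul_sum, ← Finset.mul_sum, sum_increment f hnd]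
        ring

/-- The guarantee of the algorithm on every run. -/
theorem ExchangeInvariant.union_le {p k : ℕ} {α : ℝ} (hα : 0 ≤ α) {seen : Set E} {S B : List E}
    {U : Finset E} (hM : IsMatchoid p M) (hf : IsNonnegSubmodularOn (matchoidGround M) f)
    (h : ExchangeInvariant M f α seen S B U) (hseen : ∀ x ∈ seen, x ∈ matchoidGround M)
    {T : Finset E} (hT : MatchoidIndep M T) (hTk : T.card ≤ k) (hTs : ∀ t ∈ T, t ∈ seen) :
    f (T ∪ U) ≤ k * α + 4 * p * f S.toFinset + f (T.filter (· ∈ B)) := by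
  obtain ⟨χ, K, a, hL⟩ := h.ledger
  have hUN : ∀ x ∈ U, x ∈ matchoidGround M := fun x hx => hseen x (h.union_seen x hx)
  have hTN : ∀ x ∈ T, x ∈ matchoidGround M := fun x hx => hseen x (hTs x hx)
  set R := T.filter fun t => t ∉ B ∧ t ∉ U with hRdef
  have hRT : R ⊆ T := Finset.filter_subset _ _
  have hR : MatchoidIndep M R :=
    ⟨fun x hx => hTN x (hRT hx), fun l => (hT.2 l).subset
      (Set.inter_subset_inter_left _ (Finset.coe_subset.2 hRT))⟩
  have hRs : ∀ t ∈ R, t ∈ seen ∧ t ∉ B ∧ t ∉ U := by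
    intro t ht
    rw [hRdef, Finset.mem_filter] at ht
    exact ⟨hTs t ht.1, ht.2⟩
  -- `U ∪ R` and `T ∩ B` are disjoint, because buffered elements never were in the solution.
  have h1 : f (T ∪ U) + f ∅ ≤ f (U ∪ R) + f (T.filter (· ∈ B)) := by
    have := hf.submodular (U ∪ R) (T.filter (· ∈ B))
      (fun x hx => by
        rw [Finset.mem_coe, Finset.mem_union] at hx
        exact hx.elim (hUN x) fun hx => hTN x (hRT hx))
      (fun x hx => hTN x (Finset.mem_filter.1 hx).1)
    rw [show U ∪ R ∪ T.filter (· ∈ B) = T ∪ U by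
        ext x; simp only [hRdef, Finset.mem_union, Finset.mem_filter]; tauto,
      show (U ∪ R) ∩ T.filter (· ∈ B) = ∅ by
        ext x
        simp only [hRdef, Finset.mem_union, Finset.mem_filter, Finset.mem_inter,
          Finset.notMem_empty, iff_false]
        rintro ⟨hx | hx, hx'⟩
        · exact (h.buffer_seen x hx'.2).2 hx
        · exact hx.2.1 hx'.2] at this
    exact this
  have h2 : f (U ∪ R) ≤ f U + ∑ t ∈ R, (α + 2 * ∑ l, a t l) :=
    hf.union_le_add_sum hUN (fun x hx => hTN x (hRT hx))
      (fun t _ => add_nonneg hα (mul_nonneg zero_le_two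
        (Finset.sum_nonneg fun l _ => hL.rejected_nonneg t l)))
      fun t ht _ => (hL.rejected t (hRs t ht).1 (hRs t ht).2.1 (hRs t ht).2.2 (hR.nonloop ht)).1
  rw [Finset.sum_add_distrib, Finset.sum_const, nsmul_eq_mul, ← Finset.mul_sum] at h2
  have h3 := hL.sum_rejected_le hM h.mem_union h.nodup hUN h.increment_nonneg hR hRs
  have h4 : (R.card : ℝ) * α ≤ k * α :=
    mul_le_mul_of_nonneg_right (by exact_mod_cast (Finset.card_le_card hRT).trans hTk) hα
  have h5 := hL.energy
  have h6 := hL.union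
  have h0 : 0 ≤ f ∅ := hf.nonneg ∅ (by simp)
  set X := ∑ d ∈ U \ S.toFinset, χ d
  -- The bound on `f(U)` contributes 1 to both coefficients, the charges contribute `2p` and `2(p -
  -- 1)`; then `X ≤ f(S) - f(∅)` gives `4p`. For `p = 0` the coefficient of `X` is negative, but
  -- then the ground set is empty and both terms vanish.
  have hmain : (1 + 2 * (p : ℝ)) * (f S.toFinset - f ∅) + (2 * p - 1) * X ≤
      4 * p * (f S.toFinset - f ∅) := by
    rcases Nat.eq_zero_or_pos p with rfl | hp
    · have hU0 : U = ∅ := by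
        refine Finset.eq_empty_of_forall_notMem fun z hz => ?_
        obtain ⟨l, hl⟩ := Set.mem_iUnion.1 (hUN z hz)
        have := hM.card_filter_le (hUN z hz)
        rw [Nat.le_zero, Finset.card_eq_zero] at this
        exact Finset.notMem_empty l (this ▸ Finset.mem_filter.2 ⟨Finset.mem_univ l, hl⟩)
      have hS0 : S.toFinset = ∅ := by
        refine Finset.eq_empty_of_forall_notMem fun z hz => ?_
        have := h.mem_union z (by simpa using hz)
        simp [hU0] at this
      have hX : X = 0 := by simp [X, hU0]
      simp [hS0, hX]
    · have hp' : (1 : ℝ) ≤ p := by exact_mod_cast hp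
      nlinarith
  have h7 : (0 : ℝ) ≤ 4 * p * f ∅ := by positivity
  nlinarith

end Analysis

/-! ### The random process of one copy -/

section Copy

open scoped Classical ENNReal

variable {E : Type u} {m : ℕ} {M : Fin m → Matroid E} {f : Finset E → ℝ}

/-- The law of the next state of one copy of the algorithm. -/
noncomputable def instKernel (O : Answers E m) (a b : ℕ) (α : ℝ) (s : List E × List E) (e : E) :
    PMF (List E × List E) :=
  -- For an empty pool this is the one-point space.
  (PMF.uniformOfFintype (Fin ((O.pool α s e).length - 1 + 1))).map fun r =>
    O.instStep a b α s e r.val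

/-- The law of the state of one copy of the algorithm after reading a list. -/
noncomputable def instLaw (M : Fin m → Matroid E) (f : Finset E → ℝ) (a b : ℕ) (α : ℝ)
    (l : List E) : PMF (List E × List E) :=
  l.foldl (fun μ e => μ.bind fun s => instKernel (trueAnswers M f) a b α s e) (PMF.pure ([], []))

/-- The joint law of the state and of the set of all elements that ever were in the solution. -/
noncomputable def historyLaw (M : Fin m → Matroid E) (f : Finset E → ℝ) (a b : ℕ) (α : ℝ)
    (l : List E) : PMF ((List E × List E) × Finset E) :=
  l.foldl (fun μ e => μ.bind fun s => (instKernel (trueAnswers M f) a b α s.1 e).map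
    fun s' => (s', s.2 ∪ s'.1.toFinset)) (PMF.pure (([], []), ∅))

theorem instLaw_append_singleton (a b : ℕ) (α : ℝ) (l : List E) (e : E) :
    instLaw M f a b α (l ++ [e]) =
      (instLaw M f a b α l).bind fun s => instKernel (trueAnswers M f) a b α s e := by
  simp [instLaw]

theorem historyLaw_append_singleton (a b : ℕ) (α : ℝ) (l : List E) (e : E) :
    historyLaw M f a b α (l ++ [e]) =
      (historyLaw M f a b α l).bind fun s => (instKernel (trueAnswers M f) a b α s.1 e).map
        fun s' => (s', s.2 ∪ s'.1.toFinset) := by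
  simp [historyLaw]

theorem map_fst_historyLaw (a b : ℕ) (α : ℝ) (l : List E) :
    (historyLaw M f a b α l).map Prod.fst = instLaw M f a b α l := by
  induction l using List.reverseRecOn with
  | nil => simp [historyLaw, instLaw, PMF.pure_map]
  | append_singleton l e ih =>
    rw [historyLaw_append_singleton, instLaw_append_singleton, ← ih, PMF.map_bind, PMF.bind_map]
    congr 1
    funext s
    rw [PMF.map_comp]
    exact PMF.map_id _

theorem ExchangeInvariant.matchoidIndep {α : ℝ} {seen : Set E} {S B : List E} {U : Finset E}
    (h : ExchangeInvariant M f α seen S B U) (hseen : ∀ x ∈ seen, x ∈ matchoidGround M) :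
    MatchoidIndep M S.toFinset := by
  refine ⟨fun y hy => hseen y (h.union_seen y (h.mem_union y (by simpa using hy))),
    fun l => (h.indep l).subset ?_⟩
  rintro y ⟨hy, hyl⟩
  exact ⟨by simpa using hy, hyl⟩

theorem ExchangeInvariant.progress_nonneg {α : ℝ} (hα : 0 < α) {seen : Set E} {S B : List E}
    {U : Finset E} (h : ExchangeInvariant M f α seen S B U) :
    0 ≤ (trueAnswers M f).progress α S := by
  refine div_nonneg ?_ hα.le
  change 0 ≤ f S.toFinset - f ∅
  rw [← sum_increment f h.nodup]
  exact Finset.sum_nonneg fun s hs => h.increment_nonneg s (by simpa using hs)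

theorem Answers.Full.pos {O : Answers E m} {a b : ℕ} {α : ℝ} {S : List E} {n : ℕ}
    (h : O.Full a b α S n) (h0 : 0 ≤ O.progress α S) : 0 < n := by
  by_contra hn
  obtain rfl : n = 0 := by omega
  unfold Answers.Full at h
  have : (0 : ℝ) < (4 : ℝ) ^ (b + 3 * a + 2) * min (O.progress α S + 1) (4 ^ (a + b + 2)) := by
    have : 0 < O.progress α S + 1 := by linarith
    positivity
  norm_num at h
  linarith

theorem Answers.pool_accepts {O : Answers E m} {α : ℝ} {s : List E × List E} {e x : E}
    (hx : x ∈ O.pool α s e) : O.Accepts α s.1 x := by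
  simpa using (List.mem_filter.1 hx).2

theorem Answers.instStep_cases {O : Answers E m} {a b : ℕ} {α : ℝ} {s : List E × List E}
    (h0 : 0 ≤ O.progress α s.1) (e : E) (r : ℕ) :
    (¬ O.Full a b α s.1 (O.pool α s e).length ∧ O.instStep a b α s e r = (s.1, O.pool α s e)) ∨
      (O.Full a b α s.1 (O.pool α s e).length ∧ ∃ x ∈ O.pool α s e,
        O.instStep a b α s e r = (O.exchange s.1 x, (O.pool α s e).erase x)) := by
  unfold Answers.instStep
  split_ifs with h
  · refine Or.inr ⟨h, _, ?_, rfl⟩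
    have hlt := Nat.mod_lt r (h.pos h0)
    rw [List.getD_eq_getElem _ _ hlt]
    exact List.getElem_mem hlt
  · exact Or.inl ⟨h, rfl⟩

theorem ExchangeInvariant.instStep {a b : ℕ} {α : ℝ} (hα : 0 < α) {seen : Set E}
    {s : List E × List E} {U : Finset E} (hf : IsNonnegSubmodularOn (matchoidGround M) f)
    (h : ExchangeInvariant M f α seen s.1 s.2 U) (hseen : ∀ x ∈ seen, x ∈ matchoidGround M)
    {e : E} (he : e ∈ matchoidGround M) (hes : e ∉ seen) (r : ℕ) :
    ExchangeInvariant M f α (insert e seen) ((trueAnswers M f).instStep a b α s e r).1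
      ((trueAnswers M f).instStep a b α s e r).2
      (U ∪ ((trueAnswers M f).instStep a b α s e r).1.toFinset) := by
  have hrej := h.reject hf hseen he hes
  have hsub : s.1.toFinset ⊆ U := fun y hy => h.mem_union y (by simpa using hy)
  obtain ⟨-, heq⟩ | ⟨-, x, hx, heq⟩ :=
    Answers.instStep_cases (a := a) (b := b) (h.progress_nonneg hα) e r
  · rw [heq]
    simp only
    rwa [Finset.union_eq_left.2 hsub]
  · rw [heq]
    simp only
    have := hrej.exchange hα.le hf (by
      rintro y (rfl | hy)
      · exact he
      · exact hseen y hy) hx (Answers.pool_accepts hx)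
    rwa [show U ∪ ((trueAnswers M f).exchange s.1 x).toFinset = insert x U by
      ext y
      simp only [Finset.mem_union, List.mem_toFinset, mem_exchange, Finset.mem_insert]
      have := h.mem_union y
      tauto]

theorem progress_exchange {α : ℝ} (hα : 0 < α) {seen : Set E} {s : List E × List E}
    {U : Finset E} (hf : IsNonnegSubmodularOn (matchoidGround M) f)
    (h : ExchangeInvariant M f α seen s.1 s.2 U) (hseen : ∀ x ∈ seen, x ∈ matchoidGround M)
    {e : E} (he : e ∈ matchoidGround M) (hes : e ∉ seen) {x : E}
    (hx : x ∈ (trueAnswers M f).pool α s e) :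
    (trueAnswers M f).progress α s.1 + 1 ≤
      (trueAnswers M f).progress α ((trueAnswers M f).exchange s.1 x) := by
  have hrej := h.reject hf hseen he hes
  obtain ⟨hxs, hxU⟩ := hrej.buffer_seen x hx
  have hins : ∀ y ∈ insert e seen, y ∈ matchoidGround M := by
    rintro y (rfl | hy)
    · exact he
    · exact hseen y hy
  have hgain := exchange_gain hf h.nodup
    (fun y hy => hseen y (h.union_seen y (h.mem_union y hy)))
    (fun hS => hxU (h.mem_union x hS)) (hins x hxs) (Answers.pool_accepts hx)
  have hnn : 0 ≤ ∑ c ∈ (trueAnswers M f).evictedSet s.1 x, increment f s.1 c :=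
    Finset.sum_nonneg fun c hc => h.increment_nonneg c (mem_evictedSet.1 hc).1
  unfold Answers.progress
  rw [div_add_one hα.ne', div_le_div_iff_of_pos_right hα]
  change f s.1.toFinset - f ∅ + α ≤ f ((trueAnswers M f).exchange s.1 x).toFinset - f ∅
  linarith

/-- The bound on the size of the buffer. -/
def BufferBound (O : Answers E m) (a b : ℕ) (α : ℝ) (s : List E × List E) : Prop :=
  (s.2.length : ℝ) ^ 2 ≤
    (4 : ℝ) ^ (b + 3 * a + 2) * min (O.progress α s.1 + 1) (4 ^ (a + b + 2))

/-- Without an exchange the pool is not full. With one, the pool has at most one element more than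
the old buffer and loses the chosen one, while the progress, and with it the capacity, has not
decreased. -/
theorem BufferBound.instStep {a b : ℕ} {α : ℝ} (hα : 0 < α) {seen : Set E}
    {s : List E × List E} {U : Finset E} (hf : IsNonnegSubmodularOn (matchoidGround M) f)
    (h : ExchangeInvariant M f α seen s.1 s.2 U) (hseen : ∀ x ∈ seen, x ∈ matchoidGround M)
    {e : E} (he : e ∈ matchoidGround M) (hes : e ∉ seen) (r : ℕ)
    (hB : BufferBound (trueAnswers M f) a b α s) :
    BufferBound (trueAnswers M f) a b α ((trueAnswers M f).instStep a b α s e r) := by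
  obtain ⟨hnf, heq⟩ | ⟨-, x, hx, heq⟩ :=
    Answers.instStep_cases (a := a) (b := b) (h.progress_nonneg hα) e r
  · rw [heq]
    exact (not_le.1 hnf).le
  · rw [heq]
    unfold BufferBound at hB ⊢
    have hprog := progress_exchange hα hf h hseen he hes hx
    have hlen : ((trueAnswers M f).pool α s e).length ≤ s.2.length + 1 := by
      unfold Answers.pool
      refine (List.length_filter_le _ _).trans (by simp)
    have hlen' : (((trueAnswers M f).pool α s e).erase x).length ≤ s.2.length := by
      rw [List.length_erase_of_mem hx]
      omega
    refine le_trans ?_ (hB.trans ?_)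
    · have : ((((trueAnswers M f).pool α s e).erase x).length : ℝ) ≤ s.2.length := by
        exact_mod_cast hlen'
      simp only
      gcongr
    · have h2 : (trueAnswers M f).progress α s.1 ≤
          (trueAnswers M f).progress α ((trueAnswers M f).exchange s.1 x) := by linarith
      simp only
      gcongr

theorem historyLaw_invariant {a b : ℕ} {α : ℝ} (hα : 0 < α)
    (hf : IsNonnegSubmodularOn (matchoidGround M) f) {l : List E} (hnd : l.Nodup)
    (hl : ∀ x ∈ l, x ∈ matchoidGround M) :
    ∀ s ∈ (historyLaw M f a b α l).support,
      ExchangeInvariant M f α {x | x ∈ l} s.1.1 s.1.2 s.2 ∧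
        BufferBound (trueAnswers M f) a b α s.1 := by
  induction l using List.reverseRecOn with
  | nil =>
    intro s hs
    simp only [historyLaw, List.foldl_nil, PMF.support_pure, Set.mem_singleton_iff] at hs
    subst hs
    refine ⟨?_, ?_⟩
    · have := exchangeInvariant_empty M f α
      convert this using 1
      ext x; simp
    · unfold BufferBound Answers.progress
      simp
  | append_singleton l e ih =>
    intro s hs
    rw [historyLaw_append_singleton, PMF.mem_support_bind_iff] at hs
    obtain ⟨s₀, hs₀, hs⟩ := hs
    rw [PMF.mem_support_map_iff] at hs
    obtain ⟨s₁, hs₁, rfl⟩ := hs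
    unfold instKernel at hs₁
    rw [PMF.mem_support_map_iff] at hs₁
    obtain ⟨r, -, rfl⟩ := hs₁
    have hl' : ∀ x ∈ l, x ∈ matchoidGround M := fun x hx => hl x (by simp [hx])
    have he : e ∈ matchoidGround M := hl e (by simp)
    have hel : e ∉ {x | x ∈ l} := fun h => (List.nodup_append.1 hnd).2.2 e h e (by simp) rfl
    obtain ⟨h1, h2⟩ := ih (List.nodup_append.1 hnd).1 hl' s₀ hs₀
    refine ⟨?_, h2.instStep hα hf h1 hl' he hel _⟩
    have := h1.instStep (a := a) (b := b) hα hf hl' he hel r.val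
    convert this using 1
    ext x; simp [or_comm]

theorem instLaw_invariant {a b : ℕ} {α : ℝ} (hα : 0 < α)
    (hf : IsNonnegSubmodularOn (matchoidGround M) f) {l : List E} (hnd : l.Nodup)
    (hl : ∀ x ∈ l, x ∈ matchoidGround M) :
    ∀ s ∈ (instLaw M f a b α l).support,
      (∃ U, ExchangeInvariant M f α {x | x ∈ l} s.1 s.2 U) ∧
        BufferBound (trueAnswers M f) a b α s := by
  intro s hs
  rw [← map_fst_historyLaw, PMF.mem_support_map_iff] at hs
  obtain ⟨t, ht, rfl⟩ := hs
  obtain ⟨h1, h2⟩ := historyLaw_invariant hα hf hnd hl t ht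
  exact ⟨⟨_, h1⟩, h2⟩

theorem Answers.part_nil (O : Answers E m) (l : Fin m) : O.part [] l = ∅ :=
  Finset.filter_empty _

theorem Answers.evictedSet_nil (O : Answers E m) (x : E) : O.evictedSet [] x = ∅ :=
  Finset.filter_empty _

/-- Nothing is stored as long as all values are below the threshold. -/
theorem instLaw_eq_pure {a b : ℕ} {α : ℝ} (hf : IsNonnegSubmodularOn (matchoidGround M) f)
    {l : List E} (hl : ∀ x ∈ l, (∀ i, x ∈ (M i).E → (M i).Indep {x}) → f {x} < α) :
    instLaw M f a b α l = PMF.pure ([], []) := by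
  induction l using List.reverseRecOn with
  | nil => rfl
  | append_singleton l e ih =>
    rw [instLaw_append_singleton, ih fun x hx => hl x (by simp [hx]), PMF.pure_bind]
    -- Over the empty solution nothing is evicted, so an element passes only if it is a nonloop with
    -- `f {x} - f ∅ ≥ α`.
    have hpool : (trueAnswers M f).pool α ([], []) e = [] := by
      unfold Answers.pool
      simp only [List.nil_append, List.filter_eq_nil_iff, List.mem_singleton, decide_eq_true_eq]
      rintro x rfl ⟨hfeas, hval⟩
      have h0 : 0 ≤ f ∅ := hf.nonneg ∅ (by simp)
      have hval' : α ≤ f {x} - f ∅ := by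
        simpa [Answers.evictedSet_nil, trueAnswers] using hval
      have := hl x (by simp) fun i hi => by
        have := hfeas i hi
        rw [Answers.part_nil] at this
        simpa [Answers.candidates, trueAnswers] using this
      linarith
    have hstep : ∀ r, (trueAnswers M f).instStep a b α ([], []) e r = ([], []) := by
      intro r
      unfold Answers.instStep
      rw [if_neg, hpool]
      intro h
      refine absurd (h.pos ?_) (by simp [hpool])
      simp [Answers.progress]
    unfold instKernel
    simp_rw [hstep]
    exact PMF.map_const _ _

end Copy

/-! ### The expected loss by random insertions -/

section Sampling

open scoped Classical ENNReal

variable {E : Type u} {m : ℕ} {M : Fin m → Matroid E} {f : Finset E → ℝ}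

theorem sum_range_getD {β : Type*} [AddCommMonoid β] {P : List E} (hP : P.Nodup) (e : E)
    (g : E → β) : ∑ i ∈ Finset.range P.length, g (P.getD i e) = ∑ x ∈ P.toFinset, g x := by
  refine Finset.sum_bij (fun i _ => P.getD i e) ?_ ?_ ?_ fun _ _ => rfl
  · intro i hi
    rw [List.getD_eq_getElem _ _ (Finset.mem_range.1 hi), List.mem_toFinset]
    exact List.getElem_mem _
  · intro i hi j hj hij
    rw [List.getD_eq_getElem _ _ (Finset.mem_range.1 hi),
      List.getD_eq_getElem _ _ (Finset.mem_range.1 hj)] at hij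
    exact (hP.getElem_inj_iff).1 hij
  · intro x hx
    obtain ⟨i, hi, rfl⟩ := List.mem_iff_getElem.1 (List.mem_toFinset.1 hx)
    exact ⟨i, Finset.mem_range.2 hi, List.getD_eq_getElem _ _ hi⟩

/-- If the buffer is full, the next state is given by a uniformly random element of the pool. -/
theorem mean_instKernel_of_full {O : Answers E m} {a b : ℕ} {α : ℝ} {s : List E × List E} {e : E}
    (hfull : O.Full a b α s.1 (O.pool α s e).length) (h0 : 0 ≤ O.progress α s.1)
    (hnd : (O.pool α s e).Nodup) (h : List E × List E → ℝ≥0∞) :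
    (instKernel O a b α s e).mean h = ((O.pool α s e).length : ℝ≥0∞)⁻¹ *
      ∑ x ∈ (O.pool α s e).toFinset, h (O.exchange s.1 x, (O.pool α s e).erase x) := by
  have hpos := hfull.pos h0
  have hlen : (O.pool α s e).length - 1 + 1 = (O.pool α s e).length := Nat.sub_add_cancel hpos
  unfold instKernel
  rw [PMF.mean_map, PMF.mean_uniformOfFintype, Fintype.card_fin,
    Fin.sum_univ_eq_sum_range (fun r => h (O.instStep a b α s e r)), hlen]
  congr 1
  rw [← sum_range_getD hnd e fun x => h (O.exchange s.1 x, (O.pool α s e).erase x)]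
  refine Finset.sum_congr rfl fun i hi => ?_
  unfold Answers.instStep
  rw [if_pos hfull, Nat.mod_eq_of_lt (Finset.mem_range.1 hi)]

theorem mean_instKernel_of_not_full {O : Answers E m} {a b : ℕ} {α : ℝ} {s : List E × List E}
    {e : E} (hfull : ¬ O.Full a b α s.1 (O.pool α s e).length) (h : List E × List E → ℝ≥0∞) :
    (instKernel O a b α s e).mean h = h (s.1, O.pool α s e) := by
  unfold instKernel
  rw [PMF.mean_map]
  simp_rw [Answers.instStep, if_neg hfull]
  exact PMF.mean_const _ _

/-- The potential which compensates for the loss by random insertions. -/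
noncomputable def potential (a b : ℕ) (F : ℝ) : ℝ :=
  -- The subtracted term bounds the losses still to come: a sum of `1 / (κ√(F' + 1))` over progress
  -- values up to `4 ^ (a + b + 1)`, where `κ = 2 ^ (b + 3a + 2)`. At `F = 0` it equals `2 ^ (a + b
  -- + 2) / κ = 4 ^ (-a)`.
  1 - 2 / 2 ^ (b + 3 * a + 2) * (2 ^ (a + b + 1) - √F)

theorem potential_mono {a b : ℕ} {F F' : ℝ} (h : F ≤ F') : potential a b F ≤ potential a b F' := by
  unfold potential
  have := Real.sqrt_le_sqrt h
  gcongr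

theorem potential_zero (a b : ℕ) : potential a b 0 = 1 - (1 / 4) ^ a := by
  unfold potential
  rw [Real.sqrt_zero, sub_zero, div_mul_eq_mul_div, one_div, inv_pow,
    show (4 : ℝ) = 2 ^ 2 by norm_num, ← pow_mul, eq_comm, sub_right_inj, inv_eq_one_div,
    div_eq_div_iff (by positivity) (by positivity)]
  ring

theorem potential_nonneg (a b : ℕ) {F : ℝ} (hF : 0 ≤ F) : 0 ≤ potential a b F := by
  refine le_trans ?_ (potential_mono hF)
  rw [potential_zero, sub_nonneg]
  exact pow_le_one₀ (by norm_num) (by norm_num)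

theorem sqrt_four_pow (n : ℕ) : √((4 : ℝ) ^ n) = 2 ^ n := by
  rw [show (4 : ℝ) = 2 ^ 2 by norm_num, ← pow_mul, mul_comm, pow_mul]
  exact Real.sqrt_sq (by positivity)

theorem potential_le_one {a b : ℕ} {F : ℝ} (hF : F ≤ 4 ^ (a + b + 1)) : potential a b F ≤ 1 := by
  unfold potential
  have := Real.sqrt_le_sqrt hF
  rw [sqrt_four_pow] at this
  have h2 : (0 : ℝ) ≤ 2 / 2 ^ (b + 3 * a + 2) * (2 ^ (a + b + 1) - √F) :=
    mul_nonneg (by positivity) (by linarith)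
  linarith

/-- The hypothesis says `n ≥ κ√(F + 1)`, and `√(F + 1) - √F ≥ 1 / (2√(F + 1))`. -/
theorem potential_step {a b n : ℕ} {F : ℝ} (hF : 0 ≤ F) (hn : 0 < n)
    (h : (4 : ℝ) ^ (b + 3 * a + 2) * (F + 1) ≤ (n : ℝ) ^ 2) :
    potential a b F + 1 / n ≤ potential a b (F + 1) := by
  unfold potential
  set κ : ℝ := 2 ^ (b + 3 * a + 2) with hκ
  have hκ0 : 0 < κ := by positivity
  have hn' : (0 : ℝ) < n := by exact_mod_cast hn
  have h4 : (4 : ℝ) ^ (b + 3 * a + 2) = κ ^ 2 := by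
    rw [hκ, ← pow_mul, mul_comm _ 2, pow_mul]
    norm_num
  rw [h4] at h
  set y := √(F + 1) with hy
  set x := √F with hx
  have hy2 : y ^ 2 = F + 1 := Real.sq_sqrt (by linarith)
  have hx2 : x ^ 2 = F := Real.sq_sqrt hF
  have hy0 : 0 < y := Real.sqrt_pos.2 (by linarith)
  have hx0 : 0 ≤ x := Real.sqrt_nonneg _
  have hxy : x ≤ y := Real.sqrt_le_sqrt (by linarith)
  have hκy : κ * y ≤ n := by
    refine abs_le_of_sq_le_sq' ?_ hn'.le |>.2
    rw [mul_pow, hy2]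
    exact h
  have h1 : 1 ≤ 2 * y * (y - x) := by nlinarith
  have h2 : 1 / (n : ℝ) ≤ 2 / κ * (y - x) := by
    rw [div_mul_eq_mul_div, div_le_div_iff₀ hn' hκ0]
    have : 0 ≤ y - x := by linarith
    calc 1 * κ ≤ (2 * y * (y - x)) * κ := by nlinarith
      _ = 2 * (y - x) * (κ * y) := by ring
      _ ≤ 2 * (y - x) * n := by gcongr
  have h3 : 2 / κ * (2 ^ (a + b + 1) - x) = 2 / κ * (2 ^ (a + b + 1) - y) + 2 / κ * (y - x) := by
    ring
  linarith

/-- The product of `f(T ∪ U)` and the potential `ψ` does not decrease in expectation. A random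
insertion keeps the fraction `1 - 1/n` of the first factor, and `(1 - 1/n) ψ(F + 1) ≥ ψ(F + 1) - 1/n
≥ ψ(F)`, since `ψ(F + 1) ≤ 1`. -/
theorem potential_mul_le_mean_instKernel {a b : ℕ} {α : ℝ} (hα : 0 < α) {seen : Set E}
    {s : List E × List E} {U : Finset E} (hf : IsNonnegSubmodularOn (matchoidGround M) f)
    (h : ExchangeInvariant M f α seen s.1 s.2 U) (hseen : ∀ x ∈ seen, x ∈ matchoidGround M)
    {e : E} (he : e ∈ matchoidGround M) (hes : e ∉ seen)
    (hopt : ∀ S, MatchoidIndep M S → f S - f ∅ ≤ 4 ^ (a + b + 1) * α)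
    {T : Finset E} (hT : (T : Set E) ⊆ matchoidGround M) :
    ENNReal.ofReal (f (T ∪ U) * potential a b ((trueAnswers M f).progress α s.1)) ≤
      (instKernel (trueAnswers M f) a b α s e).mean fun s' =>
        ENNReal.ofReal (f (T ∪ (U ∪ s'.1.toFinset)) *
          potential a b ((trueAnswers M f).progress α s'.1)) := by
  set O := trueAnswers M f with hO
  have hrej := h.reject hf hseen he hes
  have hins : ∀ y ∈ insert e seen, y ∈ matchoidGround M := by
    rintro y (rfl | hy)
    · exact he
    · exact hseen y hy
  have hsub : s.1.toFinset ⊆ U := fun y hy => h.mem_union y (by simpa using hy)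
  have hF0 := h.progress_nonneg hα
  rw [← hO] at hF0
  by_cases hfull : O.Full a b α s.1 (O.pool α s e).length
  · rw [mean_instKernel_of_full hfull hF0 hrej.nodup_buffer]
    set P := O.pool α s e with hP
    set F := O.progress α s.1 with hFdef
    have hn : 0 < P.length := hfull.pos hF0
    have hn' : (0 : ℝ) < P.length := by exact_mod_cast hn
    have hPN : (P.toFinset : Set E) ⊆ matchoidGround M := fun y hy =>
      hins y (hrej.buffer_seen y (by simpa using hy)).1
    have hUN : (U : Set E) ⊆ matchoidGround M := fun y hy => hseen y (h.union_seen y hy)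
    have hTU := hf.union_left hT
    have hprog : ∀ x ∈ P, F + 1 ≤ O.progress α (O.exchange s.1 x) :=
      fun x hx => progress_exchange hα hf h hseen he hes hx
    -- The solution after the exchange is independent as well, so `hopt` bounds its progress. Hence
    -- the cap in `Answers.Full` is inactive and the potential at `F + 1` is at most 1.
    have hF1 : F + 1 ≤ 4 ^ (a + b + 1) := by
      obtain ⟨x, hx⟩ := List.exists_mem_of_length_pos hn
      refine (hprog x hx).trans ?_
      have hinv := hrej.exchange hα.le hf hins hx (Answers.pool_accepts hx)
      unfold Answers.progress
      rw [div_le_iff₀ hα]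
      exact hopt _ (hinv.matchoidIndep hins)
    have hcap : (4 : ℝ) ^ (b + 3 * a + 2) * (F + 1) ≤ (P.length : ℝ) ^ 2 := by
      have := hfull
      unfold Answers.Full at this
      rwa [min_eq_left] at this
      refine hF1.trans ?_
      exact pow_le_pow_right₀ (by norm_num) (by omega)
    have hstep := potential_step hF0 hn hcap
    have hψ1 := potential_le_one hF1
    have hψ0 : 0 ≤ potential a b (F + 1) := potential_nonneg a b (by linarith)
    have hsum := hTU.card_sub_one_mul_le_sum hUN hPN
    rw [List.toFinset_card_of_nodup hrej.nodup_buffer] at hsum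
    have hfU : 0 ≤ f (T ∪ U) := hTU.nonneg U hUN
    have hreal : (P.length : ℝ) * (f (T ∪ U) * potential a b F) ≤
        ∑ x ∈ P.toFinset, f (T ∪ insert x U) * potential a b (F + 1) := by
      rw [← Finset.sum_mul]
      calc (P.length : ℝ) * (f (T ∪ U) * potential a b F)
          = f (T ∪ U) * (P.length * potential a b F) := by ring
        _ ≤ f (T ∪ U) * ((P.length - 1) * potential a b (F + 1)) := by
            refine mul_le_mul_of_nonneg_left ?_ hfU
            have : (P.length : ℝ) * (potential a b F + 1 / P.length) ≤
                P.length * potential a b (F + 1) := by gcongr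
            rw [mul_add, mul_one_div_cancel hn'.ne'] at this
            linarith
        _ = ((P.length - 1) * f (T ∪ U)) * potential a b (F + 1) := by ring
        _ ≤ _ := mul_le_mul_of_nonneg_right hsum hψ0
    have hmain : (P.length : ℝ≥0∞) * ENNReal.ofReal (f (T ∪ U) * potential a b F) ≤
        ∑ x ∈ P.toFinset, ENNReal.ofReal (f (T ∪ (U ∪ (O.exchange s.1 x).toFinset)) *
          potential a b (O.progress α (O.exchange s.1 x))) := by
      calc (P.length : ℝ≥0∞) * ENNReal.ofReal (f (T ∪ U) * potential a b F)
          = ENNReal.ofReal (P.length * (f (T ∪ U) * potential a b F)) := by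
            rw [ENNReal.ofReal_mul hn'.le, ENNReal.ofReal_natCast]
        _ ≤ ENNReal.ofReal (∑ x ∈ P.toFinset, f (T ∪ insert x U) * potential a b (F + 1)) :=
            ENNReal.ofReal_le_ofReal hreal
        _ = ∑ x ∈ P.toFinset, ENNReal.ofReal (f (T ∪ insert x U) * potential a b (F + 1)) := by
            refine ENNReal.ofReal_sum_of_nonneg fun x hx => mul_nonneg ?_ hψ0
            refine hTU.nonneg _ ?_
            rw [Finset.coe_insert]
            exact Set.insert_subset (hPN hx) hUN
        _ ≤ _ := by
            refine Finset.sum_le_sum fun x hx => ENNReal.ofReal_le_ofReal ?_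
            have hxP : x ∈ P := by simpa using hx
            rw [show U ∪ (O.exchange s.1 x).toFinset = insert x U by
              ext y
              simp only [Finset.mem_union, List.mem_toFinset, mem_exchange, Finset.mem_insert]
              have := h.mem_union y
              tauto]
            refine mul_le_mul_of_nonneg_left (potential_mono (hprog x hxP)) (hTU.nonneg _ ?_)
            rw [Finset.coe_insert]
            exact Set.insert_subset (hPN hx) hUN
    have hn0 : (P.length : ℝ≥0∞) ≠ 0 := by exact_mod_cast hn.ne'
    calc ENNReal.ofReal (f (T ∪ U) * potential a b F)
        = (P.length : ℝ≥0∞)⁻¹ *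
            ((P.length : ℝ≥0∞) * ENNReal.ofReal (f (T ∪ U) * potential a b F)) := by
          rw [← mul_assoc, ENNReal.inv_mul_cancel hn0 (ENNReal.natCast_ne_top _), one_mul]
      _ ≤ _ := mul_le_mul_right hmain _
  · rw [mean_instKernel_of_not_full hfull]
    simp only
    rw [Finset.union_eq_left.2 hsub]

/-- Random insertions destroy only a small fraction of the value of a fixed set `T`. -/
theorem le_mean_historyLaw {a b : ℕ} {α : ℝ} (hα : 0 < α)
    (hf : IsNonnegSubmodularOn (matchoidGround M) f) {l : List E} (hnd : l.Nodup)
    (hl : ∀ x ∈ l, x ∈ matchoidGround M)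
    (hopt : ∀ S, MatchoidIndep M S → f S - f ∅ ≤ 4 ^ (a + b + 1) * α)
    {T : Finset E} (hT : (T : Set E) ⊆ matchoidGround M) :
    ENNReal.ofReal (f T * (1 - (1 / 4) ^ a)) ≤
      (historyLaw M f a b α l).mean fun s => ENNReal.ofReal (f (T ∪ s.2)) := by
  have key : ENNReal.ofReal (f T * (1 - (1 / 4) ^ a)) ≤
      (historyLaw M f a b α l).mean fun s => ENNReal.ofReal (f (T ∪ s.2) *
        potential a b ((trueAnswers M f).progress α s.1.1)) := by
    induction l using List.reverseRecOn with
    | nil =>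
      simp only [historyLaw, List.foldl_nil, PMF.mean_pure, Answers.progress]
      simp [potential_zero]
    | append_singleton l e ih =>
      have hl' : ∀ x ∈ l, x ∈ matchoidGround M := fun x hx => hl x (by simp [hx])
      have hnd' := (List.nodup_append.1 hnd).1
      have hel : e ∉ {x | x ∈ l} := fun h => (List.nodup_append.1 hnd).2.2 e h e (by simp) rfl
      refine (ih hnd' hl').trans ?_
      rw [historyLaw_append_singleton, PMF.mean_bind]
      refine PMF.mean_mono _ fun s hs => ?_
      rw [PMF.mean_map]
      exact potential_mul_le_mean_instKernel hα hf (historyLaw_invariant hα hf hnd' hl' s hs).1 hl'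
        (hl e (by simp)) hel hopt hT
  refine key.trans (PMF.mean_mono _ fun s hs => ENNReal.ofReal_le_ofReal ?_)
  obtain ⟨hinv, -⟩ := historyLaw_invariant hα hf hnd hl s hs
  have h1 : (trueAnswers M f).progress α s.1.1 ≤ 4 ^ (a + b + 1) := by
    unfold Answers.progress
    rw [div_le_iff₀ hα]
    exact hopt _ (hinv.matchoidIndep hl)
  refine mul_le_of_le_one_right (hf.nonneg _ ?_) (potential_le_one h1)
  rw [Finset.coe_union]
  exact Set.union_subset hT fun y hy => hl y (hinv.union_seen y hy)

/-- The guarantee of one copy of the algorithm, in expectation. -/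
theorem le_mean_instLaw {p k a b : ℕ} {α : ℝ} (hα : 0 < α) (hM : IsMatchoid p M)
    (hf : IsNonnegSubmodularOn (matchoidGround M) f) {l : List E} (hnd : l.Nodup)
    (hl : ∀ x ∈ l, x ∈ matchoidGround M)
    (hopt : ∀ S, MatchoidIndep M S → f S - f ∅ ≤ 4 ^ (a + b + 1) * α)
    {T : Finset E} (hT : MatchoidIndep M T) (hTk : T.card ≤ k) (hTl : ∀ t ∈ T, t ∈ l) :
    ENNReal.ofReal (f T * (1 - (1 / 4) ^ a)) ≤ (instLaw M f a b α l).mean fun s =>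
      ENNReal.ofReal (k * α + 4 * p * f s.1.toFinset + f (T.filter (· ∈ s.2))) := by
  refine (le_mean_historyLaw hα hf hnd hl hopt hT.1).trans ?_
  rw [← map_fst_historyLaw, PMF.mean_map]
  refine PMF.mean_mono _ fun s hs => ENNReal.ofReal_le_ofReal ?_
  exact (historyLaw_invariant hα hf hnd hl s hs).1.union_le hα.le hM hf hl hT hTk hTl

end Sampling

/-! ### Encoding the states of all copies in the memory -/

section Memory

open scoped Classical

variable {E : Type u} {m : ℕ}

/-- The blocks of elements in the memory, which are ended by control bits. -/
def memoryBlocks : StreamMemory E → List (List E)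
  | [] => []
  | Sum.inr _ :: W => [] :: memoryBlocks W
  | Sum.inl x :: W =>
    match memoryBlocks W with
    | [] => [[x]]
    | b :: bs => (x :: b) :: bs

def encodeBlocks (bs : List (List E)) : StreamMemory E :=
  bs.flatMap fun b => b.map Sum.inl ++ [Sum.inr true]

theorem memoryBlocks_encodeBlocks (bs : List (List E)) : memoryBlocks (encodeBlocks bs) = bs := by
  induction bs with
  | nil => rfl
  | cons b bs ih =>
    have : ∀ b' : List E, memoryBlocks (b'.map Sum.inl ++ Sum.inr true :: encodeBlocks bs) =
        b' :: bs := by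
      intro b'
      induction b' with
      | nil => simp [memoryBlocks, ih]
      | cons x b' ihb => simp [memoryBlocks, ihb]
    simpa [encodeBlocks] using this b

theorem mem_of_mem_memoryBlocks {W : StreamMemory E} {b : List E} {x : E}
    (hb : b ∈ memoryBlocks W) (hx : x ∈ b) : Sum.inl x ∈ W := by
  induction W generalizing b with
  | nil => simp [memoryBlocks] at hb
  | cons w W ih =>
    cases w with
    | inr c =>
      simp only [memoryBlocks, List.mem_cons] at hb
      obtain rfl | hb := hb
      · simp at hx
      · exact List.mem_cons_of_mem _ (ih hb hx)
    | inl y =>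
      simp only [memoryBlocks] at hb
      cases hW : memoryBlocks W with
      | nil =>
        simp only [hW, List.mem_singleton] at hb
        subst hb
        simp only [List.mem_singleton] at hx
        simp [hx]
      | cons b' bs =>
        simp only [hW, List.mem_cons] at hb
        obtain rfl | hb := hb
        · obtain rfl | hx := List.mem_cons.1 hx
          · simp
          · exact List.mem_cons_of_mem _ (ih (by simp [hW]) hx)
        · exact List.mem_cons_of_mem _ (ih (by simp [hW, hb]) hx)

theorem length_flatten_memoryBlocks_le (W : StreamMemory E) :
    (memoryBlocks W).flatten.length ≤ W.length := by
  induction W with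
  | nil => simp [memoryBlocks]
  | cons w W ih =>
    cases w with
    | inr c => simp only [memoryBlocks, List.flatten_cons, List.nil_append, List.length_cons]; omega
    | inl y =>
      simp only [memoryBlocks]
      cases hW : memoryBlocks W with
      | nil => simp
      | cons b' bs =>
        simp only [hW, List.flatten_cons, List.length_append, List.length_cons] at ih ⊢
        omega

/-- Missing blocks read as empty, so the empty memory encodes the initial state. -/
def memoryBlock (W : StreamMemory E) (n : ℕ) : List E :=
  (memoryBlocks W).getD n []

theorem mem_flatten_of_mem_memoryBlock {W : StreamMemory E} {n : ℕ} {x : E}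
    (hx : x ∈ memoryBlock W n) : x ∈ (memoryBlocks W).flatten := by
  unfold memoryBlock at hx
  rcases lt_or_ge n (memoryBlocks W).length with h | h
  · rw [List.getD_eq_getElem _ _ h] at hx
    exact List.mem_flatten.2 ⟨_, List.getElem_mem h, hx⟩
  · rw [List.getD_eq_default _ _ h] at hx
    simp at hx

theorem mem_stored_of_mem_flatten {W : StreamMemory E} {x : E}
    (hx : x ∈ (memoryBlocks W).flatten) : x ∈ W.stored := by
  obtain ⟨b, hb, hxb⟩ := List.mem_flatten.1 hx
  exact mem_of_mem_memoryBlocks hb hxb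

theorem length_memoryBlock_le (W : StreamMemory E) (n : ℕ) :
    (memoryBlock W n).length ≤ W.length := by
  unfold memoryBlock
  rcases lt_or_ge n (memoryBlocks W).length with h | h
  · rw [List.getD_eq_getElem _ _ h]
    exact (List.sublist_flatten_of_mem (List.getElem_mem h)).length_le.trans
      (length_flatten_memoryBlocks_le W)
  · rw [List.getD_eq_default _ _ h]
    simp

/-- The state of the `i`-th of `J` copies. -/
noncomputable def memorySlot (J : ℕ) (W : StreamMemory E) (i : ℤ) : List E × List E :=
  -- Block 0 is reserved for the best singleton. The index is an integer because a shift may lead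
  -- out of the range, where the copy is empty.
  if 0 ≤ i ∧ i < J then (memoryBlock W (2 * i.toNat + 1), memoryBlock W (2 * i.toNat + 2))
  else ([], [])

theorem mem_flatten_of_mem_memorySlot {J : ℕ} {W : StreamMemory E} {i : ℤ} {x : E}
    (hx : x ∈ (memorySlot J W i).1 ∨ x ∈ (memorySlot J W i).2) :
    x ∈ (memoryBlocks W).flatten := by
  unfold memorySlot at hx
  split_ifs at hx
  · obtain hx | hx := hx <;> exact mem_flatten_of_mem_memoryBlock hx
  · simp at hx

theorem length_memorySlot_le (J : ℕ) (W : StreamMemory E) (i : ℤ) :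
    (memorySlot J W i).1.length ≤ W.length ∧ (memorySlot J W i).2.length ≤ W.length := by
  unfold memorySlot
  split_ifs
  · exact ⟨length_memoryBlock_le W _, length_memoryBlock_le W _⟩
  · simp

/-! ### Processing an element -/

namespace Answers

variable (O : Answers E m)

/-- The largest value of a singleton; `y` holds an element which attains it. -/
def peak (y : List E) : ℝ :=
  match y with
  -- Starting from `f ∅` rather than 0 yields `OPT ≤ (k + 1) * peak`.
  | [] => O.val ∅
  | z :: _ => O.val {z}

/-- Loops are ignored, so that the peak is the value of an independent set and therefore at most
OPT. -/
noncomputable def nextBest (y : List E) (e : E) : List E :=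
  if (∀ l, O.grd l e → O.ind l {e}) ∧ O.peak y < O.val {e} then [e] else y

/-- For a peak of 0 the logarithm has the default value 0, and the level may drop when the peak
becomes positive. This does no harm, because all copies are empty until then. -/
noncomputable def level (y : List E) : ℤ :=
  Int.log 4 (O.peak y)

/-- The new level, after the element `e` was read. -/
noncomputable def nextLevel (W : StreamMemory E) (e : E) : ℤ :=
  O.level (O.nextBest (memoryBlock W 0) e)

/-- The state of the `i`-th copy after the shift caused by a new level. -/
noncomputable def shiftedSlot (J : ℕ) (W : StreamMemory E) (e : E) (i : ℤ) : List E × List E :=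
  -- The copy with threshold `4 ^ j` sits in slot `level - j`. When the level rises, copies move to
  -- later slots, those pushed past the end are given up, and the slots in front start empty.
  memorySlot J W (i - (O.nextLevel W e - O.level (memoryBlock W 0)))

noncomputable def threshold (W : StreamMemory E) (e : E) (i : ℕ) : ℝ :=
  4 ^ (O.nextLevel W e - i)

noncomputable def nextSlot (a b : ℕ) (W : StreamMemory E) (e : E) (r i : ℕ) : List E × List E :=
  O.instStep a b (O.threshold W e i) (O.shiftedSlot (a + b + 1) W e i) e r

noncomputable def nextBlock (a b : ℕ) (W : StreamMemory E) (e : E) (r n : ℕ) : List E :=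
  if n = 0 then O.nextBest (memoryBlock W 0) e
  else if n % 2 = 1 then (O.nextSlot a b W e r ((n - 1) / 2)).1
  else (O.nextSlot a b W e r ((n - 1) / 2)).2

noncomputable def nextMemory (a b : ℕ) (W : StreamMemory E) (e : E) (r : ℕ) : StreamMemory E :=
  encodeBlocks ((List.range (2 * (a + b + 1) + 1)).map (O.nextBlock a b W e r))

noncomputable def poolSize (a b : ℕ) (W : StreamMemory E) (e : E) (i : ℕ) : ℕ :=
  max 1 (O.pool (O.threshold W e i) (O.shiftedSlot (a + b + 1) W e i) e).length

/-- A common multiple of the sizes of all pools. -/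
noncomputable def modulus (a b : ℕ) (W : StreamMemory E) (e : E) : ℕ :=
  -- A number below this product is uniform modulo every pool size, so one random call serves all
  -- copies. They become dependent, but only the law of a single copy is used.
  ∏ i ∈ Finset.range (a + b + 1), O.poolSize a b W e i

end Answers

/-- The states of the copies, and the empty state. -/
noncomputable def slotList (J : ℕ) (W : StreamMemory E) : List (List E × List E) :=
  -- The empty state stands for the slots that a shift reads from outside the range.
  ([], []) :: (List.range J).map fun i : ℕ => memorySlot J W i

noncomputable def groundQueries (m : ℕ) (W : StreamMemory E) (e : E) : List (Fin m × E) :=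
  (List.finRange m).flatMap fun l => (e :: (memoryBlocks W).flatten).map fun x => (l, x)

noncomputable def slotValueQueries (e : E) (s : List E × List E) : List (Finset E) :=
  s.1.map (prefixSet s.1) ++ (s.1.map (fun y => insert y (prefixSet s.1 y)) ++
    (s.1.toFinset :: (s.2 ++ [e]).map fun x => insert x s.1.toFinset))

noncomputable def valueQueries (J : ℕ) (W : StreamMemory E) (e : E) : List (Finset E) :=
  ∅ :: {e} :: ((memoryBlock W 0).map (fun z => {z}) ++ (slotList J W).flatMap (slotValueQueries e))

noncomputable def slotIndepQueries (e : E) (G : Fin m → E → Prop) (s : List E × List E)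
    (l : Fin m) : List (Fin m × Finset E) :=
  (s.2 ++ [e]).flatMap fun x =>
    (l, insert x (s.1.toFinset.filter fun y => G l y)) ::
      s.1.map fun c => (l, insert x ((s.1.toFinset.filter fun y => G l y).erase c))

noncomputable def indepQueries (J : ℕ) (W : StreamMemory E) (e : E) (G : Fin m → E → Prop) :
    List (Fin m × Finset E) :=
  (List.finRange m).flatMap fun l =>
    (l, {e}) :: (slotList J W).flatMap fun s => slotIndepQueries e G s l

/-- The program which processes an element of the stream. -/
noncomputable def streamStep (m a b : ℕ) (W : StreamMemory E) (e : E) :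
    OracleProgram E m (StreamMemory E) :=
  -- Membership comes first, because the independence queries concern the parts of the solutions in
  -- the ground sets.
  .askGround (groundQueries m W e) fun G =>
    .askValues (valueQueries (a + b + 1) W e) fun g =>
      .askIndep (indepQueries (a + b + 1) W e G) fun I =>
        .uniform (Answers.modulus ⟨g, I, G⟩ a b W e - 1) fun r =>
          .ret (Answers.nextMemory ⟨g, I, G⟩ a b W e r.val)

theorem mem_slotList_subset {J : ℕ} {W : StreamMemory E} {s : List E × List E}
    (hs : s ∈ slotList J W) {x : E} (hx : x ∈ s.1 ∨ x ∈ s.2) : x ∈ (memoryBlocks W).flatten := by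
  unfold slotList at hs
  obtain rfl | hs := List.mem_cons.1 hs
  · simp at hx
  · obtain ⟨i, -, rfl⟩ := List.mem_map.1 hs
    exact mem_flatten_of_mem_memorySlot hx

theorem memorySlot_mem_slotList (J : ℕ) (W : StreamMemory E) (i : ℤ) :
    memorySlot J W i ∈ slotList J W := by
  unfold slotList
  by_cases h : 0 ≤ i ∧ i < J
  · refine List.mem_cons_of_mem _ (List.mem_map.2 ⟨i.toNat, ?_, ?_⟩)
    · rw [List.mem_range]; omega
    · rw [Int.toNat_of_nonneg h.1]
  · rw [memorySlot, if_neg h]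
    exact List.mem_cons_self

/-! #### Locality -/

theorem Answers.mem_instStep {O : Answers E m} {a b : ℕ} {α : ℝ} {s : List E × List E} {e : E}
    {r : ℕ} {x : E} (hx : x ∈ (O.instStep a b α s e r).1 ∨ x ∈ (O.instStep a b α s e r).2) :
    x = e ∨ x ∈ s.1 ∨ x ∈ s.2 := by
  have hpool : ∀ y ∈ O.pool α s e, y = e ∨ y ∈ s.1 ∨ y ∈ s.2 := by
    intro y hy
    simp only [Answers.pool, List.mem_filter, List.mem_append, List.mem_singleton] at hy
    tauto
  unfold Answers.instStep at hx
  split_ifs at hx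
  · obtain hx | hx := hx
    · obtain hx | rfl := mem_exchange.1 hx
      · exact Or.inr (Or.inl hx.1)
      · rcases lt_or_ge (r % (O.pool α s e).length) (O.pool α s e).length with h | h
        · rw [List.getD_eq_getElem _ _ h]
          exact hpool _ (List.getElem_mem h)
        · rw [List.getD_eq_default _ _ h]
          exact Or.inl rfl
    · exact hpool x (List.mem_of_mem_erase hx)
  · obtain hx | hx := hx
    · exact Or.inr (Or.inl hx)
    · exact hpool x hx

theorem Answers.mem_nextBest {O : Answers E m} {y : List E} {e x : E} (hx : x ∈ O.nextBest y e) :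
    x = e ∨ x ∈ y := by
  unfold Answers.nextBest at hx
  split_ifs at hx
  · exact Or.inl (by simpa using hx)
  · exact Or.inr hx

theorem Answers.stored_nextMemory (O : Answers E m) (a b : ℕ) (W : StreamMemory E) (e : E)
    (r : ℕ) : (O.nextMemory a b W e r).stored ⊆ insert e W.stored := by
  intro x hx
  change Sum.inl x ∈ O.nextMemory a b W e r at hx
  unfold Answers.nextMemory encodeBlocks at hx
  obtain ⟨B, hB, hxB⟩ := List.mem_flatMap.1 hx
  have hxB' : x ∈ B := by simpa using hxB
  obtain ⟨n, -, rfl⟩ := List.mem_map.1 hB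
  have hslot : ∀ i, x ∈ (O.nextSlot a b W e r i).1 ∨ x ∈ (O.nextSlot a b W e r i).2 →
      x ∈ insert e W.stored := by
    intro i hi
    obtain h | h := Answers.mem_instStep hi
    · exact Or.inl h
    · exact Or.inr (mem_stored_of_mem_flatten (mem_flatten_of_mem_memorySlot h))
  unfold Answers.nextBlock at hxB'
  split_ifs at hxB'
  · obtain h | h := Answers.mem_nextBest hxB'
    · exact Or.inl h
    · exact Or.inr (mem_stored_of_mem_flatten (mem_flatten_of_mem_memoryBlock h))
  · exact hslot _ (Or.inl hxB')
  · exact hslot _ (Or.inr hxB')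

theorem streamStep_within (m a b : ℕ) (W : StreamMemory E) (e : E) :
    (streamStep m a b W e).Within (insert e W.stored)
      fun W₁ : StreamMemory E => W₁.stored ⊆ insert e W.stored := by
  have hslot : ∀ s ∈ slotList (a + b + 1) W, ∀ x, x ∈ s.1 ∨ x ∈ s.2 → x ∈ insert e W.stored :=
    fun s hs x hx => Or.inr (mem_stored_of_mem_flatten (mem_slotList_subset hs hx))
  have hcand : ∀ s ∈ slotList (a + b + 1) W, ∀ x ∈ s.2 ++ [e], x ∈ insert e W.stored := by
    intro s hs x hx
    obtain hx | hx := List.mem_append.1 hx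
    · exact hslot s hs x (Or.inr hx)
    · exact Or.inl (by simpa using hx)
  have hsub : ∀ s ∈ slotList (a + b + 1) W, ∀ X : Finset E, X ⊆ s.1.toFinset →
      (X : Set E) ⊆ insert e W.stored :=
    fun s hs X hX x hx => hslot s hs x (Or.inl (by simpa using hX hx))
  have hins : ∀ X : Finset E, ∀ x ∈ insert e W.stored, (X : Set E) ⊆ insert e W.stored →
      ((insert x X : Finset E) : Set E) ⊆ insert e W.stored := by
    intro X x hx hX
    rw [Finset.coe_insert]
    exact Set.insert_subset hx hX
  have he : e ∈ insert e W.stored := Or.inl rfl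
  refine OracleProgram.within_askGround ?_ fun G => OracleProgram.within_askValues ?_ fun g =>
    OracleProgram.within_askIndep ?_ fun I r => Answers.stored_nextMemory _ a b W e r.val
  · intro q hq
    obtain ⟨l, -, hq⟩ := List.mem_flatMap.1 hq
    obtain ⟨x, hx, rfl⟩ := List.mem_map.1 hq
    obtain rfl | hx := List.mem_cons.1 hx
    · exact he
    · exact Or.inr (mem_stored_of_mem_flatten hx)
  · intro X hX
    unfold valueQueries at hX
    simp only [List.mem_cons, List.mem_append, List.mem_map, List.mem_flatMap] at hX
    obtain rfl | rfl | ⟨z, hz, rfl⟩ | ⟨s, hs, hX⟩ := hX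
    · simp
    · simp
    · simpa using Or.inr (mem_stored_of_mem_flatten (mem_flatten_of_mem_memoryBlock hz))
    · unfold slotValueQueries at hX
      simp only [List.mem_cons, List.mem_append, List.mem_map] at hX
      obtain ⟨y, hy, rfl⟩ | ⟨y, hy, rfl⟩ | rfl | ⟨x, hx, rfl⟩ := hX
      · exact hsub s hs _ (prefixSet_subset _ _)
      · exact hins _ y (hslot s hs y (Or.inl hy)) (hsub s hs _ (prefixSet_subset _ _))
      · exact hsub s hs _ subset_rfl
      · exact hins _ x (hcand s hs x (by simpa using hx)) (hsub s hs _ subset_rfl)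
  · intro q hq
    unfold indepQueries at hq
    simp only [List.mem_cons, List.mem_flatMap] at hq
    obtain ⟨l, -, rfl | ⟨s, hs, hq⟩⟩ := hq
    · simp
    · unfold slotIndepQueries at hq
      simp only [List.mem_cons, List.mem_flatMap, List.mem_map] at hq
      obtain ⟨x, hx, rfl | ⟨c, -, rfl⟩⟩ := hq
      · exact hins _ x (hcand s hs x hx) (hsub s hs _ (Finset.filter_subset _ _))
      · exact hins _ x (hcand s hs x hx)
          (hsub s hs _ ((Finset.erase_subset _ _).trans (Finset.filter_subset _ _)))

/-! #### The answers that are asked for suffice -/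

/-- The answers `O` and `O'` agree on everything that matters for one copy. -/
structure AgreeOn (O O' : Answers E m) (s : List E × List E) (e : E) : Prop where
  empty : O.val ∅ = O'.val ∅
  pre : ∀ y ∈ s.1, O.val (prefixSet s.1 y) = O'.val (prefixSet s.1 y)
  pre_insert : ∀ y ∈ s.1, O.val (insert y (prefixSet s.1 y)) = O'.val (insert y (prefixSet s.1 y))
  solution : O.val s.1.toFinset = O'.val s.1.toFinset
  solution_insert : ∀ x ∈ s.2 ++ [e], O.val (insert x s.1.toFinset) = O'.val (insert x s.1.toFinset)
  ground : ∀ l x, x ∈ s.1 ∨ x ∈ s.2 ++ [e] → (O.grd l x ↔ O'.grd l x)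
  indep : ∀ l, ∀ x ∈ s.2 ++ [e],
    (O.ind l (insert x (O'.part s.1 l)) ↔ O'.ind l (insert x (O'.part s.1 l)))
  indep_erase : ∀ l, ∀ x ∈ s.2 ++ [e], ∀ c ∈ s.1,
    (O.ind l (insert x ((O'.part s.1 l).erase c)) ↔ O'.ind l (insert x ((O'.part s.1 l).erase c)))

namespace AgreeOn

variable {O O' : Answers E m} {s : List E × List E} {e : E}

theorem part_eq (h : AgreeOn O O' s e) (l : Fin m) : O.part s.1 l = O'.part s.1 l :=
  Finset.filter_congr fun y hy => h.ground l y (Or.inl (by simpa using hy))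

theorem increment_eq (h : AgreeOn O O' s e) : increment O.val s.1 = increment O'.val s.1 := by
  funext y
  unfold increment
  split_ifs with hy
  · rw [h.pre y hy, h.pre_insert y hy]
  · rfl

theorem candidates_eq (h : AgreeOn O O' s e) {x : E} (hx : x ∈ s.2 ++ [e]) (l : Fin m) :
    O.candidates s.1 x l = O'.candidates s.1 x l := by
  refine List.filter_congr fun c hc => ?_
  rw [h.part_eq, decide_eq_decide, h.ground l c (Or.inl hc), h.indep_erase l x hx c hc]

theorem evicted_eq (h : AgreeOn O O' s e) {x : E} (hx : x ∈ s.2 ++ [e]) (l : Fin m) :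
    O.evicted s.1 x l = O'.evicted s.1 x l := by
  unfold Answers.evicted
  rw [h.candidates_eq hx, h.increment_eq, h.part_eq]
  simp only [h.ground l x (Or.inr hx), h.indep l x hx]

theorem evictedSet_eq (h : AgreeOn O O' s e) {x : E} (hx : x ∈ s.2 ++ [e]) :
    O.evictedSet s.1 x = O'.evictedSet s.1 x := by
  refine Finset.filter_congr fun c _ => ?_
  simp only [h.evicted_eq hx]

theorem accepts_iff (h : AgreeOn O O' s e) (α : ℝ) {x : E} (hx : x ∈ s.2 ++ [e]) :
    O.Accepts α s.1 x ↔ O'.Accepts α s.1 x := by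
  unfold Answers.Accepts Answers.Feasible
  rw [h.evictedSet_eq hx, h.increment_eq, h.solution, h.solution_insert x hx]
  refine and_congr_left fun _ => forall_congr' fun l => ?_
  rw [h.candidates_eq hx, h.part_eq, h.ground l x (Or.inr hx), h.indep l x hx]

theorem pool_eq (h : AgreeOn O O' s e) (α : ℝ) : O.pool α s e = O'.pool α s e :=
  List.filter_congr fun x hx => by rw [decide_eq_decide, h.accepts_iff α hx]

theorem full_iff (h : AgreeOn O O' s e) (a b : ℕ) (α : ℝ) (n : ℕ) :
    O.Full a b α s.1 n ↔ O'.Full a b α s.1 n := by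
  unfold Answers.Full Answers.progress
  rw [h.solution, h.empty]

theorem instStep_eq (h : AgreeOn O O' s e) (a b : ℕ) (α : ℝ) (r : ℕ) :
    O.instStep a b α s e r = O'.instStep a b α s e r := by
  unfold Answers.instStep
  rw [h.pool_eq]
  by_cases hfull : O'.Full a b α s.1 (O'.pool α s e).length
  · rw [if_pos hfull, if_pos ((h.full_iff a b α _).2 hfull)]
    have hmem : (O'.pool α s e).getD (r % (O'.pool α s e).length) e ∈ s.2 ++ [e] := by
      rcases lt_or_ge (r % (O'.pool α s e).length) (O'.pool α s e).length with hlt | hge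
      · rw [List.getD_eq_getElem _ _ hlt]
        exact (List.mem_filter.1 (List.getElem_mem hlt)).1
      · rw [List.getD_eq_default _ _ hge]
        simp
    unfold Answers.exchange
    rw [h.evictedSet_eq hmem]
  · rw [if_neg hfull, if_neg (mt (h.full_iff a b α _).1 hfull)]

end AgreeOn

/-- The answers that are known after asking. -/
noncomputable def askedAnswers (M : Fin m → Matroid E) (f : Finset E → ℝ) (J : ℕ)
    (W : StreamMemory E) (e : E) : Answers E m where
  val S := if S ∈ valueQueries J W e then f S else 0
  ind l S := (l, S) ∈ indepQueries J W e (fun l x => (l, x) ∈ groundQueries m W e ∧ x ∈ (M l).E) ∧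
    (M l).Indep (S : Set E)
  grd l x := (l, x) ∈ groundQueries m W e ∧ x ∈ (M l).E

section Asked

variable (M : Fin m → Matroid E) (f : Finset E → ℝ) (J : ℕ) (W : StreamMemory E) (e : E)

theorem askedAnswers_grd {l : Fin m} {x : E} (hx : x = e ∨ x ∈ (memoryBlocks W).flatten) :
    (askedAnswers M f J W e).grd l x ↔ (trueAnswers M f).grd l x := by
  refine and_iff_right ?_
  unfold groundQueries
  exact List.mem_flatMap.2 ⟨l, List.mem_finRange l,
    List.mem_map.2 ⟨x, List.mem_cons.2 hx, rfl⟩⟩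

theorem askedAnswers_val {S : Finset E} (hS : S ∈ valueQueries J W e) :
    (askedAnswers M f J W e).val S = (trueAnswers M f).val S :=
  if_pos hS

theorem askedAnswers_agreeOn {s : List E × List E} (hs : s ∈ slotList J W) :
    AgreeOn (askedAnswers M f J W e) (trueAnswers M f) s e := by
  have hval : ∀ S ∈ slotValueQueries e s,
      (askedAnswers M f J W e).val S = (trueAnswers M f).val S := by
    intro S hS
    refine askedAnswers_val M f J W e ?_
    unfold valueQueries
    exact List.mem_cons_of_mem _ (List.mem_cons_of_mem _
      (List.mem_append_right _ (List.mem_flatMap.2 ⟨s, hs, hS⟩)))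
  have hgrd : ∀ l x, x ∈ s.1 ∨ x ∈ s.2 ++ [e] →
      ((askedAnswers M f J W e).grd l x ↔ (trueAnswers M f).grd l x) := by
    intro l x hx
    refine askedAnswers_grd M f J W e ?_
    rw [List.mem_append, List.mem_singleton] at hx
    obtain hx | hx | hx := hx
    · exact Or.inr (mem_slotList_subset hs (Or.inl hx))
    · exact Or.inr (mem_slotList_subset hs (Or.inr hx))
    · exact Or.inl hx
  have hpart : ∀ l, (askedAnswers M f J W e).part s.1 l = (trueAnswers M f).part s.1 l :=
    fun l => Finset.filter_congr fun y hy => hgrd l y (Or.inl (by simpa using hy))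
  have hind : ∀ l S, (l, S) ∈ slotIndepQueries e (askedAnswers M f J W e).grd s l →
      ((askedAnswers M f J W e).ind l S ↔ (trueAnswers M f).ind l S) := by
    intro l S hS
    refine and_iff_right ?_
    unfold indepQueries
    exact List.mem_flatMap.2 ⟨l, List.mem_finRange l,
      List.mem_cons_of_mem _ (List.mem_flatMap.2 ⟨s, hs, hS⟩)⟩
  refine
    { empty := askedAnswers_val M f J W e (by simp [valueQueries])
      pre := fun y hy => hval _ ?_
      pre_insert := fun y hy => hval _ ?_
      solution := hval _ ?_
      solution_insert := fun x hx => hval _ ?_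
      ground := hgrd
      indep := fun l x hx => hind l _ ?_
      indep_erase := fun l x hx c hc => hind l _ ?_ }
  · exact List.mem_append_left _ (List.mem_map.2 ⟨y, hy, rfl⟩)
  · exact List.mem_append_right _ (List.mem_append_left _ (List.mem_map.2 ⟨y, hy, rfl⟩))
  · exact List.mem_append_right _ (List.mem_append_right _ List.mem_cons_self)
  · exact List.mem_append_right _ (List.mem_append_right _
      (List.mem_cons_of_mem _ (List.mem_map.2 ⟨x, hx, rfl⟩)))
  · rw [← hpart]
    exact List.mem_flatMap.2 ⟨x, hx, List.mem_cons_self⟩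
  · rw [← hpart]
    exact List.mem_flatMap.2 ⟨x, hx, List.mem_cons_of_mem _ (List.mem_map.2 ⟨c, hc, rfl⟩)⟩

theorem askedAnswers_peak : (askedAnswers M f J W e).peak (memoryBlock W 0) =
    (trueAnswers M f).peak (memoryBlock W 0) := by
  cases h : memoryBlock W 0 with
  | nil => exact askedAnswers_val M f J W e (by simp [valueQueries])
  | cons z y =>
    refine askedAnswers_val M f J W e ?_
    unfold valueQueries
    exact List.mem_cons_of_mem _ (List.mem_cons_of_mem _
      (List.mem_append_left _ (List.mem_map.2 ⟨z, by simp [h], rfl⟩)))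

theorem askedAnswers_singleton :
    (askedAnswers M f J W e).val {e} = (trueAnswers M f).val {e} :=
  askedAnswers_val M f J W e (by simp [valueQueries])

theorem askedAnswers_nextBest : (askedAnswers M f J W e).nextBest (memoryBlock W 0) e =
    (trueAnswers M f).nextBest (memoryBlock W 0) e := by
  unfold Answers.nextBest
  rw [askedAnswers_peak, askedAnswers_singleton]
  have : (∀ l, (askedAnswers M f J W e).grd l e → (askedAnswers M f J W e).ind l {e}) ↔
      ∀ l, (trueAnswers M f).grd l e → (trueAnswers M f).ind l {e} := by
    refine forall_congr' fun l => ?_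
    rw [askedAnswers_grd M f J W e (Or.inl rfl)]
    refine imp_congr_right fun _ => and_iff_right ?_
    unfold indepQueries
    exact List.mem_flatMap.2 ⟨l, List.mem_finRange l, List.mem_cons_self⟩
  simp only [this]

theorem askedAnswers_nextLevel :
    (askedAnswers M f J W e).nextLevel W e = (trueAnswers M f).nextLevel W e := by
  unfold Answers.nextLevel Answers.level
  rw [askedAnswers_nextBest]
  congr 1
  by_cases h : (∀ l, (trueAnswers M f).grd l e → (trueAnswers M f).ind l {e}) ∧
      (trueAnswers M f).peak (memoryBlock W 0) < (trueAnswers M f).val {e}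
  · rw [Answers.nextBest, if_pos h]
    exact askedAnswers_singleton M f J W e
  · rw [Answers.nextBest, if_neg h]
    exact askedAnswers_peak M f J W e

theorem askedAnswers_shiftedSlot (i : ℤ) : (askedAnswers M f J W e).shiftedSlot J W e i =
    (trueAnswers M f).shiftedSlot J W e i := by
  unfold Answers.shiftedSlot Answers.level
  rw [askedAnswers_nextLevel, askedAnswers_peak]

theorem askedAnswers_nextMemory (a b r : ℕ) :
    (askedAnswers M f (a + b + 1) W e).nextMemory a b W e r =
      (trueAnswers M f).nextMemory a b W e r := by
  have hslot : ∀ i, (askedAnswers M f (a + b + 1) W e).nextSlot a b W e r i =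
      (trueAnswers M f).nextSlot a b W e r i := by
    intro i
    unfold Answers.nextSlot Answers.threshold
    rw [askedAnswers_shiftedSlot, askedAnswers_nextLevel]
    exact (askedAnswers_agreeOn M f _ W e (memorySlot_mem_slotList _ _ _)).instStep_eq a b _ r
  unfold Answers.nextMemory
  congr 2
  funext n
  unfold Answers.nextBlock
  rw [askedAnswers_nextBest, hslot]

theorem askedAnswers_modulus (a b : ℕ) :
    (askedAnswers M f (a + b + 1) W e).modulus a b W e = (trueAnswers M f).modulus a b W e := by
  unfold Answers.modulus
  refine Finset.prod_congr rfl fun i _ => ?_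
  unfold Answers.poolSize Answers.threshold
  rw [askedAnswers_shiftedSlot, askedAnswers_nextLevel,
    (askedAnswers_agreeOn M f _ W e (s := (trueAnswers M f).shiftedSlot (a + b + 1) W e i)
      (memorySlot_mem_slotList _ _ _)).pool_eq]

theorem run_streamStep (off : Finset E → PMF (Finset E)) (a b : ℕ) :
    (streamStep m a b W e).run M f off =
      (PMF.uniformOfFintype (Fin ((trueAnswers M f).modulus a b W e - 1 + 1))).map fun r =>
        (trueAnswers M f).nextMemory a b W e r.val := by
  unfold streamStep
  rw [OracleProgram.run_askGround, OracleProgram.run_askValues, OracleProgram.run_askIndep]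
  change (PMF.uniformOfFintype
    (Fin ((askedAnswers M f (a + b + 1) W e).modulus a b W e - 1 + 1))).bind (fun r =>
      PMF.pure ((askedAnswers M f (a + b + 1) W e).nextMemory a b W e r.val)) = _
  rw [askedAnswers_modulus]
  simp_rw [askedAnswers_nextMemory]
  rfl

end Asked

end Memory

/-! ### The streaming algorithm and the law of its memory -/

section Streaming

open scoped Classical ENNReal

variable {E : Type u} {m : ℕ}

/-- Find the best of `X`, the solutions of the copies, and the results of the offline algorithm on
the buffers of the copies. -/
noncomputable def finishLoop : List (List E × List E) → Finset E → OracleProgram E m (Finset E)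
  | [], X => .ret X
  | s :: L, X => .offline s.2.toFinset fun Y => .value s.1.toFinset fun vS => .value Y fun vY =>
      .value X fun vX => finishLoop L
        (if vS ≤ vX ∧ vY ≤ vX then X else if vY ≤ vS then s.1.toFinset else Y)

theorem finishLoop_within {A : Set E} {L : List (List E × List E)} {X : Finset E}
    (hL : ∀ s ∈ L, ∀ x, x ∈ s.1 ∨ x ∈ s.2 → x ∈ A) (hX : (X : Set E) ⊆ A) :
    (finishLoop L X : OracleProgram E m (Finset E)).Within A fun S : Finset E => (S : Set E) ⊆ A := by
  induction L generalizing X with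
  | nil => exact hX
  | cons s L ih =>
    have hS : (s.1.toFinset : Set E) ⊆ A := fun x hx => hL s (by simp) x (Or.inl (by simpa using hx))
    have hB : (s.2.toFinset : Set E) ⊆ A := fun x hx => hL s (by simp) x (Or.inr (by simpa using hx))
    refine ⟨hB, fun Y hY => ?_⟩
    have hYA : (Y : Set E) ⊆ A := (Finset.coe_subset.2 hY).trans hB
    refine ⟨hS, fun vS => ⟨hYA, fun vY => ⟨hX, fun vX => ?_⟩⟩⟩
    refine ih (fun t ht => hL t (by simp [ht])) ?_
    split_ifs
    · exact hX
    · exact hS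
    · exact hYA

theorem finishLoop_callsAtMost (L : List (List E × List E)) (X : Finset E) :
    (finishLoop L X : OracleProgram E m (Finset E)).CallsAtMost (4 * L.length) := by
  induction L generalizing X with
  | nil => trivial
  | cons s L ih => exact fun Y vS vY vX => ih _

/-- The streaming algorithm, for the accuracy `4 ^ (-a)` and independent sets with at most `4 ^ b`
elements. -/
noncomputable def exchangeStreaming (E : Type u) (m a b : ℕ) : StreamingAlgorithm E m where
  step := streamStep m a b
  finish W := finishLoop ((List.range (a + b + 1)).map fun i : ℕ => memorySlot (a + b + 1) W i) ∅
  step_within := streamStep_within m a b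
  finish_within W := by
    refine finishLoop_within ?_ (by simp)
    intro s hs x hx
    exact mem_stored_of_mem_flatten (mem_slotList_subset (List.mem_cons_of_mem _ hs) hx)

variable {M : Fin m → Matroid E} {f : Finset E → ℝ} {off : Finset E → PMF (Finset E)}

theorem MatchoidIndep.empty : MatchoidIndep M ∅ := by
  refine ⟨by simp, fun l => by simp⟩

/-! #### The final choice -/

/-- The set that is kept never loses value during the loop. Hence its final mean dominates each
solution and, after averaging over the offline answer, each offline mean. -/
theorem mean_run_finishLoop (hoff : ∀ B : Finset E, (B : Set E) ⊆ matchoidGround M →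
      ∀ S ∈ (off B).support, S ⊆ B ∧ MatchoidIndep M S)
    {L : List (List E × List E)} (hLind : ∀ s ∈ L, MatchoidIndep M s.1.toFinset)
    (hLsub : ∀ s ∈ L, (s.2.toFinset : Set E) ⊆ matchoidGround M) {X : Finset E}
    (hX : MatchoidIndep M X) :
    (∀ S ∈ ((finishLoop L X : OracleProgram E m (Finset E)).run M f off).support,
      MatchoidIndep M S) ∧
    ENNReal.ofReal (f X) ≤ ((finishLoop L X : OracleProgram E m (Finset E)).run M f off).mean
      (fun S => ENNReal.ofReal (f S)) ∧
    ∀ s ∈ L,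
      ENNReal.ofReal (f s.1.toFinset) ≤
        ((finishLoop L X : OracleProgram E m (Finset E)).run M f off).mean
          (fun S => ENNReal.ofReal (f S)) ∧
      (off s.2.toFinset).mean (fun S => ENNReal.ofReal (f S)) ≤
        ((finishLoop L X : OracleProgram E m (Finset E)).run M f off).mean
          (fun S => ENNReal.ofReal (f S)) := by
  induction L generalizing X with
  | nil =>
    simp only [finishLoop, OracleProgram.run]
    refine ⟨?_, ?_, by simp⟩
    · intro S hS
      rw [PMF.support_pure, Set.mem_singleton_iff] at hS
      rwa [hS]
    · rw [PMF.mean_pure]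
  | cons s L ih =>
    have hs := hLind s (by simp)
    have hb := hLsub s (by simp)
    set best : Finset E → Finset E := fun Y =>
      if f s.1.toFinset ≤ f X ∧ f Y ≤ f X then X else if f Y ≤ f s.1.toFinset then s.1.toFinset
        else Y with hbest
    have hrun : (finishLoop (s :: L) X : OracleProgram E m (Finset E)).run M f off =
        (off s.2.toFinset).bind fun Y =>
          (finishLoop L (best Y) : OracleProgram E m (Finset E)).run M f off := rfl
    have hbI : ∀ Y ∈ (off s.2.toFinset).support, MatchoidIndep M (best Y) := by
      intro Y hY
      simp only [hbest]
      split_ifs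
      · exact hX
      · exact hs
      · exact (hoff _ hb Y hY).2
    have hbX : ∀ Y, f X ≤ f (best Y) := by
      intro Y
      simp only [hbest]
      split_ifs with h1 h2
      · exact le_rfl
      · by_contra! h
        exact h1 ⟨h.le, h2.trans h.le⟩
      · by_contra! h
        exact h1 ⟨(not_le.1 h2).le.trans h.le, h.le⟩
    have hbS : ∀ Y, f s.1.toFinset ≤ f (best Y) := by
      intro Y
      simp only [hbest]
      split_ifs with h1 h2
      · exact h1.1
      · exact le_rfl
      · exact (not_le.1 h2).le
    have hbY : ∀ Y, f Y ≤ f (best Y) := by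
      intro Y
      simp only [hbest]
      split_ifs with h1 h2
      · exact h1.2
      · exact h2
      · exact le_rfl
    have ih' := fun Y hY => ih (fun t ht => hLind t (by simp [ht]))
      (fun t ht => hLsub t (by simp [ht])) (hbI Y hY)
    rw [hrun, PMF.mean_bind]
    have hconst : ∀ c : ℝ≥0∞, (∀ Y ∈ (off s.2.toFinset).support, c ≤
        ((finishLoop L (best Y) : OracleProgram E m (Finset E)).run M f off).mean
          fun S => ENNReal.ofReal (f S)) →
        c ≤ (off s.2.toFinset).mean fun Y =>
          ((finishLoop L (best Y) : OracleProgram E m (Finset E)).run M f off).mean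
            fun S => ENNReal.ofReal (f S) := by
      intro c hc
      rw [← PMF.mean_const (off s.2.toFinset) c]
      exact PMF.mean_mono _ hc
    refine ⟨?_, ?_, ?_⟩
    · intro S hS
      obtain ⟨Y, hY, hS⟩ := (PMF.mem_support_bind_iff _ _ _).1 hS
      exact (ih' Y hY).1 S hS
    · exact hconst _ fun Y hY => (ENNReal.ofReal_le_ofReal (hbX Y)).trans (ih' Y hY).2.1
    · intro t ht
      obtain rfl | ht := List.mem_cons.1 ht
      · refine ⟨hconst _ fun Y hY => (ENNReal.ofReal_le_ofReal (hbS Y)).trans (ih' Y hY).2.1, ?_⟩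
        exact PMF.mean_mono _ fun Y hY => (ENNReal.ofReal_le_ofReal (hbY Y)).trans (ih' Y hY).2.1
      · refine ⟨hconst _ fun Y hY => ((ih' Y hY).2.2 t ht).1, ?_⟩
        exact hconst _ fun Y hY => ((ih' Y hY).2.2 t ht).2

/-! #### The law of the memory -/

section Next

variable (O : Answers E m) (a b : ℕ) (W : StreamMemory E) (e : E) (r : ℕ)

theorem memoryBlock_nextMemory {n : ℕ} (hn : n < 2 * (a + b + 1) + 1) :
    memoryBlock (O.nextMemory a b W e r) n = O.nextBlock a b W e r n := by
  unfold memoryBlock Answers.nextMemory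
  rw [memoryBlocks_encodeBlocks, List.getD_eq_getElem _ _ (by simpa using hn)]
  simp

theorem memoryBlock_zero_nextMemory :
    memoryBlock (O.nextMemory a b W e r) 0 = O.nextBest (memoryBlock W 0) e := by
  rw [memoryBlock_nextMemory O a b W e r (by omega)]
  rfl

theorem memorySlot_nextMemory {i : ℕ} (hi : i < a + b + 1) :
    memorySlot (a + b + 1) (O.nextMemory a b W e r) i = O.nextSlot a b W e r i := by
  unfold memorySlot
  rw [if_pos (by omega), Int.toNat_natCast, memoryBlock_nextMemory O a b W e r (by omega),
    memoryBlock_nextMemory O a b W e r (by omega)]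
  unfold Answers.nextBlock
  rw [if_neg (by omega), if_pos (by omega), if_neg (by omega), if_neg (by omega),
    show (2 * i + 1 - 1) / 2 = i by omega, show (2 * i + 2 - 1) / 2 = i by omega]

end Next

/-- The step depends on `r` only modulo the pool size. For an empty pool every index reads the same
default. -/
theorem map_instStep_eq_instKernel (O : Answers E m) (a b : ℕ) (α : ℝ) (s : List E × List E)
    (e : E) {Q : ℕ} (hQ : 0 < Q) (hdvd : max 1 (O.pool α s e).length ∣ Q) :
    ((PMF.uniformOfFintype (Fin (Q - 1 + 1))).map fun r => O.instStep a b α s e r.val) =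
      instKernel O a b α s e := by
  set d := max 1 (O.pool α s e).length with hd
  have hd0 : 0 < d := by omega
  have hmod : ∀ r, O.instStep a b α s e r = O.instStep a b α s e (r % d) := by
    intro r
    unfold Answers.instStep
    rcases Nat.eq_zero_or_pos (O.pool α s e).length with h | h
    · rw [List.length_eq_zero_iff] at h
      have hp : ∀ i, (O.pool α s e).getD i e = e := by
        intro i
        rw [h]
        rfl
      rw [hp, hp]
    · rw [show d = (O.pool α s e).length by omega, Nat.mod_mod]
  obtain ⟨q, rfl⟩ := hdvd
  have hq : 0 < q := Nat.pos_of_mul_pos_left hQ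
  rw [mul_comm d q]
  rw [show (fun r : Fin (q * d - 1 + 1) => O.instStep a b α s e r.val) =
    fun r => O.instStep a b α s e (r.val % d) from funext fun r => hmod r.val]
  rw [PMF.map_mod_uniformOfFintype hd0 hq fun r => O.instStep a b α s e r]
  unfold instKernel
  rw [show d - 1 = (O.pool α s e).length - 1 by omega]

/-- The element of largest value among those read so far. -/
noncomputable def bestOf (M : Fin m → Matroid E) (f : Finset E → ℝ) (l : List E) : List E :=
  l.foldl (trueAnswers M f).nextBest []

/-- The largest value of a singleton read so far. -/
noncomputable def peakOf (M : Fin m → Matroid E) (f : Finset E → ℝ) (l : List E) : ℝ :=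
  (trueAnswers M f).peak (bestOf M f l)

theorem bestOf_append_singleton (l : List E) (e : E) :
    bestOf M f (l ++ [e]) = (trueAnswers M f).nextBest (bestOf M f l) e := by
  simp [bestOf]

theorem peakOf_append_singleton (l : List E) (e : E) :
    peakOf M f l ≤ peakOf M f (l ++ [e]) ∧
      ((∀ i, e ∈ (M i).E → (M i).Indep {e}) → f {e} ≤ peakOf M f (l ++ [e])) := by
  unfold peakOf
  rw [bestOf_append_singleton]
  unfold Answers.nextBest
  split_ifs with h
  · exact ⟨h.2.le, fun _ => le_rfl⟩
  · refine ⟨le_rfl, fun hloop => ?_⟩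
    by_contra! hlt
    refine h ⟨fun i hi => ?_, hlt⟩
    simpa [trueAnswers] using hloop i hi

theorem empty_le_peakOf (l : List E) : f ∅ ≤ peakOf M f l := by
  induction l using List.reverseRecOn with
  | nil => exact le_rfl
  | append_singleton l e ih => exact ih.trans (peakOf_append_singleton l e).1

theorem le_peakOf {l : List E} {x : E} (hx : x ∈ l)
    (hloop : ∀ i, x ∈ (M i).E → (M i).Indep {x}) : f {x} ≤ peakOf M f l := by
  induction l using List.reverseRecOn with
  | nil => simp at hx
  | append_singleton l e ih =>
    obtain hx | hx := List.mem_append.1 hx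
    · exact (ih hx).trans (peakOf_append_singleton l e).1
    · obtain rfl := List.mem_singleton.1 hx
      exact (peakOf_append_singleton l x).2 hloop

theorem bestOf_eq (l : List E) : bestOf M f l = [] ∨
    ∃ x ∈ l, (∀ i, x ∈ (M i).E → (M i).Indep {x}) ∧ bestOf M f l = [x] := by
  induction l using List.reverseRecOn with
  | nil => exact Or.inl rfl
  | append_singleton l e ih =>
    rw [bestOf_append_singleton]
    unfold Answers.nextBest
    split_ifs with h
    · refine Or.inr ⟨e, by simp, fun i hi => ?_, rfl⟩
      simpa [trueAnswers] using h.1 i hi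
    · obtain h | ⟨x, hx, h1, h2⟩ := ih
      · exact Or.inl h
      · exact Or.inr ⟨x, by simp [hx], h1, h2⟩

/-- The largest value of a singleton is attained by an independent set. -/
theorem exists_peakOf_eq {l : List E} (hl : ∀ x ∈ l, x ∈ matchoidGround M) :
    ∃ S, MatchoidIndep M S ∧ f S = peakOf M f l := by
  unfold peakOf
  obtain h | ⟨x, hx, h1, h2⟩ := bestOf_eq (M := M) (f := f) l
  · exact ⟨∅, MatchoidIndep.empty, by rw [h]; rfl⟩
  · refine ⟨{x}, ⟨by simpa using hl x hx, fun i => ?_⟩, by rw [h2]; rfl⟩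
    by_cases hi : x ∈ (M i).E
    · exact (h1 i hi).subset (by simp)
    · rw [Finset.coe_singleton, Set.singleton_inter_eq_empty.2 hi]
      exact (M i).empty_indep

/-- The level after a list was read. -/
noncomputable def levelOf (M : Fin m → Matroid E) (f : Finset E → ℝ) (l : List E) : ℤ :=
  Int.log 4 (peakOf M f l)

/-- A nonpositive peak is a separate alternative, since the level is then only the default of the
logarithm and says nothing about the threshold. -/
theorem instLaw_eq_pure_of_level_lt {a b : ℕ} (hf : IsNonnegSubmodularOn (matchoidGround M) f)
    {l : List E} {j : ℤ} (hj : levelOf M f l < j ∨ peakOf M f l ≤ 0) :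
    instLaw M f a b (4 ^ j) l = PMF.pure ([], []) := by
  have h4 : (0 : ℝ) < 4 ^ j := by positivity
  have hlt : peakOf M f l < 4 ^ j := by
    rcases le_or_gt (peakOf M f l) 0 with h | h
    · exact h.trans_lt h4
    · have := (Int.lt_zpow_iff_log_lt (b := 4) (by norm_num) h).2 (hj.resolve_right (not_le.2 h))
      exact_mod_cast this
  exact instLaw_eq_pure hf fun x hx hloop => (le_peakOf hx hloop).trans_lt hlt

theorem memoryAfter_append_singleton (A : StreamingAlgorithm E m) (l : List E) (e : E) :
    A.memoryAfter M f off (l ++ [e]) =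
      (A.memoryAfter M f off l).bind fun W => (A.step W e).run M f off := by
  simp [StreamingAlgorithm.memoryAfter]

/-- The shape of the memory. -/
theorem memoryAfter_shape {a b : ℕ} {l : List E} {W : StreamMemory E}
    (hW : W ∈ ((exchangeStreaming E m a b).memoryAfter M f off l).support) :
    memoryBlock W 0 = bestOf M f l ∧
      (W = [] ∨ W = encodeBlocks ((List.range (2 * (a + b + 1) + 1)).map (memoryBlock W))) := by
  induction l using List.reverseRecOn generalizing W with
  | nil =>
    simp only [StreamingAlgorithm.memoryAfter, List.foldl_nil, PMF.support_pure,
      Set.mem_singleton_iff] at hW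
    subst hW
    exact ⟨rfl, Or.inl rfl⟩
  | append_singleton l e ih =>
    rw [memoryAfter_append_singleton, PMF.mem_support_bind_iff] at hW
    obtain ⟨W₀, hW₀, hW⟩ := hW
    change W ∈ ((streamStep m a b W₀ e).run M f off).support at hW
    rw [run_streamStep, PMF.mem_support_map_iff] at hW
    obtain ⟨r, -, rfl⟩ := hW
    refine ⟨?_, Or.inr ?_⟩
    · rw [memoryBlock_zero_nextMemory, (ih hW₀).1, bestOf_append_singleton]
    · conv_lhs => unfold Answers.nextMemory
      congr 1
      refine List.map_congr_left fun n hn => ?_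
      rw [memoryBlock_nextMemory _ _ _ _ _ _ (List.mem_range.1 hn)]

/-- Every slot of the memory behaves like a single copy of the algorithm. -/
theorem map_memorySlot_memoryAfter {a b : ℕ} (hf : IsNonnegSubmodularOn (matchoidGround M) f)
    (l : List E) (j : ℤ) (hj : levelOf M f l - j < (a + b + 1 : ℕ)) :
    ((exchangeStreaming E m a b).memoryAfter M f off l).map
      (fun W => memorySlot (a + b + 1) W (levelOf M f l - j)) = instLaw M f a b (4 ^ j) l := by
  induction l using List.reverseRecOn generalizing j with
  | nil =>
    simp only [StreamingAlgorithm.memoryAfter, instLaw, List.foldl_nil, PMF.pure_map]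
    congr 1
    unfold memorySlot memoryBlock
    simp [memoryBlocks]
  | append_singleton l e ih =>
    -- At a negative index the threshold is above all singleton values, so the copy is empty, and so
    -- is the slot by convention.
    rcases lt_or_ge (levelOf M f (l ++ [e]) - j) 0 with hneg | hnn
    · rw [instLaw_eq_pure_of_level_lt hf (Or.inl (by omega))]
      unfold memorySlot
      simp_rw [if_neg (show ¬ (0 ≤ levelOf M f (l ++ [e]) - j ∧
        levelOf M f (l ++ [e]) - j < (a + b + 1 : ℕ)) by omega)]
      exact PMF.map_const _ _
    obtain ⟨i, hi⟩ := Int.eq_ofNat_of_zero_le hnn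
    rw [hi] at hj ⊢
    have hiJ : i < a + b + 1 := by exact_mod_cast hj
    have hold : ((exchangeStreaming E m a b).memoryAfter M f off l).map
        (fun W => memorySlot (a + b + 1) W (levelOf M f l - j)) = instLaw M f a b (4 ^ j) l := by
      -- With a nonpositive old peak the levels cannot be compared, so the old index may be out of
      -- range; the slot is empty in any case. With a positive old peak the level has not dropped,
      -- so the old index is below the bound too.
      rcases le_or_gt (peakOf M f l) 0 with hpeak | hpeak
      · rw [instLaw_eq_pure_of_level_lt hf (Or.inr hpeak)]
        have hemp : ∀ W ∈ ((exchangeStreaming E m a b).memoryAfter M f off l).support,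
            memorySlot (a + b + 1) W (levelOf M f l - j) = ([], []) := by
          intro W hW
          by_cases hlt : levelOf M f l - j < (a + b + 1 : ℕ)
          · have h1 := ih j hlt
            rw [instLaw_eq_pure_of_level_lt hf (Or.inr hpeak)] at h1
            have h2 : memorySlot (a + b + 1) W (levelOf M f l - j) ∈
                (((exchangeStreaming E m a b).memoryAfter M f off l).map
                  (fun W => memorySlot (a + b + 1) W (levelOf M f l - j))).support :=
              (PMF.mem_support_map_iff _ _ _).2 ⟨W, hW, rfl⟩
            rwa [h1, PMF.support_pure, Set.mem_singleton_iff] at h2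
          · unfold memorySlot
            rw [if_neg (fun h => hlt h.2)]
        calc ((exchangeStreaming E m a b).memoryAfter M f off l).map
              (fun W => memorySlot (a + b + 1) W (levelOf M f l - j))
            = ((exchangeStreaming E m a b).memoryAfter M f off l).bind
                fun _ => PMF.pure ([], []) :=
              PMF.bind_congr_support _ fun W hW => by
                rw [Function.comp_apply, hemp W hW]
          _ = PMF.pure ([], []) := PMF.bind_const _ _
      · refine ih j (lt_of_le_of_lt ?_ hj)
        have : levelOf M f l ≤ levelOf M f (l ++ [e]) :=
          Int.log_mono_right hpeak (peakOf_append_singleton l e).1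
        omega
    rw [instLaw_append_singleton, ← hold, memoryAfter_append_singleton, PMF.map_bind, PMF.bind_map]
    refine PMF.bind_congr_support _ fun W hW => ?_
    have hbest := (memoryAfter_shape hW).1
    have hlev : (trueAnswers M f).nextLevel W e = levelOf M f (l ++ [e]) := by
      unfold Answers.nextLevel
      rw [hbest, ← bestOf_append_singleton]
      rfl
    have hlev' : (trueAnswers M f).level (memoryBlock W 0) = levelOf M f l := by
      rw [hbest]
      rfl
    have hthr : (trueAnswers M f).threshold W e i = 4 ^ j := by
      unfold Answers.threshold
      rw [hlev]
      congr 1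
      omega
    have hshift : (trueAnswers M f).shiftedSlot (a + b + 1) W e i =
        memorySlot (a + b + 1) W (levelOf M f l - j) := by
      unfold Answers.shiftedSlot
      rw [hlev, hlev']
      congr 1
      omega
    change ((streamStep m a b W e).run M f off).map _ = _
    rw [run_streamStep, PMF.map_comp]
    have hfun : ((fun W => memorySlot (a + b + 1) W (i : ℤ)) ∘
        fun r : Fin ((trueAnswers M f).modulus a b W e - 1 + 1) =>
          (trueAnswers M f).nextMemory a b W e r.val) =
        fun r => (trueAnswers M f).instStep a b (4 ^ j)
          (memorySlot (a + b + 1) W (levelOf M f l - j)) e r.val := by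
      funext r
      rw [Function.comp_apply, memorySlot_nextMemory _ _ _ _ _ _ hiJ]
      unfold Answers.nextSlot
      rw [hthr, hshift]
    rw [hfun, Function.comp_apply]
    refine map_instStep_eq_instKernel _ _ _ _ _ _ ?_ ?_
    · exact Finset.prod_pos fun i _ => lt_of_lt_of_le one_pos (le_max_left _ _)
    · have := Finset.dvd_prod_of_mem ((trueAnswers M f).poolSize a b W e)
        (Finset.mem_range.2 hiJ)
      unfold Answers.poolSize at this
      rwa [hthr, hshift] at this

end Streaming

/-! ### Space and number of calls -/

section Resources

open scoped Classical ENNReal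

variable {E : Type u} {m : ℕ} {M : Fin m → Matroid E} {f : Finset E → ℝ}
  {off : Finset E → PMF (Finset E)}

theorem memorySlot_invariant {a b : ℕ} (hf : IsNonnegSubmodularOn (matchoidGround M) f)
    {l : List E} (hnd : l.Nodup) (hl : ∀ x ∈ l, x ∈ matchoidGround M) {W : StreamMemory E}
    (hW : W ∈ ((exchangeStreaming E m a b).memoryAfter M f off l).support) {i : ℕ}
    (hi : i < a + b + 1) :
    (∃ U, ExchangeInvariant M f (4 ^ (levelOf M f l - i)) {x | x ∈ l}
      (memorySlot (a + b + 1) W i).1 (memorySlot (a + b + 1) W i).2 U) ∧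
    BufferBound (trueAnswers M f) a b (4 ^ (levelOf M f l - i)) (memorySlot (a + b + 1) W i) := by
  have h := map_memorySlot_memoryAfter (off := off) (a := a) (b := b) hf l (levelOf M f l - i)
    (by omega)
  rw [sub_sub_cancel] at h
  refine instLaw_invariant (by positivity) hf hnd hl _ ?_
  rw [← h]
  exact (PMF.mem_support_map_iff _ _ _).2 ⟨W, hW, rfl⟩

/-- The value of an independent set in terms of the largest value of a singleton. -/
theorem sub_empty_le_mul_peakOf {k : ℕ} (hk : ∀ S, MatchoidIndep M S → S.card ≤ k)
    (hf : IsNonnegSubmodularOn (matchoidGround M) f) {l : List E} {S : Finset E}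
    (hS : MatchoidIndep M S) (hSl : ∀ x ∈ S, x ∈ l) : f S - f ∅ ≤ k * peakOf M f l := by
  have hpeak : 0 ≤ peakOf M f l := (hf.nonneg ∅ (by simp)).trans (empty_le_peakOf l)
  calc f S - f ∅ ≤ ∑ x ∈ S, f {x} := hf.sub_empty_le_sum_singleton hS.1
    _ ≤ ∑ _x ∈ S, peakOf M f l :=
        Finset.sum_le_sum fun x hx => le_peakOf (hSl x hx) (hS.nonloop hx)
    _ = S.card * peakOf M f l := by rw [Finset.sum_const, nsmul_eq_mul]
    _ ≤ k * peakOf M f l := by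
        refine mul_le_mul_of_nonneg_right ?_ hpeak
        exact_mod_cast hk S hS

/-- An independent set gains at most `k` times the peak, and `k * peak ≤ 4 ^ b * 4 ^ (L + 1)`.
Dividing by the threshold `4 ^ (L - i)` bounds the progress by `4 ^ (b + i + 1)`; for `i > a` the
cap in `Answers.Full` takes over. The buffer size is the square root of the resulting capacity. -/
theorem length_memorySlot_snd_le {a b k : ℕ} (hk : ∀ S, MatchoidIndep M S → S.card ≤ k)
    (hkb : k ≤ 4 ^ b) (hf : IsNonnegSubmodularOn (matchoidGround M) f)
    {l : List E} (hnd : l.Nodup) (hl : ∀ x ∈ l, x ∈ matchoidGround M) {W : StreamMemory E}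
    (hW : W ∈ ((exchangeStreaming E m a b).memoryAfter M f off l).support) {i : ℕ}
    (hi : i < a + b + 1) :
    (memorySlot (a + b + 1) W i).2.length ≤ 2 ^ (2 * b + 3 * a + 4) * 2 ^ min i a := by
  obtain ⟨⟨U, hinv⟩, hB⟩ := memorySlot_invariant hf hnd hl hW hi
  set s := memorySlot (a + b + 1) W i
  set L := levelOf M f l
  have hα : (0 : ℝ) < 4 ^ (L - i) := by positivity
  have hprog : (trueAnswers M f).progress (4 ^ (L - i)) s.1 + 1 ≤ 4 ^ (b + i + 2) := by
    have h1 : (trueAnswers M f).progress (4 ^ (L - i)) s.1 ≤ 4 ^ (b + i + 1) := by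
      unfold Answers.progress
      rw [div_le_iff₀ hα]
      refine (sub_empty_le_mul_peakOf hk hf (hinv.matchoidIndep hl) fun x hx =>
        hinv.union_seen x (hinv.mem_union x (by simpa using hx))).trans ?_
      have hrhs : (4 : ℝ) ^ (b + i + 1) * 4 ^ (L - i) = 4 ^ b * 4 ^ (L + 1) := by
        rw [← zpow_natCast, ← zpow_natCast, ← zpow_add₀ (by norm_num), ← zpow_add₀ (by norm_num)]
        congr 1
        push_cast
        ring
      rw [hrhs]
      have hkb' : (k : ℝ) ≤ 4 ^ b := by exact_mod_cast hkb
      rcases le_or_gt (peakOf M f l) 0 with hp | hp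
      · exact (mul_nonpos_of_nonneg_of_nonpos (by positivity) hp).trans (by positivity)
      · have hlt : peakOf M f l < 4 ^ (L + 1) := by
          have := (Int.lt_zpow_iff_log_lt (b := 4) (by norm_num) hp).2 (Int.lt_succ L)
          exact_mod_cast this
        gcongr
    have h2 : (1 : ℝ) ≤ 4 ^ (b + i + 1) := one_le_pow₀ (by norm_num)
    rw [show b + i + 2 = (b + i + 1) + 1 by ring, pow_succ]
    linarith
  have hmin : min ((trueAnswers M f).progress (4 ^ (L - i)) s.1 + 1) (4 ^ (a + b + 2)) ≤
      (4 : ℝ) ^ (b + min i a + 2) := by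
    rcases le_total i a with h | h
    · rw [min_eq_left h]
      exact (min_le_left _ _).trans hprog
    · rw [min_eq_right h, add_comm b a]
      exact min_le_right _ _
  have hsq : (s.2.length : ℝ) ^ 2 ≤ ((2 : ℝ) ^ (2 * b + 3 * a + 4) * 2 ^ min i a) ^ 2 := by
    refine hB.trans ?_
    calc (4 : ℝ) ^ (b + 3 * a + 2) *
          min ((trueAnswers M f).progress (4 ^ (L - i)) s.1 + 1) (4 ^ (a + b + 2))
        ≤ 4 ^ (b + 3 * a + 2) * 4 ^ (b + min i a + 2) := by gcongr
      _ = _ := by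
        rw [← pow_add, ← pow_add, ← pow_mul, mul_comm _ 2, pow_mul]
        norm_num
        ring
  have := abs_le_of_sq_le_sq' hsq (by positivity) |>.2
  exact_mod_cast this

theorem length_encodeBlocks (J : ℕ) (g : ℕ → List E) :
    (encodeBlocks ((List.range (2 * J + 1)).map g)).length = (g 0).length + 1 +
      ∑ i ∈ Finset.range J, ((g (2 * i + 1)).length + (g (2 * i + 2)).length + 2) := by
  have happ : ∀ bs bs' : List (List E), (encodeBlocks (bs ++ bs')).length =
      (encodeBlocks bs).length + (encodeBlocks bs').length := by
    intro bs bs'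
    simp [encodeBlocks]
  have hone : ∀ B : List E, (encodeBlocks [B]).length = B.length + 1 := by
    intro B
    simp [encodeBlocks]
  induction J with
  | zero => exact hone _
  | succ J ih =>
    rw [show 2 * (J + 1) + 1 = 2 * J + 1 + 1 + 1 by ring, List.range_succ, List.range_succ,
      List.map_append, List.map_append, happ, happ, ih, Finset.sum_range_succ, List.map_singleton,
      List.map_singleton, hone, hone]
    ring

/-- The buffers dominate, with 16 of the 21 units. The solutions and control bits of the copies take
3, and the block of the best singleton takes 2. -/
theorem length_memoryAfter_le {a b k : ℕ} (hk : ∀ S, MatchoidIndep M S → S.card ≤ k)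
    (hkb : k ≤ 4 ^ b) (hf : IsNonnegSubmodularOn (matchoidGround M) f)
    {l : List E} (hnd : l.Nodup) (hl : ∀ x ∈ l, x ∈ matchoidGround M) {W : StreamMemory E}
    (hW : W ∈ ((exchangeStreaming E m a b).memoryAfter M f off l).support) :
    W.length ≤ 21 * 4 ^ b * 16 ^ a * (b + 2) := by
  obtain ⟨hbest, hshape⟩ := memoryAfter_shape hW
  obtain rfl | hshape := hshape
  · simp
  rw [hshape, length_encodeBlocks, hbest]
  have h0 : (bestOf M f l).length ≤ 1 := by
    obtain h | ⟨x, -, -, h⟩ := bestOf_eq (M := M) (f := f) l <;> simp [h]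
  have hi : ∀ i ∈ Finset.range (a + b + 1),
      (memoryBlock W (2 * i + 1)).length + (memoryBlock W (2 * i + 2)).length + 2 ≤
        (4 ^ b + 2) + 2 ^ (2 * b + 3 * a + 4) * 2 ^ min i a := by
    intro i hi
    rw [Finset.mem_range] at hi
    have hslot : memorySlot (a + b + 1) W (i : ℤ) =
        (memoryBlock W (2 * i + 1), memoryBlock W (2 * i + 2)) := by
      unfold memorySlot
      rw [if_pos (by omega), Int.toNat_natCast]
    obtain ⟨⟨U, hinv⟩, -⟩ := memorySlot_invariant hf hnd hl hW hi
    have h2 := length_memorySlot_snd_le hk hkb hf hnd hl hW hi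
    have h1 := (hk _ (hinv.matchoidIndep hl)).trans hkb
    rw [List.toFinset_card_of_nodup hinv.nodup] at h1
    rw [hslot] at h1 h2
    simp only at h1 h2
    omega
  -- The buffers with `i < a` form a geometric series below `2 ^ a`, and `b + 1` buffers have full
  -- size; `a` does not enter as a factor.
  have hpow : ∑ i ∈ Finset.range (a + b + 1), 2 ^ min i a ≤ 2 ^ a * (b + 2) := by
    rw [add_assoc, Finset.sum_range_add]
    have e1 : ∑ i ∈ Finset.range a, 2 ^ min i a = ∑ i ∈ Finset.range a, 2 ^ i :=
      Finset.sum_congr rfl fun i hi => by rw [min_eq_left (Finset.mem_range.1 hi).le]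
    have e2 : ∑ i ∈ Finset.range (b + 1), 2 ^ min (a + i) a = (b + 1) * 2 ^ a := by
      rw [Finset.sum_congr rfl fun i _ => by rw [min_eq_right (Nat.le_add_right a i)],
        Finset.sum_const, Finset.card_range, smul_eq_mul]
    rw [e1, e2]
    have := Nat.geomSum_lt (m := 2) (n := a) (s := Finset.range a) le_rfl
      fun i hi => Finset.mem_range.1 hi
    nlinarith
  have hsum := Finset.sum_le_sum hi
  have hrhs : ∑ i ∈ Finset.range (a + b + 1),
      ((4 ^ b + 2) + 2 ^ (2 * b + 3 * a + 4) * 2 ^ min i a) = (a + b + 1) * (4 ^ b + 2) +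
        2 ^ (2 * b + 3 * a + 4) * ∑ i ∈ Finset.range (a + b + 1), 2 ^ min i a := by
    rw [Finset.sum_add_distrib, Finset.sum_const, Finset.card_range, smul_eq_mul, Finset.mul_sum]
  rw [hrhs] at hsum
  have h16 : 2 ^ (2 * b + 3 * a + 4) * 2 ^ a = 16 * (4 ^ b * 16 ^ a) := by
    rw [← pow_add, show 2 * b + 3 * a + 4 + a = 4 + (2 * b + 4 * a) by ring, pow_add, pow_add,
      pow_mul, pow_mul]
    norm_num
  have h3 : 2 ^ (2 * b + 3 * a + 4) * ∑ i ∈ Finset.range (a + b + 1), 2 ^ min i a ≤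
      16 * (4 ^ b * 16 ^ a) * (b + 2) := by
    rw [← h16, mul_assoc]
    exact Nat.mul_le_mul_left _ hpow
  have h4 : 1 ≤ 4 ^ b := Nat.one_le_pow _ _ (by norm_num)
  have h5 : a + 1 ≤ 16 ^ a := Nat.lt_pow_self (by norm_num)
  have h6 : (a + b + 1) * (4 ^ b + 2) ≤ 3 * (4 ^ b * 16 ^ a) * (b + 2) := by
    calc (a + b + 1) * (4 ^ b + 2) ≤ ((a + 1) * (b + 2)) * (3 * 4 ^ b) := by
          refine Nat.mul_le_mul ?_ ?_
          · nlinarith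
          · omega
      _ ≤ (16 ^ a * (b + 2)) * (3 * 4 ^ b) := by gcongr
      _ = _ := by ring
  have h7 : 2 ≤ 2 * (4 ^ b * 16 ^ a) * (b + 2) := by
    have : 1 ≤ 4 ^ b * 16 ^ a := Nat.mul_pos h4 (by positivity)
    nlinarith
  calc _ ≤ 2 + ((a + b + 1) * (4 ^ b + 2) +
        2 ^ (2 * b + 3 * a + 4) * ∑ i ∈ Finset.range (a + b + 1), 2 ^ min i a) := by omega
    _ ≤ 2 * (4 ^ b * 16 ^ a) * (b + 2) + (3 * (4 ^ b * 16 ^ a) * (b + 2) +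
        16 * (4 ^ b * 16 ^ a) * (b + 2)) := by omega
    _ = _ := by ring

/-! #### The number of calls -/

theorem length_flatMap_le {β γ : Type*} {L : List β} {g : β → List γ} {n : ℕ}
    (h : ∀ x ∈ L, (g x).length ≤ n) : (L.flatMap g).length ≤ L.length * n := by
  induction L with
  | nil => simp
  | cons x L ih =>
    rw [List.flatMap_cons, List.length_append, List.length_cons, Nat.succ_mul]
    have h1 := h x (by simp)
    have h2 := ih fun y hy => h y (by simp [hy])
    omega

theorem length_of_mem_slotList {J : ℕ} {W : StreamMemory E} {s : List E × List E}
    (hs : s ∈ slotList J W) : s.1.length ≤ W.length ∧ s.2.length ≤ W.length := by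
  unfold slotList at hs
  obtain rfl | hs := List.mem_cons.1 hs
  · simp
  · obtain ⟨i, -, rfl⟩ := List.mem_map.1 hs
    exact length_memorySlot_le J W i

theorem streamStep_callsAtMost (a b : ℕ) {W : StreamMemory E} (e : E) {n : ℕ}
    (hW : W.length + 1 ≤ n) :
    (streamStep m a b W e).CallsAtMost
      (m * n + (2 + n + (a + b + 2) * (3 * n) + (m * (1 + (a + b + 2) * (n * n)) + 1))) := by
  have hJ : (slotList (a + b + 1) W).length = a + b + 2 := by simp [slotList]
  have hG : (groundQueries m W e).length ≤ m * n := by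
    unfold groundQueries
    refine (length_flatMap_le (n := n) fun l _ => ?_).trans (by simp)
    have := length_flatten_memoryBlocks_le W
    rw [List.length_map, List.length_cons]
    omega
  have hV : (valueQueries (a + b + 1) W e).length ≤ 2 + n + (a + b + 2) * (3 * n) := by
    unfold valueQueries
    have h1 := length_memoryBlock_le W 0
    have h2 : ((slotList (a + b + 1) W).flatMap (slotValueQueries e)).length ≤
        (slotList (a + b + 1) W).length * (3 * n) := by
      refine length_flatMap_le fun s hs => ?_
      have := length_of_mem_slotList hs
      simp only [slotValueQueries, List.length_append, List.length_map, List.length_cons,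
        List.length_nil]
      omega
    rw [hJ] at h2
    simp only [List.length_cons, List.length_append, List.length_map]
    omega
  have hI : ∀ G : Fin m → E → Prop, (indepQueries (a + b + 1) W e G).length ≤
      m * (1 + (a + b + 2) * (n * n)) := by
    intro G
    unfold indepQueries
    refine (length_flatMap_le (n := 1 + (a + b + 2) * (n * n)) fun l _ => ?_).trans (by simp)
    have h2 : ((slotList (a + b + 1) W).flatMap fun s => slotIndepQueries e G s l).length ≤
        (slotList (a + b + 1) W).length * (n * n) := by
      refine length_flatMap_le fun s hs => ?_
      have := length_of_mem_slotList hs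
      unfold slotIndepQueries
      refine (length_flatMap_le (n := n) fun x _ => ?_).trans ?_
      · rw [List.length_cons, List.length_map]
        omega
      · refine Nat.mul_le_mul_right _ ?_
        rw [List.length_append, List.length_singleton]
        omega
    rw [hJ] at h2
    rw [List.length_cons]
    omega
  refine (OracleProgram.callsAtMost_askGround fun G =>
    (OracleProgram.callsAtMost_askValues fun g =>
      (OracleProgram.callsAtMost_askIndep (n := 1) fun I => ?_).mono
        (Nat.add_le_add_right (hI G) 1)).mono (Nat.add_le_add_right hV _)).mono
          (Nat.add_le_add_right hG _)
  exact fun r => trivial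

end Resources

/-! ### The approximation ratio and the choice of parameters -/

section Main

open scoped Classical ENNReal

variable {E : Type u} {m : ℕ} {M : Fin m → Matroid E} {f : Finset E → ℝ}
  {off : Finset E → PMF (Finset E)}

/-! #### The optimum -/

theorem IsMatchoid.finite_indep {p : ℕ} (hM : IsMatchoid p M) :
    {S : Finset E | MatchoidIndep M S}.Finite := by
  have hfin : (matchoidGround M).Finite := Set.finite_iUnion hM.finite
  refine hfin.toFinset.powerset.finite_toSet.subset fun S hS => ?_
  simpa [← Finset.coe_subset] using hS.1

theorem le_matchoidOptIn {p : ℕ} (hM : IsMatchoid p M) {B : Set E} {S : Finset E}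
    (hS : MatchoidIndep M S) (hSB : (S : Set E) ⊆ B) : f S ≤ matchoidOptIn M f B := by
  refine le_csSup ?_ ⟨S, ⟨hS, hSB⟩, rfl⟩
  exact ((hM.finite_indep.subset fun S hS => hS.1).image f).bddAbove

theorem le_matchoidOpt {p : ℕ} (hM : IsMatchoid p M) {S : Finset E} (hS : MatchoidIndep M S) :
    f S ≤ matchoidOpt M f :=
  le_matchoidOptIn hM hS hS.1

theorem exists_eq_matchoidOpt {p : ℕ} (hM : IsMatchoid p M) :
    ∃ T, MatchoidIndep M T ∧ f T = matchoidOpt M f := by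
  have hne : (f '' {S | MatchoidIndep M S ∧ (S : Set E) ⊆ matchoidGround M}).Nonempty :=
    ⟨_, ∅, ⟨MatchoidIndep.empty, by simp⟩, rfl⟩
  obtain ⟨T, hT, hTf⟩ := hne.csSup_mem ((hM.finite_indep.subset fun S hS => hS.1).image f)
  exact ⟨T, hT.1, hTf⟩

theorem expectedValue_nonneg {μ : PMF (Finset E)} (h : ∀ S ∈ μ.support, 0 ≤ f S) :
    0 ≤ expectedValue μ f := by
  rw [← toReal_mean_ofReal h]
  exact ENNReal.toReal_nonneg

/-! #### The output of the algorithm -/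

/-- The output is at least as good as the solution of the copy and as the offline result on its
buffer `B`. As `T ∩ B` is feasible for the offline problem, its value is at most `1/γ` times the
expected output. -/
theorem mean_finish {p a b : ℕ} {γ : ℝ} (hf : IsNonnegSubmodularOn (matchoidGround M) f)
    (hM : IsMatchoid p M) (hγ : 0 < γ) (hoff : IsOfflineAlgorithm M f γ off)
    {l : List E} (hnd : l.Nodup) (hl : ∀ x ∈ l, x ∈ matchoidGround M) {W : StreamMemory E}
    (hW : W ∈ ((exchangeStreaming E m a b).memoryAfter M f off l).support) :
    (∀ S ∈ (((exchangeStreaming E m a b).finish W).run M f off).support, MatchoidIndep M S) ∧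
    ∀ i < a + b + 1, ∀ T, MatchoidIndep M T →
      ENNReal.ofReal (4 * p * f (memorySlot (a + b + 1) W i).1.toFinset +
        f (T.filter (· ∈ (memorySlot (a + b + 1) W i).2))) ≤
      ENNReal.ofReal (4 * p + 1 / γ) *
        (((exchangeStreaming E m a b).finish W).run M f off).mean fun S => ENNReal.ofReal (f S) := by
  set L := (List.range (a + b + 1)).map fun i : ℕ => memorySlot (a + b + 1) W i with hL
  have hinv : ∀ s ∈ L, MatchoidIndep M s.1.toFinset ∧
      (s.2.toFinset : Set E) ⊆ matchoidGround M := by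
    intro s hs
    obtain ⟨i, hi, rfl⟩ := List.mem_map.1 hs
    obtain ⟨⟨U, h⟩, -⟩ := memorySlot_invariant hf hnd hl hW (List.mem_range.1 hi)
    exact ⟨h.matchoidIndep hl, fun x hx => hl x (h.buffer_seen x (by simpa using hx)).1⟩
  obtain ⟨h1, -, h3⟩ := mean_run_finishLoop (f := f) hoff.feasible
    (fun s hs => (hinv s hs).1) (fun s hs => (hinv s hs).2) (X := ∅) MatchoidIndep.empty
  refine ⟨h1, fun i hi T hT => ?_⟩
  have hmem : memorySlot (a + b + 1) W i ∈ L := List.mem_map.2 ⟨i, List.mem_range.2 hi, rfl⟩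
  obtain ⟨h4, h5⟩ := h3 _ hmem
  obtain ⟨hS, hB⟩ := hinv _ hmem
  set s := memorySlot (a + b + 1) W (i : ℤ)
  set H := ((finishLoop L ∅ : OracleProgram E m (Finset E)).run M f off).mean
    fun S => ENNReal.ofReal (f S) with hH
  change _ ≤ ENNReal.ofReal (4 * p + 1 / γ) * H
  have hTB : f (T.filter (· ∈ s.2)) ≤ matchoidOptIn M f (s.2.toFinset : Set E) := by
    refine le_matchoidOptIn hM ⟨fun x hx => hT.1 ?_, fun l => (hT.2 l).subset ?_⟩ ?_
    · exact (Finset.mem_filter.1 hx).1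
    · exact Set.inter_subset_inter_left _ (Finset.coe_subset.2 (Finset.filter_subset _ _))
    · intro x hx
      simpa using (Finset.mem_filter.1 hx).2
  have hopt : ENNReal.ofReal (γ * f (T.filter (· ∈ s.2))) ≤ H := by
    refine le_trans (ENNReal.ofReal_le_ofReal ?_)
      ((ofReal_expectedValue_le fun S hS => hf.nonneg S (hoff.feasible _ hB S hS).2.1).trans h5)
    exact (mul_le_mul_of_nonneg_left hTB hγ.le).trans (hoff.approx _ hB)
  have hfS : 0 ≤ f s.1.toFinset := hf.nonneg _ hS.1
  have hfT : 0 ≤ f (T.filter (· ∈ s.2)) :=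
    hf.nonneg _ fun x hx => hT.1 (Finset.mem_filter.1 hx).1
  have hγ' : (0 : ℝ) ≤ 1 / γ := by positivity
  have hp : (0 : ℝ) ≤ 4 * p := by positivity
  rw [ENNReal.ofReal_add (mul_nonneg hp hfS) hfT, ENNReal.ofReal_add hp hγ', add_mul]
  refine add_le_add ?_ ?_
  · rw [ENNReal.ofReal_mul hp]
    exact mul_le_mul_right h4 _
  · calc ENNReal.ofReal (f (T.filter (· ∈ s.2)))
        = ENNReal.ofReal (1 / γ) * ENNReal.ofReal (γ * f (T.filter (· ∈ s.2))) := by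
          rw [← ENNReal.ofReal_mul hγ', ← mul_assoc, one_div_mul_cancel hγ.ne', one_mul]
      _ ≤ _ := mul_le_mul_right hopt _

theorem output_indep {p a b : ℕ} {γ : ℝ} (hf : IsNonnegSubmodularOn (matchoidGround M) f)
    (hM : IsMatchoid p M) (hγ : 0 < γ) (hoff : IsOfflineAlgorithm M f γ off)
    {l : List E} (hnd : l.Nodup) (hl : ∀ x ∈ l, x ∈ matchoidGround M) :
    ∀ S ∈ ((exchangeStreaming E m a b).output M f off l).support, MatchoidIndep M S := by
  intro S hS
  obtain ⟨W, hW, hS⟩ := (PMF.mem_support_bind_iff _ _ _).1 hS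
  exact (mean_finish hf hM hγ hoff hnd hl hW).1 S hS

/-- The approximation guarantee of the algorithm. -/
theorem approximation {p k a b : ℕ} {γ : ℝ} (hf : IsNonnegSubmodularOn (matchoidGround M) f)
    (hM : IsMatchoid p M) (hk : ∀ S, MatchoidIndep M S → S.card ≤ k) (hkb : k < 4 ^ b)
    (hγ : 0 < γ) (hoff : IsOfflineAlgorithm M f γ off) {stream : List E}
    (hstream : IsStreamOver (matchoidGround M) stream) :
    (1 - 2 * (1 / 4) ^ a) * matchoidOpt M f ≤ (4 * p + 1 / γ) *
      expectedValue ((exchangeStreaming E m a b).output M f off stream) f := by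
  obtain ⟨hnd, hmem⟩ := hstream
  have hl : ∀ x ∈ stream, x ∈ matchoidGround M := fun x hx => (hmem x).1 hx
  have hind := output_indep (a := a) (b := b) hf hM hγ hoff hnd hl
  have hout0 : ∀ S ∈ ((exchangeStreaming E m a b).output M f off stream).support, 0 ≤ f S :=
    fun S hS => hf.nonneg S (hind S hS).1
  have hev := expectedValue_nonneg hout0
  set ev := expectedValue ((exchangeStreaming E m a b).output M f off stream) f with hev_def
  set opt := matchoidOpt M f with hopt_def
  have hc : 0 ≤ 4 * (p : ℝ) + 1 / γ := by positivity
  obtain ⟨T, hT, hTopt⟩ := exists_eq_matchoidOpt (f := f) hM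
  have hopt0 : 0 ≤ opt := by rw [hopt_def, ← hTopt]; exact hf.nonneg T hT.1
  rcases hopt0.eq_or_lt with hzero | hpos
  · rw [← hzero, mul_zero]
    exact mul_nonneg hc hev
  -- The copy to be analysed has `α * 4 ^ (a + b) ≤ OPT < α * 4 ^ (a + b + 1)`: small enough for `kα
  -- ≤ 4 ^ (-a) * OPT`, and large enough for the bound on the progress that the potential needs.
  set j : ℤ := Int.log 4 opt - (a + b : ℕ) with hj
  set α : ℝ := 4 ^ j with hα_def
  have hα : 0 < α := by positivity
  have hab : α * 4 ^ (a + b) = (4 : ℝ) ^ Int.log 4 opt := by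
    rw [hα_def, ← zpow_natCast, ← zpow_add₀ (by norm_num)]
    congr 1
    omega
  have hle : α * 4 ^ (a + b) ≤ opt := by
    rw [hab]
    have := (Int.zpow_le_iff_le_log (b := 4) (by norm_num) hpos).2 le_rfl
    exact_mod_cast this
  have hlt : opt < 4 ^ (a + b + 1) * α := by
    have h1 : (4 : ℝ) ^ (a + b + 1) * α = 4 ^ (Int.log 4 opt + 1) := by
      rw [pow_succ, zpow_add₀ (by norm_num), ← hab, zpow_one]
      ring
    rw [h1]
    have := (Int.lt_zpow_iff_log_lt (b := 4) (by norm_num) hpos).2 (Int.lt_succ (Int.log 4 opt))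
    exact_mod_cast this
  have hkb' : (k : ℝ) + 1 ≤ 4 ^ b := by exact_mod_cast hkb
  have hpeak_nonneg : 0 ≤ peakOf M f stream :=
    (hf.nonneg ∅ (by simp)).trans (empty_le_peakOf stream)
  -- Here `k + 1 ≤ 4 ^ b` is used: `k` singletons, and one more peak for `f ∅`.
  have hopt_peak : opt ≤ 4 ^ b * peakOf M f stream := by
    have h1 := sub_empty_le_mul_peakOf hk hf hT fun x hx => (hmem x).2 (hT.1 hx)
    rw [hTopt, ← hopt_def] at h1
    have h2 := empty_le_peakOf (M := M) (f := f) stream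
    nlinarith
  have hpeak : 0 < peakOf M f stream := by
    by_contra! h
    have : (4 : ℝ) ^ b * peakOf M f stream ≤ 0 :=
      mul_nonpos_of_nonneg_of_nonpos (by positivity) h
    linarith
  -- This copy is in memory at the end: its threshold is at most the peak, and the peak is at most
  -- OPT.
  have hjL : j ≤ levelOf M f stream := by
    refine (Int.zpow_le_iff_le_log (b := 4) (by norm_num) hpeak).1 ?_
    have h1 : α * 4 ^ b ≤ peakOf M f stream * 4 ^ b := by
      calc α * 4 ^ b ≤ α * 4 ^ (a + b) := by
            gcongr
            · norm_num
            · omega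
        _ ≤ opt := hle
        _ ≤ _ := by rw [mul_comm]; exact hopt_peak
    have := le_of_mul_le_mul_right h1 (by positivity)
    exact_mod_cast this
  have hLj : levelOf M f stream - j ≤ (a + b : ℕ) := by
    obtain ⟨S, hS, hSp⟩ := exists_peakOf_eq (f := f) hl
    have : levelOf M f stream ≤ Int.log 4 opt := by
      refine Int.log_mono_right hpeak ?_
      rw [← hSp]
      exact le_matchoidOpt hM hS
    omega
  obtain ⟨i, hi⟩ := Int.eq_ofNat_of_zero_le (sub_nonneg.2 hjL)
  have hiJ : i < a + b + 1 := by omega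
  have hlaw := map_memorySlot_memoryAfter (off := off) (a := a) (b := b) hf stream j (by omega)
  have hmain := le_mean_instLaw (p := p) (k := k) (a := a) (b := b) hα hM hf hnd hl
    (fun S hS => by
      have h1 := le_matchoidOpt (f := f) hM hS
      have h2 : 0 ≤ f ∅ := hf.nonneg ∅ (by simp)
      linarith) hT (hk T hT) fun t ht => (hmem t).2 (hT.1 ht)
  rw [← hlaw, PMF.mean_map, hTopt, ← hopt_def, hi] at hmain
  have hkα : (0 : ℝ) ≤ k * α := by positivity
  have hbound : ENNReal.ofReal (opt * (1 - (1 / 4) ^ a)) ≤ ENNReal.ofReal (k * α) +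
      ENNReal.ofReal (4 * p + 1 / γ) *
        ((exchangeStreaming E m a b).output M f off stream).mean fun S => ENNReal.ofReal (f S) := by
    refine hmain.trans ?_
    unfold StreamingAlgorithm.output
    rw [PMF.mean_bind, ← PMF.mean_const_mul,
      ← PMF.mean_const ((exchangeStreaming E m a b).memoryAfter M f off stream)
        (ENNReal.ofReal (k * α)), ← PMF.mean_add]
    refine PMF.mean_mono _ fun W hW => ?_
    obtain ⟨⟨U, hinv⟩, -⟩ := memorySlot_invariant hf hnd hl hW hiJ
    rw [add_assoc, ENNReal.ofReal_add hkα (add_nonneg (mul_nonneg (by positivity)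
      (hf.nonneg _ (hinv.matchoidIndep hl).1))
      (hf.nonneg _ fun x hx => hT.1 (Finset.mem_filter.1 hx).1))]
    exact add_le_add_right ((mean_finish hf hM hγ hoff hnd hl hW).2 i hiJ T hT) _
  -- All outputs are independent, hence their values are at most OPT and the mean is finite.
  have hfin : (((exchangeStreaming E m a b).output M f off stream).mean
      fun S => ENNReal.ofReal (f S)) = ENNReal.ofReal ev := by
    rw [hev_def, ← toReal_mean_ofReal hout0, ENNReal.ofReal_toReal]
    refine ne_top_of_le_ne_top (b := ENNReal.ofReal opt) ENNReal.ofReal_ne_top ?_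
    rw [← PMF.mean_const ((exchangeStreaming E m a b).output M f off stream) (ENNReal.ofReal opt)]
    exact PMF.mean_mono _ fun S hS => ENNReal.ofReal_le_ofReal (le_matchoidOpt hM (hind S hS))
  rw [hfin, ← ENNReal.ofReal_mul hc, ← ENNReal.ofReal_add hkα (mul_nonneg hc hev),
    ENNReal.ofReal_le_ofReal_iff (add_nonneg hkα (mul_nonneg hc hev))] at hbound
  -- The second loss of `4 ^ (-a)`, besides that of the random insertions.
  have hkα' : (k : ℝ) * α ≤ (1 / 4) ^ a * opt := by
    have h1 : (1 / 4 : ℝ) ^ a * 4 ^ a = 1 := by rw [← mul_pow]; norm_num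
    calc (k : ℝ) * α ≤ 4 ^ b * α := by gcongr; linarith
      _ = ((1 / 4) ^ a * 4 ^ a) * (4 ^ b * α) := by rw [h1, one_mul]
      _ = (1 / 4) ^ a * (α * 4 ^ (a + b)) := by rw [pow_add]; ring
      _ ≤ _ := by gcongr
  linarith

/-! #### Parameters -/

/-- `4 ^ a` and `4 ^ b` are the first powers of 4 above `2/ε` and `k`, hence at most 4 times as
large. The additive constants in `b + 2` are absorbed by `log k ≥ log 2`, which uses `k ≥ 2`. -/
theorem exists_parameters {k : ℕ} {ε : ℝ} (hk : 2 ≤ k) (hε : 0 < ε) (hε1 : ε < 1) :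
    ∃ a b : ℕ, 2 * (1 / 4 : ℝ) ^ a ≤ ε ∧ k < 4 ^ b ∧ (4 : ℝ) ^ a ≤ 8 / ε ∧
      (4 : ℝ) ^ b ≤ 4 * k ∧ (b : ℝ) + 2 ≤ 7 * Real.log k := by
  have hx : 1 ≤ 2 / ε := by rw [le_div_iff₀ hε]; linarith
  obtain ⟨n, hn1, hn2⟩ := exists_nat_pow_near hx (y := 4) (by norm_num)
  have hk1 : (1 : ℝ) ≤ k := by exact_mod_cast (by omega : 1 ≤ k)
  obtain ⟨t, ht1, ht2⟩ := exists_nat_pow_near hk1 (y := 4) (by norm_num)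
  refine ⟨n + 1, t + 1, ?_, by exact_mod_cast ht2, ?_, ?_, ?_⟩
  · rw [div_lt_iff₀ hε] at hn2
    rw [one_div, inv_pow, ← div_eq_mul_inv, div_le_iff₀ (by positivity)]
    linarith
  · rw [pow_succ]
    calc (4 : ℝ) ^ n * 4 ≤ 2 / ε * 4 := by gcongr
      _ = 8 / ε := by ring
  · rw [pow_succ]
    linarith
  · have hlog := Real.log_le_log (by positivity) ht1
    rw [Real.log_pow] at hlog
    have h4 : Real.log 4 = 2 * Real.log 2 := by
      rw [show (4 : ℝ) = 2 ^ 2 by norm_num, Real.log_pow]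
      norm_num
    have h2 := Real.log_two_gt_d9
    have hk2 : Real.log 2 ≤ Real.log k :=
      Real.log_le_log (by norm_num) (by exact_mod_cast hk)
    rw [h4] at hlog
    have ht0 : (0 : ℝ) ≤ t := by positivity
    push_cast
    nlinarith

/-- The algorithm which stores nothing and returns the empty set. -/
def emptyStreaming (E : Type u) (m : ℕ) : StreamingAlgorithm E m where
  step _ _ := .ret []
  finish _ := .ret ∅
  step_within W e := by
    intro x hx
    change Sum.inl x ∈ ([] : List (E ⊕ Bool)) at hx
    simp at hx
  finish_within W := by
    change ((∅ : Finset E) : Set E) ⊆ _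
    simp

theorem emptyStreaming_memoryAfter (l : List E) :
    (emptyStreaming E m).memoryAfter M f off l = PMF.pure [] := by
  induction l using List.reverseRecOn with
  | nil => rfl
  | append_singleton l e ih =>
    rw [memoryAfter_append_singleton, ih, PMF.pure_bind]
    rfl

theorem emptyStreaming_output (l : List E) :
    (emptyStreaming E m).output M f off l = PMF.pure ∅ := by
  unfold StreamingAlgorithm.output
  rw [emptyStreaming_memoryAfter, PMF.pure_bind]
  rfl

theorem callsAtMost_ret {α : Type u} (x : α) (n : ℕ) :
    (OracleProgram.ret x : OracleProgram E m α).CallsAtMost n := by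
  cases n <;> trivial

/-- The number of calls is polynomial. -/
theorem calls_bound {m k a b w : ℕ} {ε D X V : ℝ} (hX : X = m + k + 1 / ε) (hε : 0 < ε)
    (hk : 1 ≤ k) (hε1 : ε < 1) (ha : (4 : ℝ) ^ a ≤ 8 / ε) (hb : (4 : ℝ) ^ b ≤ 4 * k)
    (hV : V = D * X ^ 4) (hV1 : 1 ≤ V) (hw : ((w + 1 : ℕ) : ℝ) ≤ V) :
    ((m * (w + 1) + (2 + (w + 1) + (a + b + 2) * (3 * (w + 1)) +
      (m * (1 + (a + b + 2) * ((w + 1) * (w + 1))) + 1)) : ℕ) : ℝ) ≤ 100 * D ^ 2 * X ^ 10 ∧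
    ((4 * (a + b + 1) : ℕ) : ℝ) ≤ 100 * D ^ 2 * X ^ 10 := by
  have hε' : (1 : ℝ) ≤ 1 / ε := by rw [le_div_iff₀ hε]; linarith
  have hk' : (1 : ℝ) ≤ k := by exact_mod_cast hk
  have hm' : (0 : ℝ) ≤ m := by positivity
  have hX1 : 1 ≤ X := by linarith
  have hmX : (m : ℝ) ≤ X := by linarith
  have haX : (a : ℝ) ≤ 8 * X := by
    have h1 : (a : ℝ) ≤ 4 ^ a := by exact_mod_cast (Nat.lt_pow_self (by norm_num)).le
    have h2 : 8 / ε = 8 * (1 / ε) := by ring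
    linarith
  have hbX : (b : ℝ) ≤ 4 * X := by
    have h1 : (b : ℝ) ≤ 4 ^ b := by exact_mod_cast (Nat.lt_pow_self (by norm_num)).le
    linarith
  have hJ : (a : ℝ) + b + 2 ≤ 14 * X := by linarith
  have hXV : 1 ≤ X * V := one_le_mul_of_one_le_of_one_le hX1 hV1
  -- The independence queries dominate, with about `m (a + b + 2) (w + 1) ^ 2 ≤ 14 X ^ 2 V ^ 2` of
  -- them. All other terms are compared with the same product.
  have hfinal : X ^ 2 * V ^ 2 = D ^ 2 * X ^ 10 := by rw [hV]; ring
  have hXX : X ≤ X ^ 2 * V ^ 2 := by nlinarith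
  have h1 : (1 : ℝ) ≤ X ^ 2 * V ^ 2 := by linarith
  have hXV2 : X * V ≤ X ^ 2 * V ^ 2 := by nlinarith
  have hV2 : V ≤ X ^ 2 * V ^ 2 := by nlinarith
  refine ⟨?_, ?_⟩
  · set n : ℝ := ((w + 1 : ℕ) : ℝ) with hn
    have hn0 : 0 ≤ n := by positivity
    have e1 : (m : ℝ) * n ≤ X * V := by gcongr
    have e2 : ((a : ℝ) + b + 2) * (3 * n) ≤ 14 * X * (3 * V) := by gcongr
    have e3 : (m : ℝ) * (1 + (a + b + 2) * (n * n)) ≤ X * (1 + 14 * X * (V * V)) := by gcongr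
    have e4 : ((m * (w + 1) + (2 + (w + 1) + (a + b + 2) * (3 * (w + 1)) +
        (m * (1 + (a + b + 2) * ((w + 1) * (w + 1))) + 1)) : ℕ) : ℝ) =
        m * n + (2 + n + (a + b + 2) * (3 * n) + (m * (1 + (a + b + 2) * (n * n)) + 1)) := by
      rw [hn]
      push_cast
      ring
    rw [e4]
    have e5 : X * (1 + 14 * X * (V * V)) = X + 14 * (X ^ 2 * V ^ 2) := by ring
    have e6 : 14 * X * (3 * V) = 42 * (X * V) := by ring
    nlinarith
  · push_cast
    nlinarith

end Main

theorem mainTheorem1 :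
    ∃ (C : ℝ) (d : ℕ), ∀ (E : Type u) (m k : ℕ) (ε : ℝ), 2 ≤ k → 0 < ε →
      ∃ A : StreamingAlgorithm E m,
        ∀ (p : ℕ) (M : Fin m → Matroid E) (f : Finset E → ℝ) (γ : ℝ)
          (off : Finset E → PMF (Finset E)) (stream : List E),
          IsMatchoid p M →
          (∀ S, MatchoidIndep M S → S.card ≤ k) →
          IsNonnegSubmodularOn (matchoidGround M) f →
          0 < γ →
          IsOfflineAlgorithm M f γ off →
          IsStreamOver (matchoidGround M) stream →
          A.UsesSpace M f off stream (C * (k * Real.log k / ε ^ 2)) ∧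
          A.UsesCalls M f off stream ⌊C * (m + k + 1 / ε) ^ d⌋₊ ∧
          (∀ S ∈ (A.output M f off stream).support, MatchoidIndep M S) ∧
          (1 - ε) * matchoidOpt M f ≤
            (4 * p + 1 / γ) * expectedValue (A.output M f off stream) f := by
  -- The space constant is `37632 = 21 * 4 * 64 * 7`, from the bounds on `4 ^ b`, `16 ^ a` and `b +
  -- 2`. One more covers the element being read, and `100 * D ^ 2 * X ^ 10` is the bound on the
  -- calls.
  refine ⟨100 * 37633 ^ 2, 10, fun E m k ε hk hε => ?_⟩
  have hk1 : (1 : ℝ) ≤ k := by exact_mod_cast (by omega : 1 ≤ k)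
  have hlog : 0 ≤ Real.log k := Real.log_nonneg hk1
  have hspace0 : 0 ≤ k * Real.log k / ε ^ 2 := by positivity
  -- For `ε ≥ 1` the left-hand side of the guarantee is not positive, and the empty set is good
  -- enough.
  rcases le_or_gt 1 ε with hε1 | hε1
  · refine ⟨emptyStreaming E m, fun p M f γ off stream hM hkS hf hγ hoff hstream => ?_⟩
    refine ⟨?_, ?_, ?_, ?_⟩
    · intro l _ W hW
      rw [emptyStreaming_memoryAfter, PMF.support_pure, Set.mem_singleton_iff] at hW
      subst hW
      simp only [List.length_nil, Nat.cast_zero]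
      positivity
    · exact ⟨fun _ _ _ _ _ => callsAtMost_ret _ _, fun _ _ => callsAtMost_ret _ _⟩
    · intro S hS
      rw [emptyStreaming_output, PMF.support_pure, Set.mem_singleton_iff] at hS
      subst hS
      exact MatchoidIndep.empty
    · rw [emptyStreaming_output]
      have h0 : 0 ≤ f ∅ := hf.nonneg ∅ (by simp)
      have h1 : 0 ≤ matchoidOpt M f := h0.trans (le_matchoidOpt hM MatchoidIndep.empty)
      have h2 : 0 ≤ expectedValue (PMF.pure ∅) f := by
        refine expectedValue_nonneg fun S hS => ?_
        rw [PMF.support_pure, Set.mem_singleton_iff] at hS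
        rwa [hS]
      have h3 : (0 : ℝ) ≤ 4 * p + 1 / γ := by positivity
      exact (mul_nonpos_of_nonpos_of_nonneg (by linarith) h1).trans (mul_nonneg h3 h2)
  obtain ⟨a, b, ha, hkb, ha', hb', hlogb⟩ := exists_parameters hk hε hε1
  refine ⟨exchangeStreaming E m a b, fun p M f γ off stream hM hkS hf hγ hoff hstream => ?_⟩
  have hsub : ∀ l, l <+: stream → l.Nodup ∧ ∀ x ∈ l, x ∈ matchoidGround M := fun l hl =>
    ⟨hstream.1.sublist hl.sublist, fun x hx => (hstream.2 x).1 (hl.subset hx)⟩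
  have hspace : ∀ l, l <+: stream →
      ∀ W ∈ ((exchangeStreaming E m a b).memoryAfter M f off l).support,
        (W.length : ℝ) ≤ 37632 * (k * Real.log k / ε ^ 2) := by
    intro l hl W hW
    have h1 := length_memoryAfter_le hkS hkb.le hf (hsub l hl).1 (hsub l hl).2 hW
    have h2 : (W.length : ℝ) ≤ 21 * 4 ^ b * 16 ^ a * (b + 2) := by exact_mod_cast h1
    have h16 : (16 : ℝ) ^ a ≤ 64 / ε ^ 2 := by
      calc (16 : ℝ) ^ a = (4 ^ a) ^ 2 := by rw [← pow_mul, mul_comm, pow_mul]; norm_num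
        _ ≤ (8 / ε) ^ 2 := by gcongr
        _ = _ := by ring
    calc (W.length : ℝ) ≤ 21 * 4 ^ b * 16 ^ a * (b + 2) := h2
      _ ≤ 21 * (4 * k) * (64 / ε ^ 2) * (7 * Real.log k) := by gcongr
      _ = _ := by ring
  set X : ℝ := m + k + 1 / ε with hX
  have hε' : (1 : ℝ) ≤ 1 / ε := by rw [le_div_iff₀ hε]; linarith
  have hm0 : (0 : ℝ) ≤ m := by positivity
  have hX1 : 1 ≤ X := by linarith
  have hbig : 37632 * (k * Real.log k / ε ^ 2) + 1 ≤ 37633 * X ^ 4 := by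
    have h1 : Real.log k ≤ X := (Real.log_le_self (by linarith)).trans (by linarith)
    have h2 : (k : ℝ) ≤ X := by linarith
    have h3 : 1 / ε ≤ X := by linarith
    have h4 : k * Real.log k / ε ^ 2 ≤ X ^ 4 := by
      calc k * Real.log k / ε ^ 2 = k * Real.log k * (1 / ε) ^ 2 := by ring
        _ ≤ X * X * X ^ 2 := by gcongr
        _ = X ^ 4 := by ring
    have h5 : 1 ≤ X ^ 4 := one_le_pow₀ hX1
    linarith
  have hcalls : ∀ l, l <+: stream →
      ∀ W ∈ ((exchangeStreaming E m a b).memoryAfter M f off l).support, _ :=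
    fun l hl W hW => calls_bound (m := m) (k := k) (a := a) (b := b) (w := W.length) (D := 37633)
      hX hε (by omega) hε1 ha' hb' rfl (by
        have : 1 ≤ X ^ 4 := one_le_pow₀ hX1
        linarith) (by
        push_cast
        exact (add_le_add_left (hspace l hl W hW) 1).trans hbig)
  refine ⟨?_, ⟨?_, ?_⟩, output_indep hf hM hγ hoff (hsub _ List.prefix_rfl).1
    (hsub _ List.prefix_rfl).2, ?_⟩
  · intro l hl W hW
    refine (hspace l hl W hW).trans ?_
    gcongr
    norm_num
  · intro l e hle W hW
    have hl : l <+: stream := (List.prefix_append l [e]).trans hle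
    exact (streamStep_callsAtMost a b e le_rfl).mono (Nat.le_floor (hcalls l hl W hW).1)
  · intro W hW
    refine (finishLoop_callsAtMost _ _).mono ?_
    rw [List.length_map, List.length_range]
    exact Nat.le_floor (hcalls stream List.prefix_rfl W hW).2
  · have h1 := approximation (a := a) (b := b) hf hM hkS hkb hγ hoff hstream
    have h2 : 0 ≤ matchoidOpt M f :=
      (hf.nonneg ∅ (by simp)).trans (le_matchoidOpt hM MatchoidIndep.empty)
    refine le_trans ?_ h1
    gcongr
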